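/- Let $G$ be a finite connected multigraph with vertex set $V(G)$ and edge set $E(G)$, with an arbitrary orientation of its edges ($e$ runs from $e^-$ to $e^+$). **Ceresa period of $G$.** Let $R=\mathbb Z[x_e \mid e\in E(G)]$, $N=\operatorname{Hom}(H_1(G,\mathbb Z),\mathbb Z)$ and $N_R=\operatorname{Hom}(H_1(G,\mathbb Z),R)$. Let $[\cdot,\cdot]$ be the $R$-valued pairing on $C_1(G,\mathbb Z)$ with $[e,e]=x_e$ and $[e,e']=0$ for $e\ne e'$, let $\pi(c)=[c,\cdot]\in N_R$ for $c\in C_1(G,\mathbb Z)$, and let $\Lambda=\pi(H_1(G,\mathbb Z))$. Let $C_{1,q}=N\otimes_{\mathbb Z} C_q$, where $C_q$ is the free abelian group on the ordered simplices $(u_0,\dots,u_q)\in N_R^{q+1}$ modulo simultaneous translation by $\Lambda$, with the usual boundary map $\partial$, and let $\Theta\colon C_{1,2}\to\bigwedge^3_R N_R$, $\Theta(n\otimes(u_0,u_1,u_2))=n\wedge(u_1-u_0)\wedge(u_2-u_0)$. Put $\mathscr P=\Theta(\ker\partial)$. For a vertex $v$ put $$\operatorname{Cer}_v(G)=\sum_{e}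 x_e^{-1}\pi(e)\otimes\big((\pi(\delta_e),\pi(\delta_e+e))+(-\pi(\delta_e),-\pi(\delta_e+e))\big),$$ where $\delta_e$ is a path from $v$ to $e^-$. This chain is a boundary, and $\alpha(G)$ is the class of $\Theta(\Sigma)$ in $\bigwedge^3 N_R/\mathscr P$ for any $\Sigma\in C_{1,2}$ with $\partial\Sigma=\operatorname{Cer}_v(G)$. **Ceresa cycle of a tropical curve.** A length function $\ell\colon E(G)\to\mathbb R_{>0}$ determines a tropical curve (metric graph) $C$ overlying $G$. Replacing $R$ by $\mathbb R$ and $x_e$ by $\ell(e)$ gives the tropical Jacobian $\operatorname{Jac}(C)=H^1(C,\mathbb R)/\Lambda_C$, a real torus with integral structure $H^1(C,\mathbb Z)$, and for $v\in C$ the Abel--Jacobi map $\Phi_v\colon C\to\operatorname{Jac}(C)$. The tropical Ceresa cycle of $C$ based at $v$ is the tropical $1$-cycle $\Phi_{v,*}C-[-1]_*\Phi_{v,*}C$. A tropical $1$-cycle in $X=\operatorname{Jac}(C)$ is algebraically trivial if it lies in the group generated by the cycles $p_*(W\cdot q^*(b_0-b_1))$, where $B$ is a (connected, compact, smooth) tropical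 curve, $b_0,b_1\in B$, $W$ is a tropical $2$-cycle in $X\times B$, and $p,q$ are the projections of $X\times B$ to $X$ and $B$. A property holds for a very general tropical curve overlying $G$ if it holds for every curve corresponding to a point outside some countable union of hypersurfaces of the moduli space $\mathbb R_{>0}^{E(G)}/\operatorname{Aut}(G)$. **Claim.** 1. If $\alpha(G)\neq 0$ (for some basepoint), then for a very general tropical curve $C$ overlying $G$ the tropical Ceresa cycle of $C$ is algebraically nontrivial, for every basepoint $v\in C$. 2. If $G$ has the complete graph $K_4$ or the graph $L_3$ (a triangle with all three edges doubled) as a minor, then $\alpha(G)\ne0$ (for every basepoint); consequently, for a very general tropical curve overlying $G$ the tropical Ceresa cycle is algebraically nontrivial, for every basepoint. -/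

import Mathlib

open scoped BigOperators Pointwise

noncomputable section

/-! ### Multigraphs -/

/-- A multigraph with vertex set `V` and edge set `E` (loops and parallel edges allowed), together
with an arbitrary orientation of its edges. -/
structure MultiGraph (V E : Type*) where
  /-- the tail `e⁻` of an edge -/
  tail : E → V
  /-- the head `e⁺` of an edge -/
  head : E → V

namespace MultiGraph

variable {V E : Type*}

/-- Two vertices are joined by some edge from `S`. -/
def AdjVia (G : MultiGraph V E) (S : Set E) (a b : V) : Prop :=
  ∃ e ∈ S, (G.tail e = a ∧ G.head e = b) ∨ (G.tail e = b ∧ G.head e = a)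

/-- Connectedness (a connected graph has at least one vertex). -/
def Connected (G : MultiGraph V E) : Prop :=
  Nonempty V ∧ ∀ a b : V, Relation.ReflTransGen (G.AdjVia Set.univ) a b

/-- Graph automorphisms: permutations of vertices and edges that preserve incidence
(the orientation need not be preserved). -/
def IsAut (G : MultiGraph V E) (σ : Equiv.Perm V) (τ : Equiv.Perm E) : Prop :=
  ∀ e, (G.tail (τ e) = σ (G.tail e) ∧ G.head (τ e) = σ (G.head e)) ∨
    (G.tail (τ e) = σ (G.head e) ∧ G.head (τ e) = σ (G.tail e))

/-- `H` is a minor of `G`: there are pairwise disjoint nonempty branch sets in `G`, one for each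
vertex of `H`, and distinct edges of `G`, one for each edge of `H`, joining the corresponding branch
sets; every branch set is connected through edges inside it that are not among the chosen ones (so
that contracting those edges and deleting everything else yields `H`). -/
def IsMinor {V' E' : Type*} (H : MultiGraph V' E') (G : MultiGraph V E) : Prop :=
  ∃ (br : V' → Set V) (ψ : E' → E),
    (∀ a, (br a).Nonempty) ∧
    (∀ a b, a ≠ b → Disjoint (br a) (br b)) ∧
    Function.Injective ψ ∧
    (∀ f, (G.tail (ψ f) ∈ br (H.tail f) ∧ G.head (ψ f) ∈ br (H.head f)) ∨
      (G.tail (ψ f) ∈ br (H.head f) ∧ G.head (ψ f) ∈ br (H.tail f))) ∧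
    ∀ a, ∀ x ∈ br a, ∀ y ∈ br a, Relation.ReflTransGen
      (G.AdjVia {e | e ∉ Set.range ψ ∧ G.tail e ∈ br a ∧ G.head e ∈ br a}) x y

/-- The complete graph on four vertices. -/
def K4 : MultiGraph (Fin 4) (Fin 6) where
  tail := ![0, 0, 0, 1, 1, 2]
  head := ![1, 2, 3, 2, 3, 3]

/-- The graph `L₃`: a triangle with every edge doubled. -/
def L3 : MultiGraph (Fin 3) (Fin 6) where
  tail := ![0, 0, 1, 1, 2, 2]
  head := ![1, 1, 2, 2, 0, 0]

/-! ### Homology, length pairing and the Jacobian data -/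

variable [Fintype E]

/-- The simplicial boundary `C₁(G, ℤ) → C₀(G, ℤ)`, `e ↦ e⁺ - e⁻`. -/
def bdry (G : MultiGraph V E) : (E → ℤ) →ₗ[ℤ] (V →₀ ℤ) :=
  Fintype.linearCombination ℤ
    (fun e => Finsupp.single (G.head e) (1 : ℤ) - Finsupp.single (G.tail e) (1 : ℤ))

/-- `H₁(G, ℤ) ⊆ C₁(G, ℤ)`. -/
abbrev H1 (G : MultiGraph V E) : Submodule ℤ (E → ℤ) := LinearMap.ker G.bdry

/-- `H¹(G, A) = Hom(H₁(G, ℤ), A)`.  For `A = ℤ` this is `N`, and in general it is `N_A`. -/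
abbrev Coh (G : MultiGraph V E) (A : Type*) [CommRing A] : Type _ := G.H1 →ₗ[ℤ] A

/-- The natural map `N → N_A`. -/
def cohCast (G : MultiGraph V E) (A : Type*) [CommRing A] : G.Coh ℤ →+ G.Coh A where
  toFun n := (Int.castAddHom A).toIntLinearMap.comp n
  map_zero' := by ext; simp
  map_add' := by intros; ext; simp

/-- The length pairing on 1-chains: `[e, e] = x e` and `[e, e'] = 0` for `e ≠ e'`. -/
def lengthPairing {A : Type*} [CommRing A] (x c d : E → A) : A := ∑ e, x e * c e * d e

/-- `π : C₁(G, A) → N_A`, `c ↦ [c, ·]`. -/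
def proj (G : MultiGraph V E) {A : Type*} [CommRing A] (x : E → A) : (E → A) →+ G.Coh A where
  toFun c :=
    { toFun := fun γ => lengthPairing x c (fun e => ((γ : E → ℤ) e : A))
      map_add' := by
        intro γ γ'
        simp [lengthPairing, mul_add, Finset.sum_add_distrib]
      map_smul' := by
        intro k γ
        simp only [lengthPairing, SetLike.val_smul, Pi.smul_apply, smul_eq_mul, Int.cast_mul,
          zsmul_eq_mul, Finset.mul_sum, eq_intCast, Int.cast_id]
        exact Finset.sum_congr rfl fun e _ => by ring }
  map_zero' := by ext; simp [lengthPairing]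
  map_add' := by
    intro c d
    ext γ
    simp [lengthPairing, mul_add, add_mul, Finset.sum_add_distrib]

/-- `π` of an integral 1-chain. -/
def projInt (G : MultiGraph V E) {A : Type*} [CommRing A] (x : E → A) : (E → ℤ) →+ G.Coh A where
  toFun c := G.proj x (fun e => (c e : A))
  map_zero' := by
    rw [← (G.proj x).map_zero]
    congr 1
    ext e
    simp
  map_add' c d := by
    rw [← map_add]
    congr 1
    ext e
    simp

/-- The lattice `Λ = π(H₁(G, ℤ)) ⊆ N_A`. -/
def lattice (G : MultiGraph V E) {A : Type*} [CommRing A] (x : E → A) : AddSubgroup (G.Coh A) :=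
  G.H1.toAddSubgroup.map (G.projInt x)

/-- The class `γ ↦ γ e` in `N`; it is `x_e⁻¹ π(e)`. -/
def edgeCoord (G : MultiGraph V E) (e : E) : G.Coh ℤ :=
  (LinearMap.proj e).comp G.H1.subtype

/-- `π(e)` for an edge `e`, namely `γ ↦ x_e γ_e`. -/
def edgeProj (G : MultiGraph V E) {A : Type*} [CommRing A] (x : E → A) (e : E) : G.Coh A :=
  x e • G.cohCast A (G.edgeCoord e)

theorem exists_pathChain (G : MultiGraph V E) (hG : G.Connected) (a b : V) :
    ∃ δ : E → ℤ, G.bdry δ = Finsupp.single b 1 - Finsupp.single a 1 := by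
  classical
  have key : ∀ e, G.bdry (Pi.single e 1) =
      Finsupp.single (G.head e) 1 - Finsupp.single (G.tail e) 1 := by
    intro e
    simp [bdry]
  induction hG.2 a b with
  | refl => exact ⟨0, by simp⟩
  | tail _ h ih =>
    obtain ⟨δ, hδ⟩ := ih
    obtain ⟨e, -, ⟨rfl, rfl⟩ | ⟨rfl, rfl⟩⟩ := h
    · exact ⟨δ + Pi.single e 1, by rw [map_add, hδ, key]; abel⟩
    · exact ⟨δ - Pi.single e 1, by rw [map_sub, hδ, key]; abel⟩

/-- A path from `a` to `b`, as an integral 1-chain with boundary `b - a`; any two choices differ by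
an element of `H₁(G, ℤ)`. -/
def pathChain (G : MultiGraph V E) (hG : G.Connected) (a b : V) : E → ℤ :=
  (G.exists_pathChain hG a b).choose

theorem bdry_pathChain (G : MultiGraph V E) (hG : G.Connected) (a b : V) :
    G.bdry (G.pathChain hG a b) = Finsupp.single b 1 - Finsupp.single a 1 :=
  (G.exists_pathChain hG a b).choose_spec

end MultiGraph

/-! ### Ordered simplices modulo a lattice, and chains with coefficients -/

namespace LatticeChain

variable {M N : Type*} [AddCommGroup M] [AddCommGroup N]

/-- The diagonal copy of `Λ` in `M^{q+1}`. -/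
def diag (Λ : AddSubgroup M) (q : ℕ) : AddSubgroup (Fin (q + 1) → M) :=
  Λ.map (Pi.constAddMonoidHom (Fin (q + 1)) M)

/-- Ordered `q`-simplices `(u₀, …, u_q)` of `M`, modulo simultaneous translation by `Λ`. -/
abbrev Simplex (Λ : AddSubgroup M) (q : ℕ) : Type _ := (Fin (q + 1) → M) ⧸ diag Λ q

/-- The class of `(u₀, …, u_q)`. -/
def mk (Λ : AddSubgroup M) {q : ℕ} (u : Fin (q + 1) → M) : Simplex Λ q := QuotientAddGroup.mk u

/-- Omission of the `i`-th vertex. -/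
def face (Λ : AddSubgroup M) (q : ℕ) (i : Fin (q + 2)) : Simplex Λ (q + 1) →+ Simplex Λ q :=
  QuotientAddGroup.map _ _
    { toFun := fun u j => u (i.succAbove j)
      map_zero' := rfl
      map_add' := fun _ _ => rfl }
    (by
      rintro _ ⟨l, hl, rfl⟩
      exact ⟨l, hl, rfl⟩)

variable (N) in
/-- Chains: `N ⊗ (free abelian group on simplices)`, i.e. finite formal sums `∑ n ⊗ σ`; the element
`n ⊗ σ` is `Finsupp.single σ n`. -/
abbrev Chain (Λ : AddSubgroup M) (q : ℕ) : Type _ := Simplex Λ q →₀ N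

variable (N) in
/-- `∂ (n ⊗ (u₀, …, u_{q+1})) = ∑ (-1)^i n ⊗ (u₀, …, û_i, …, u_{q+1})`. -/
def boundary (Λ : AddSubgroup M) (q : ℕ) : Chain N Λ (q + 1) →+ Chain N Λ q :=
  ∑ i : Fin (q + 2), ((-1 : ℤ) ^ (i : ℕ)) • Finsupp.mapDomain.addMonoidHom (face Λ q i)

theorem boundary_single_one (Λ : AddSubgroup M) (n : N) (a b c : M) :
    boundary N Λ 1 (Finsupp.single (mk Λ ![a, b, c]) n) =
      Finsupp.single (mk Λ ![b, c]) n - Finsupp.single (mk Λ ![a, c]) n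
        + Finsupp.single (mk Λ ![a, b]) n := by
  have h0 : face Λ 1 0 (mk Λ ![a, b, c]) = mk Λ ![b, c] := by
    change QuotientAddGroup.mk _ = QuotientAddGroup.mk _
    congr 1
  have h1 : face Λ 1 1 (mk Λ ![a, b, c]) = mk Λ ![a, c] := by
    change QuotientAddGroup.mk _ = QuotientAddGroup.mk _
    congr 1; ext j; fin_cases j <;> rfl
  have h2 : face Λ 1 2 (mk Λ ![a, b, c]) = mk Λ ![a, b] := by
    change QuotientAddGroup.mk _ = QuotientAddGroup.mk _
    congr 1; ext j; fin_cases j <;> rfl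
  simp [boundary, Fin.sum_univ_three, Finsupp.mapDomain_single, h0, h1, h2, sub_eq_add_neg]

theorem mk_translate (Λ : AddSubgroup M) (a b : M) {l : M} (hl : l ∈ Λ) :
    mk Λ ![a + l, b + l] = mk Λ ![a, b] := by
  symm
  apply (QuotientAddGroup.eq).2
  refine ⟨l, hl, ?_⟩
  ext j; fin_cases j <;> simp

/-- Let `φ(tail e)`, `φ(head e)` be the classes of `u e`, `u' e`, and suppose that the vectors `n e`
balance at every vertex.  Then the sum of the `n e ⊗ (u e, u' e)` and of their reflections is a
boundary. -/
theorem exists_filling (Λ : AddSubgroup M) {V E : Type*} [Fintype E] (tail head : E → V)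
    (φ : V → M ⧸ Λ) (u u' : E → M) (n : E → N)
    (hu : ∀ e, (u e : M ⧸ Λ) = φ (tail e)) (hu' : ∀ e, (u' e : M ⧸ Λ) = φ (head e))
    (hn : ∑ e, (Finsupp.single (head e) (n e) - Finsupp.single (tail e) (n e)) = 0) :
    ∃ S : Chain N Λ 2, boundary N Λ 1 S =
      ∑ e, (Finsupp.single (mk Λ ![u e, u' e]) (n e)
        - Finsupp.single (mk Λ ![-u e, -u' e]) (-n e)) := by
  classical
  let B : AddSubgroup (Chain N Λ 1) := (boundary N Λ 1).range
  let s : M → M → N → Chain N Λ 1 ⧸ B := fun a b m =>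
    (Finsupp.single (mk Λ ![a, b]) m : Chain N Λ 1)
  have tri : ∀ a b c m, s a c m = s a b m + s b c m := by
    intro a b c m
    have : ((boundary N Λ 1 (Finsupp.single (mk Λ ![a, b, c]) m) : Chain N Λ 1) :
        Chain N Λ 1 ⧸ B) = 0 := (QuotientAddGroup.eq_zero_iff _).2 ⟨_, rfl⟩
    rw [boundary_single_one, QuotientAddGroup.mk_add, QuotientAddGroup.mk_sub] at this
    change s b c m - s a c m + s a b m = 0 at this
    rw [← sub_eq_zero, ← neg_eq_zero, ← this]; abel
  have deg : ∀ a m, s a a m = 0 := by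
    intro a m
    have := tri a a a m
    simpa using this
  have tr : ∀ a b l m, l ∈ Λ → s (a + l) (b + l) m = s a b m := by
    intro a b l m hl
    simp only [s, mk_translate Λ a b hl]
  let h : M → N → Chain N Λ 1 ⧸ B := fun a m => s 0 a m + s 0 (-a) m
  have hper : ∀ a l m, l ∈ Λ → h (a + l) m = h a m := by
    intro a l m hl
    have e1 := tri 0 l (a + l) m
    have e2 := tri 0 (-l) (-(a + l)) m
    have e3 : s l (a + l) m = s 0 a m := by simpa using tr 0 a l m hl
    have e4 : s (-l) (-(a + l)) m = s 0 (-a) m := by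
      have := tr 0 (-a) (-l) m (Λ.neg_mem hl)
      rw [zero_add] at this
      rw [← this]; congr 1; abel
    have e5 : s 0 l m + s 0 (-l) m = 0 := by
      have a1 := tr 0 (-l) l m hl
      have a2 := tri 0 l 0 m
      rw [zero_add, neg_add_cancel] at a1
      rw [deg] at a2
      rw [← a1, ← a2]
    simp only [h, e1, e2, e3, e4]
    rw [show s 0 l m + s 0 a m + (s 0 (-l) m + s 0 (-a) m)
      = (s 0 l m + s 0 (-l) m) + (s 0 a m + s 0 (-a) m) by abel, e5, zero_add]
  have hper' : ∀ (a b : M) (m : N), (a : M ⧸ Λ) = (b : M ⧸ Λ) → h a m = h b m := by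
    intro a b m hab
    have : -a + b ∈ Λ := QuotientAddGroup.eq.1 hab
    have := hper a _ m this
    rw [← this]; congr 1; abel
  let H : V → N →+ Chain N Λ 1 ⧸ B := fun w =>
    { toFun := fun m => h (φ w).out m
      map_zero' := by simp [h, s]
      map_add' := by
        intro m m'
        simp only [h, s, Finsupp.single_add, QuotientAddGroup.mk_add]
        abel }
  have hH : ∀ (w : V) (a : M) (m : N), (a : M ⧸ Λ) = φ w → h a m = H w m := by
    intro w a m haw
    exact hper' _ _ _ (haw.trans (QuotientAddGroup.out_eq' (φ w)).symm)
  suffices hz : ((∑ e, (Finsupp.single (mk Λ ![u e, u' e]) (n e)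
        - Finsupp.single (mk Λ ![-u e, -u' e]) (-n e)) : Chain N Λ 1) : Chain N Λ 1 ⧸ B) = 0 by
    obtain ⟨S, hS⟩ := (QuotientAddGroup.eq_zero_iff _).1 hz
    exact ⟨S, hS⟩
  have hsum := congrArg (Finsupp.liftAddHom H) hn
  rw [map_zero, map_sum] at hsum
  rw [← hsum]
  change QuotientAddGroup.mk' B _ = _
  rw [map_sum]
  refine Finset.sum_congr rfl fun e _ => ?_
  rw [map_sub, map_sub, Finsupp.liftAddHom_apply_single, Finsupp.liftAddHom_apply_single,
    ← hH _ _ _ (hu e), ← hH _ _ _ (hu' e), Finsupp.single_neg, map_neg]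
  change s (u e) (u' e) (n e) - - s (-u e) (-u' e) (n e) = _
  have t1 := tri 0 (u e) (u' e) (n e)
  have t2 := tri 0 (-u e) (-u' e) (n e)
  simp only [h, t1, t2]
  abel

end LatticeChain

/-! ### The Ceresa period of a graph -/

namespace MultiGraph

variable {V E : Type*} [Fintype E]

/-- The polynomial ring `R = ℤ[x_e | e ∈ E(G)]`. -/
abbrev EdgeRing (E : Type*) : Type _ := MvPolynomial E ℤ

/-- The universal edge lengths. -/
def univLength (e : E) : EdgeRing E := MvPolynomial.X e

/-- `N_R`. -/
abbrev UCoh (G : MultiGraph V E) : Type _ := G.Coh (EdgeRing E)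

/-- The lattice `Λ ⊆ N_R`. -/
abbrev uLattice (G : MultiGraph V E) : AddSubgroup G.UCoh := G.lattice univLength

/-- The chain group `C_{1,q}(Jac G)`. -/
abbrev UChain (G : MultiGraph V E) (q : ℕ) : Type _ := LatticeChain.Chain (G.Coh ℤ) G.uLattice q

/-- The boundary `C_{1,q+1}(Jac G) → C_{1,q}(Jac G)`. -/
abbrev uBoundary (G : MultiGraph V E) (q : ℕ) : G.UChain (q + 1) →+ G.UChain q :=
  LatticeChain.boundary (G.Coh ℤ) G.uLattice q

/-- `π(δ_e)`, for a path `δ_e` from the basepoint `v` to `e⁻`. -/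
def uStart (G : MultiGraph V E) (hG : G.Connected) (v : V) (e : E) : G.UCoh :=
  G.projInt univLength (G.pathChain hG v (G.tail e))

/-- `π(δ_e + e)`. -/
def uEnd (G : MultiGraph V E) (hG : G.Connected) (v : V) (e : E) : G.UCoh :=
  G.uStart hG v e + G.edgeProj univLength e

/-- The universal Ceresa cycle `∑ Φ_v(e) - [-1]_* ∑ Φ_v(e)` with
`Φ_v(e) = x_e⁻¹ π(e) ⊗ (π(δ_e), π(δ_e + e))`. -/
def uCeresa (G : MultiGraph V E) (hG : G.Connected) (v : V) : G.UChain 1 :=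
  ∑ e, (Finsupp.single (LatticeChain.mk G.uLattice ![G.uStart hG v e, G.uEnd hG v e])
        (G.edgeCoord e)
      - Finsupp.single (LatticeChain.mk G.uLattice ![-G.uStart hG v e, -G.uEnd hG v e])
        (-G.edgeCoord e))

/-- On a simplex: `n ↦ n ∧ (u₁ - u₀) ∧ (u₂ - u₀) ∈ ⋀³ N_R`. -/
def thetaLift (G : MultiGraph V E) (u : Fin 3 → G.UCoh) :
    G.Coh ℤ →+ ⋀[EdgeRing E]^3 G.UCoh :=
  (((exteriorPower.ιMulti (EdgeRing E) 3).toMultilinearMap.toLinearMap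
      ![0, u 1 - u 0, u 2 - u 0] 0).toAddMonoidHom).comp (G.cohCast (EdgeRing E))

theorem thetaLift_apply (G : MultiGraph V E) (u : Fin 3 → G.UCoh) (n : G.Coh ℤ) :
    G.thetaLift u n = exteriorPower.ιMulti (EdgeRing E) 3
      ![G.cohCast (EdgeRing E) n, u 1 - u 0, u 2 - u 0] := by
  change exteriorPower.ιMulti (EdgeRing E) 3 (Function.update _ 0 _) = _
  congr 1
  ext j
  fin_cases j <;> rfl

/-- `Θ : C_{1,2}(Jac G) → ⋀³ N_R`, `n ⊗ (u₀, u₁, u₂) ↦ n ∧ (u₁ - u₀) ∧ (u₂ - u₀)`. -/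
def theta (G : MultiGraph V E) : G.UChain 2 →+ ⋀[EdgeRing E]^3 G.UCoh :=
  Finsupp.liftAddHom fun σ : LatticeChain.Simplex G.uLattice 2 =>
    Quotient.liftOn' σ (fun u => G.thetaLift u) (by
      intro u u' h
      obtain ⟨l, -, hl⟩ := QuotientAddGroup.leftRel_apply.1 h
      have hj : ∀ j, u' j = u j + l := fun j => by
        have := congrFun hl j
        simp only [Pi.constAddMonoidHom_apply, Function.const_apply, Pi.add_apply,
          Pi.neg_apply] at this
        rw [this]; abel
      simp only [thetaLift, hj, add_sub_add_right_eq_sub])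

theorem theta_single (G : MultiGraph V E) (n : G.Coh ℤ) (a b c : G.UCoh) :
    G.theta (Finsupp.single (LatticeChain.mk G.uLattice ![a, b, c]) n) =
      exteriorPower.ιMulti (EdgeRing E) 3 ![G.cohCast (EdgeRing E) n, b - a, c - a] := by
  rw [theta, Finsupp.liftAddHom_apply_single]
  exact G.thetaLift_apply _ _

/-- `𝒫 = Θ(H_{1,2}(Jac G))`, the image of the group of `(1,2)`-cycles. -/
def periods (G : MultiGraph V E) : AddSubgroup (⋀[EdgeRing E]^3 G.UCoh) :=
  (G.uBoundary 1).ker.map G.theta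

theorem exists_uFilling (G : MultiGraph V E) (hG : G.Connected) (v : V) :
    ∃ S : G.UChain 2, G.uBoundary 1 S = G.uCeresa hG v := by
  classical
  have hedge : ∀ e, G.edgeProj univLength e = G.projInt univLength (Pi.single e 1) := by
    intro e
    ext γ
    simp [edgeProj, edgeCoord, cohCast, projInt, proj, lengthPairing, Pi.single_apply]
  refine LatticeChain.exists_filling G.uLattice G.tail G.head
    (fun w => (G.projInt univLength (G.pathChain hG v w) : G.UCoh ⧸ G.uLattice))
    (G.uStart hG v) (G.uEnd hG v) G.edgeCoord (fun e => rfl) (fun e => ?_) ?_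
  · refine QuotientAddGroup.eq.2 ⟨G.pathChain hG v (G.head e)
      - (G.pathChain hG v (G.tail e) + Pi.single e 1), ?_, ?_⟩
    · change G.bdry _ = 0
      rw [map_sub, map_add, bdry_pathChain, bdry_pathChain]
      simp [bdry]
    · rw [uEnd, uStart, hedge, map_sub, map_add]; abel
  · ext w γ
    have hγ : G.bdry γ = 0 := γ.2
    have := DFunLike.congr_fun hγ w
    simp only [bdry, Fintype.linearCombination_apply, Finsupp.coe_finsetSum, Finset.sum_apply,
      Finsupp.smul_apply, Finsupp.sub_apply, Finsupp.single_apply, Finsupp.coe_zero,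
      Pi.zero_apply] at this
    simp only [Finsupp.coe_finsetSum, Finset.sum_apply, Finsupp.sub_apply, LinearMap.sum_apply,
      LinearMap.sub_apply, Finsupp.single_apply, Finsupp.coe_zero, Pi.zero_apply,
      LinearMap.zero_apply]
    rw [← this]
    refine Finset.sum_congr rfl fun e _ => ?_
    by_cases h1 : G.head e = w <;> by_cases h2 : G.tail e = w <;> simp [h1, h2, edgeCoord]

/-- The Ceresa period `α(G)` with basepoint `v`: the class of `Θ(Σ)` in `⋀³ N_R / 𝒫`, for a chain
`Σ` with `∂Σ` the Ceresa cycle (two such chains differ by a cycle, so the class does not depend on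
the choice). -/
def ceresaPeriod (G : MultiGraph V E) (hG : G.Connected) (v : V) :
    (⋀[EdgeRing E]^3 G.UCoh) ⧸ G.periods :=
  QuotientAddGroup.mk (G.theta (G.exists_uFilling hG v).choose)

end MultiGraph

/-! ### Rational polytopes -/

namespace Trop

section Polytope

variable {U : Type*} [AddCommGroup U] [Module ℝ U]

/-- A rational polytope with respect to the lattice `L`: a nonempty convex hull of finitely many
points that is cut out by finitely many half-spaces `f ≤ c` with `f` integral on `L`, `c ∈ ℝ`. -/
def IsRationalPolytope (L : AddSubgroup U) (P : Set U) : Prop :=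
  (∃ S : Finset U, S.Nonempty ∧ P = convexHull ℝ (S : Set U)) ∧
    ∃ H : Finset ((U →ₗ[ℝ] ℝ) × ℝ),
      (∀ h ∈ H, ∀ x ∈ L, ∃ k : ℤ, h.1 x = k) ∧ P = {x | ∀ h ∈ H, h.1 x ≤ h.2}

/-- The dimension of a polytope. -/
def dim (P : Set U) : ℕ := Module.finrank ℝ (vectorSpan ℝ P)

/-- Nonempty faces of a polytope: the loci where a linear functional is maximal. -/
def IsFace (F P : Set U) : Prop :=
  F.Nonempty ∧ ∃ f : U →ₗ[ℝ] ℝ, F = {x | x ∈ P ∧ ∀ y ∈ P, f y ≤ f x}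

/-- `ν` is a primitive integral normal vector of `P` relative to its codimension-one face `F`: it
generates the lattice of `P` modulo that of `F`, and points from `F` into `P`. -/
def IsPrimitiveNormal (L : AddSubgroup U) (F P : Set U) (ν : U) : Prop :=
  ν ∈ L ∧ ν ∈ vectorSpan ℝ P ∧
    (∀ z ∈ L, z ∈ vectorSpan ℝ P → ∃ k : ℤ, z - k • ν ∈ vectorSpan ℝ F) ∧
    ∃ x ∈ F, ∃ ε : ℝ, 0 < ε ∧ x + ε • ν ∈ P

end Polytope

/-! ### One-dimensional weighted complexes in a torus -/

section Torus

variable {M : Type*} [AddCommGroup M] [Module ℝ M]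

/-- Pure one-dimensional weighted complexes in the torus `M / Λ`, up to refinement.  Such a complex
is recorded by its weight function on `M / Λ`, which is considered up to changes at finitely many
points (the points outside the interiors of the one-dimensional cells). -/
abbrev OneChain (Λ : AddSubgroup M) : Type _ := (Filter.cofinite : Filter (M ⧸ Λ)).Germ ℝ

/-- The weight function on `M / Λ` of the image of a segment `σ ⊆ M` of weight one: the number of
points of `σ` above a given point. -/
def segWeight (Λ : AddSubgroup M) (σ : Set M) (p : M ⧸ Λ) : ℝ :=
  ({x | x ∈ σ ∧ (x : M ⧸ Λ) = p} : Set M).ncard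

/-- The lattice index of an integral vector `n`: the largest `k` such that `n` is `k` times an
integral vector (and `0` for `n = 0`).  It is the multiplicity with which a segment is pushed
forward along an affine map that sends the unit tangent vector to `n`. -/
def latticeIndex (N : AddSubgroup M) (n : M) : ℕ := sSup {k : ℕ | ∃ m ∈ N, k • m = n}

end Torus

/-! ### Two-dimensional cycles in the product of a torus and a tropical curve -/

section Family

variable {M : Type*} [AddCommGroup M] [Module ℝ M]

/-- The integral structure `N ⊕ ℤ` of `M × ℝ`. -/
def prodLattice (N : AddSubgroup M) : AddSubgroup (M × ℝ) :=
  N.prod (AddSubgroup.zmultiples (1 : ℝ))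

variable {VB EB : Type}

/-- The vertex of the half-edge `(e, end)`: `false` is the tail end and `true` the head end. -/
def hVert (B : MultiGraph VB EB) (h : EB × Bool) : VB := if h.2 then B.head h.1 else B.tail h.1

/-- The coordinate in `[0, m e]` of the end of the half-edge. -/
def hLevel (m : EB → ℝ) (h : EB × Bool) : ℝ := if h.2 then m h.1 else 0

/-- The sign by which the coordinate of the edge is multiplied to point away from the end. -/
def hSign (h : EB × Bool) : ℝ := if h.2 then -1 else 1

/-- The facets, weights, sides and normals of a weighted rational polyhedral complex of pure
dimension two in `(M / Λ) × B`, where `B` is the tropical curve with model `(B, m)`.  Every facet is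
given by a lift to `M × [0, m e] ⊆ M × ℝ` for an edge `e`. -/
structure SurfaceData (N : AddSubgroup M) (m : EB → ℝ) where
  /-- the index set of the facets -/
  ι : Type
  fin : Fintype ι
  /-- the edge over which the facet lies -/
  edge : ι → EB
  /-- a lift of the facet -/
  poly : ι → Set (M × ℝ)
  /-- the weight of the facet -/
  weight : ι → ℤ
  /-- the one-dimensional faces of the facet -/
  sides : ι → Finset (Set (M × ℝ))
  /-- primitive normal vectors of the facet at its sides -/
  normal : ι → Set (M × ℝ) → M × ℝ
  rational : ∀ i, IsRationalPolytope (prodLattice N) (poly i)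
  dim_poly : ∀ i, dim (poly i) = 2
  poly_subset : ∀ i, ∀ y ∈ poly i, 0 ≤ y.2 ∧ y.2 ≤ m (edge i)
  mem_sides : ∀ i F, F ∈ sides i ↔ IsFace F (poly i) ∧ dim F = 1
  normal_spec : ∀ i, ∀ F ∈ sides i, IsPrimitiveNormal (prodLattice N) F (poly i) (normal i F)

namespace SurfaceData

variable {N : AddSubgroup M} {m : EB → ℝ}

instance (W : SurfaceData N m) : Fintype W.ι := W.fin

open Classical in
/-- The weighted sum of the primitive normal vectors, over all facets above the edge `e` and all
their sides that agree with `τ` modulo `Λ`. -/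
def normalSum (W : SurfaceData N m) (Λ : AddSubgroup M) (e : EB) (τ : Set (M × ℝ)) : M × ℝ :=
  ∑ i with W.edge i = e,
    ∑ F ∈ W.sides i with ∃ l ∈ Λ, F = (fun y : M × ℝ => (y.1 + l, y.2)) '' τ,
      W.weight i • W.normal i F

/-- The same sum for a segment `τ ⊆ M`, placed in the fibre over the end of the half-edge `h`. -/
def endSum (W : SurfaceData N m) (Λ : AddSubgroup M) (h : EB × Bool) (τ : Set M) : M × ℝ :=
  W.normalSum Λ h.1 ((fun x : M => (x, hLevel m h)) '' τ)

/-- The balancing condition at every one-dimensional cell of `(M / Λ) × B`.  Over the interior of an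
edge the integral tangent space is `N ⊕ ℤ`.  At a vertex `b` of valence `r` the curve is locally
the union of the rays spanned by the standard basis vectors in `ℝ^r / (1, …, 1)`, with lattice
`ℤ^r / (1, …, 1)`; so the `M`-component of the sum of the normals must be tangent to `τ`, and the
outgoing slope must be the same along all half-edges at `b`. -/
def Balanced [Fintype EB] (W : SurfaceData N m) (B : MultiGraph VB EB) (Λ : AddSubgroup M) :
    Prop :=
  (∀ (e : EB) (τ : Set (M × ℝ)), ¬ τ ⊆ {y | y.2 = 0} → ¬ τ ⊆ {y | y.2 = m e} →
      W.normalSum Λ e τ ∈ vectorSpan ℝ τ) ∧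
    ∀ (b : VB) (τ : Set M),
      (letI := Classical.decEq VB
        ∑ h : EB × Bool with hVert B h = b, (W.endSum Λ h τ).1) ∈ vectorSpan ℝ τ ∧
      ∀ h h' : EB × Bool, hVert B h = b → hVert B h' = b →
        hSign h * (W.endSum Λ h τ).2 = hSign h' * (W.endSum Λ h' τ).2

open Classical in
/-- The weight function of the cycle `p_*(W · q^*(b))`, for the projections `p`, `q` of
`(M / Λ) × B`, where `b` is the end of the half-edge `h`.  The divisor `b` on `B` is cut out near `b`
by the function that has slope one along `h` and vanishes on the other half-edges, hence a side in
the fibre over `b` of a facet of weight `w` contributes with weight `w` times the outgoing slope of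
the primitive normal.  For balanced `W` this depends only on `b`. -/
def fibre (W : SurfaceData N m) (Λ : AddSubgroup M) (h : EB × Bool) (p : M ⧸ Λ) : ℝ :=
  ∑ i with W.edge i = h.1, ∑ F ∈ W.sides i with F ⊆ {y | y.2 = hLevel m h},
    W.weight i * (hSign h * (W.normal i F).2) * segWeight Λ (Prod.fst '' F) p

end SurfaceData

/-- The elementary algebraic equivalences `p_*(W · q^*(b₀ - b₁))`, for a tropical curve `B`, a
tropical 2-cycle `W` in `(M / Λ) × B` and points `b₀, b₁` of `B`.  The model of `B` is taken fine
enough to contain the two points among its vertices, and `W` is subdivided accordingly. -/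
def IsElementary (N Λ : AddSubgroup M) (A : OneChain Λ) : Prop :=
  ∃ (VB EB : Type) (_ : Fintype VB) (_ : Fintype EB) (B : MultiGraph VB EB) (m : EB → ℝ)
    (W : SurfaceData N m) (h₀ h₁ : EB × Bool),
    B.Connected ∧ (∀ e, 0 < m e) ∧ W.Balanced B Λ ∧
      A = ((fun p => W.fibre Λ h₀ p - W.fibre Λ h₁ p : M ⧸ Λ → ℝ) : OneChain Λ)

/-- Algebraic triviality: membership in the subgroup generated by the elementary equivalences. -/
def AlgTrivial (N Λ : AddSubgroup M) (A : OneChain Λ) : Prop :=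
  A ∈ AddSubgroup.closure {D : OneChain Λ | IsElementary N Λ D}

end Family

end Trop

/-! ### The tropical Ceresa cycle and very general tropical curves -/

namespace MultiGraph

variable {V E : Type*}

/-- Length functions `E(G) → ℝ_{>0}`. -/
abbrev Lengths (E : Type*) : Type _ := E → Set.Ioi (0 : ℝ)

/-- The edge lengths as real numbers. -/
def realLen (len : Lengths E) (e : E) : ℝ := (len e : ℝ)

/-- The action of `Aut(G)` on length functions, as an equivalence relation. -/
def lengthSetoid (G : MultiGraph V E) : Setoid (Lengths E) where
  r len len' := ∃ σ τ, G.IsAut σ τ ∧ ∀ e, len' e = len (τ e)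
  iseqv :=
    { refl := fun len => ⟨Equiv.refl V, Equiv.refl E, fun _ => Or.inl ⟨rfl, rfl⟩, fun _ => rfl⟩
      symm := by
        rintro len len' ⟨σ, τ, h, hl⟩
        refine ⟨σ.symm, τ.symm, fun e => ?_, fun e => by rw [hl, Equiv.apply_symm_apply]⟩
        have := h (τ.symm e)
        rw [Equiv.apply_symm_apply] at this
        rcases this with ⟨a, b⟩ | ⟨a, b⟩
        · exact Or.inl ⟨by rw [a, Equiv.symm_apply_apply], by rw [b, Equiv.symm_apply_apply]⟩
        · exact Or.inr ⟨by rw [b, Equiv.symm_apply_apply], by rw [a, Equiv.symm_apply_apply]⟩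
      trans := by
        rintro len len' len'' ⟨σ, τ, h, hl⟩ ⟨σ', τ', h', hl'⟩
        refine ⟨σ'.trans σ, τ'.trans τ, fun e => ?_, fun e => by rw [hl', hl]; rfl⟩
        simp only [Equiv.trans_apply]
        rcases h (τ' e) with ⟨a, b⟩ | ⟨a, b⟩ <;> rcases h' e with ⟨a', b'⟩ | ⟨a', b'⟩ <;>
          simp [a, b, a', b'] }

/-- The moduli space `ℝ_{>0}^{E(G)} / Aut(G)` of tropical curves overlying `G`. -/
def Moduli (G : MultiGraph V E) : Type _ := Quotient G.lengthSetoid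

/-- The point of the moduli space given by a length function. -/
def toModuli (G : MultiGraph V E) (len : Lengths E) : G.Moduli := Quotient.mk G.lengthSetoid len

/-- Hypersurfaces in the moduli space: images of zero loci of nonzero polynomials. -/
def IsHypersurface (G : MultiGraph V E) (S : Set G.Moduli) : Prop :=
  ∃ f : MvPolynomial E ℝ, f ≠ 0 ∧
    S = G.toModuli '' {len | MvPolynomial.eval (realLen len) f = 0}

/-- A property (of the tropical curve with model `(G, len)`) holds for a very general tropical curve
overlying `G`: it holds away from a countable union of hypersurfaces in the moduli space. -/
def VeryGeneral (G : MultiGraph V E) (p : Lengths E → Prop) : Prop :=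
  ∃ 𝓗 : Set (Set G.Moduli), 𝓗.Countable ∧ (∀ S ∈ 𝓗, G.IsHypersurface S) ∧
    ∀ len : Lengths E, G.toModuli len ∉ ⋃₀ 𝓗 → p len

variable [Fintype E]

/-- The integral structure on `H¹(C, ℝ)`: classes with integral values on `H₁(C, ℤ)`. -/
def integral (G : MultiGraph V E) : AddSubgroup (G.Coh ℝ) where
  carrier := {u | ∀ γ, ∃ k : ℤ, u γ = k}
  zero_mem' := fun _ => ⟨0, by simp⟩
  add_mem' := by
    intro a b ha hb γ
    obtain ⟨k, hk⟩ := ha γ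
    obtain ⟨l, hl⟩ := hb γ
    exact ⟨k + l, by simp [hk, hl]⟩
  neg_mem' := by
    intro a ha γ
    obtain ⟨k, hk⟩ := ha γ
    exact ⟨-k, by simp [hk]⟩

/-- The lattice `Λ_C ⊆ H¹(C, ℝ)`; the tropical Jacobian of `C` is `H¹(C, ℝ) / Λ_C`. -/
abbrev jacLattice (G : MultiGraph V E) (len : Lengths E) : AddSubgroup (G.Coh ℝ) :=
  G.lattice (realLen len)

/-- Points of the tropical curve `C` with model `(G, len)`: the point at distance `s` from the tail
of the edge `e`, for `0 ≤ s ≤ len e`.  (A vertex is represented by every incident edge end.) -/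
structure CurvePoint (len : Lengths E) where
  edge : E
  pos : ℝ
  pos_nonneg : 0 ≤ pos
  pos_le : pos ≤ realLen len edge

open Classical in
/-- A lift to `H¹(C, ℝ)` of the image of `e⁻` under the Abel-Jacobi map based at the point `v`:
apply `π` to the path that runs from `v` back to the tail of its edge, and from there to `e⁻`. -/
def ajStart (G : MultiGraph V E) (hG : G.Connected) (len : Lengths E) (v : CurvePoint len)
    (e : E) : G.Coh ℝ :=
  G.proj (realLen len) (fun f =>
    (G.pathChain hG (G.tail v.edge) (G.tail e) f : ℝ)
      - if f = v.edge then v.pos / realLen len v.edge else 0)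

/-- The weight function of the push-forward `Φ_{v,*} C` of the fundamental cycle of `C`: the edge `e`
is mapped to the segment from `π(δ_e)` to `π(δ_e + e)`, its unit tangent vector to
`len(e)⁻¹ π(e)`. -/
def ajCycle (G : MultiGraph V E) (hG : G.Connected) (len : Lengths E) (v : CurvePoint len)
    (p : G.Coh ℝ ⧸ G.jacLattice len) : ℝ :=
  ∑ e, Trop.latticeIndex G.integral (G.cohCast ℝ (G.edgeCoord e)) *
    Trop.segWeight (G.jacLattice len)
      (segment ℝ (G.ajStart hG len v e)
        (G.ajStart hG len v e + G.edgeProj (realLen len) e)) p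

/-- The tropical Ceresa cycle `Φ_{v,*} C - [-1]_* Φ_{v,*} C` in the Jacobian of `C`. -/
def tropCeresa (G : MultiGraph V E) (hG : G.Connected) (len : Lengths E) (v : CurvePoint len) :
    Trop.OneChain (G.jacLattice len) :=
  ((fun p => G.ajCycle hG len v p - G.ajCycle hG len v (-p) :
    G.Coh ℝ ⧸ G.jacLattice len → ℝ) : Trop.OneChain (G.jacLattice len))

/-- The tropical curve with model `(G, len)` has algebraically nontrivial Ceresa cycle, whatever the
basepoint. -/
def CeresaNontrivial (G : MultiGraph V E) (hG : G.Connected) (len : Lengths E) : Prop :=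
  ∀ v : CurvePoint len,
    ¬ Trop.AlgTrivial G.integral (G.jacLattice len) (G.tropCeresa hG len v)

end MultiGraph

end

/-! The first claim is proved by calibration. A `Calibration` gives each segment from `a` to `b`
with integral coefficient `n` a value that is additive in `n`, invariant under the lattice, and a
cocycle on every triangle whose plane contains `n`.

The value descends to germs of 1-chains (`Calibration.eq_zero_of_mem_graph`): the germ read just
past a point in a given direction recovers the multiplicity of each piece of a subdivision. The
value also vanishes on elementary equivalences (`Calibration.mem_graph_of_isElementary`). On a facet
of the surface, with `u` the direction of a side and `ν` its primitive normal, the vector `dt(ν) u -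
dt(u) ν` is one horizontal lattice vector common to all sides, so coning from a point of the facet
gives the boundary the value zero. Balancing cancels the interior sides, and what survives says that
the fibres over the two ends of an edge of the parameter curve have equal values. Connectedness does
the rest.

The calibration used is `segPeriod`. It closes a segment up by means of chosen representatives
modulo the lattice and applies `Θ`, modulo the group generated by all `2 n ∧ π(h) ∧ π(k)`. A
quadratic correction removes a term that is a cocycle only up to half a period. Its coboundary on a
triangle is `n ∧ (b - a) ∧ (c - a)`, which is zero exactly where a calibration needs it. On the
Ceresa cycle it takes the value `-2 ∑ n_e ∧ u(e⁻) ∧ u(e⁺)` (`IsAnisotropic.sum_segPeriod`), and the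
computation is the same for real and for universal edge lengths. Over the polynomial ring this form
is a period if and only if `α(G) = 0` (`ceresaPeriod_eq_zero_iff`). When no nonzero integral
polynomial vanishes at the lengths, the polynomial ring embeds in `ℝ`, so algebraic triviality would
force `α(G) = 0`. Only countably many polynomials have to be avoided.

For the second claim, set two edge lengths to one and all others to zero. By the multiplicativity of
2 × 2 determinants, vanishing of `α(G)` then becomes a linear problem over `ℤ` (`CeresaSplits`): the
tensor of the Ceresa form can be replaced by one with values in bivectors of cycles. Solvability
passes to minors (`IsMinorModel.ceresaSplits`). For `K₄` and `L₃` the linear system is inconsistent.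
-/

namespace Trop

/-! ### Full lattices: finiteness, primitive vectors, rational subspaces. -/

section Lattice

variable {M : Type*} [AddCommGroup M] [Module ℝ M]

/-- A full lattice in a finite-dimensional real vector space: the vectors whose coordinates in some
basis are integers. -/
def IsFullLattice (Λ : AddSubgroup M) : Prop :=
  ∃ (k : ℕ) (b : Module.Basis (Fin k) ℝ M), ∀ x, x ∈ Λ ↔ ∀ j, ∃ z : ℤ, b.repr x j = z

theorem IsFullLattice.prodLattice {N : AddSubgroup M} (hN : IsFullLattice N) :
    IsFullLattice (prodLattice N) := by
  obtain ⟨k, b, hb⟩ := hN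
  refine ⟨k + 1, (b.prod (Module.Basis.singleton (Fin 1) ℝ)).reindex finSumFinEquiv,
    fun x => ?_⟩
  rw [Trop.prodLattice, AddSubgroup.mem_prod, hb, finSumFinEquiv.symm.forall_congr_left]
  simp only [Module.Basis.repr_reindex_apply, Equiv.symm_apply_apply, Equiv.symm_symm, Sum.forall,
    Module.Basis.prod_repr_inl, Module.Basis.prod_repr_inr, Module.Basis.singleton_repr,
    AddSubgroup.mem_zmultiples_iff]
  refine and_congr Iff.rfl ⟨fun ⟨z, hz⟩ _ => ⟨z, by rw [← hz]; simp⟩, fun h => ?_⟩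
  obtain ⟨z, hz⟩ := h 0
  exact ⟨z, by rw [hz]; simp⟩

/-- In a lattice basis the coordinates are integers bounded in terms of `v`, `m`, `n`, `A` and `B`.
-/
theorem IsFullLattice.finite_strip {Λ : AddSubgroup M} (hΛ : IsFullLattice Λ) (v m n : M)
    (A B : ℝ) :
    {l | l ∈ Λ ∧ ∃ t s : ℝ, |t| ≤ A ∧ |s| ≤ B ∧ l = v + t • m + s • n}.Finite := by
  obtain ⟨k, b, hb⟩ := hΛ
  let C : Fin k → ℝ := fun j => |b.repr v j| + A * |b.repr m j| + B * |b.repr n j|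
  have hfin : (Set.pi Set.univ fun j : Fin k => Set.Icc (-⌈C j⌉) ⌈C j⌉).Finite :=
    Set.Finite.pi fun j => Set.finite_Icc _ _
  refine (hfin.image fun z : Fin k → ℤ => b.equivFun.symm fun j => (z j : ℝ)).subset ?_
  rintro l ⟨hl, t, s, ht, hs, rfl⟩
  choose z hz using (hb _).1 hl
  refine ⟨z, ?_, ?_⟩
  · intro j _
    have h1 : |(z j : ℝ)| ≤ C j := by
      rw [← hz j]
      simp only [map_add, map_smul, Finsupp.add_apply, Finsupp.smul_apply, smul_eq_mul, C]
      refine (abs_add_le _ _).trans (add_le_add ((abs_add_le _ _).trans (add_le_add le_rfl ?_)) ?_)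
      · rw [abs_mul]; exact mul_le_mul_of_nonneg_right ht (abs_nonneg _)
      · rw [abs_mul]; exact mul_le_mul_of_nonneg_right hs (abs_nonneg _)
    have h2 := abs_le.1 (h1.trans (Int.le_ceil _))
    exact ⟨by exact_mod_cast h2.1, by exact_mod_cast h2.2⟩
  · apply b.equivFun.injective
    rw [LinearEquiv.apply_symm_apply]
    ext j
    rw [← hz j]; rfl

theorem IsFullLattice.finite_line {Λ : AddSubgroup M} (hΛ : IsFullLattice Λ) {n : M} (hn : n ≠ 0)
    (a : M) (p : M ⧸ Λ) (A : ℝ) :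
    {t : ℝ | |t| ≤ A ∧ ((a + t • n : M) : M ⧸ Λ) = p}.Finite := by
  obtain ⟨q, rfl⟩ := QuotientAddGroup.mk_surjective p
  refine Set.Finite.of_finite_image (f := fun t : ℝ => -q + (a + t • n))
    ((hΛ.finite_strip (-q + a) n 0 A 0).subset ?_) ?_
  · rintro _ ⟨t, ⟨ht, h⟩, rfl⟩
    exact ⟨QuotientAddGroup.eq.1 h.symm, t, 0, ht, by simp, by simp [add_assoc]⟩
  · intro t _ s _ h
    exact smul_left_injective ℝ hn (add_left_cancel (add_left_cancel h))

open Filter Topology in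
theorem eventually_pos_notMem {s : Set ℝ} (hs : s.Finite) : ∀ᶠ ε in 𝓝[>] (0 : ℝ), ε ∉ s := by
  have h : ∀ᶠ ε in 𝓝 (0 : ℝ), ε ∉ s \ {0} :=
    (hs.subset Set.sdiff_subset).isClosed.isOpen_compl.mem_nhds (by simp)
  filter_upwards [h.filter_mono nhdsWithin_le_nhds, self_mem_nhdsWithin] with ε h1 h2 h3
  exact h1 ⟨h3, ne_of_gt h2⟩

open Filter Topology in
theorem eventually_pos_lt {c : ℝ} (hc : 0 < c) : ∀ᶠ ε in 𝓝[>] (0 : ℝ), ε < c :=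
  (gt_mem_nhds hc).filter_mono nhdsWithin_le_nhds

open Filter Topology in
theorem IsFullLattice.eventually_ne {Λ : AddSubgroup M} (hΛ : IsFullLattice Λ) {n : M}
    (hn : n ≠ 0) (a : M) (p : M ⧸ Λ) :
    ∀ᶠ ε in 𝓝[>] (0 : ℝ), ((a + ε • n : M) : M ⧸ Λ) ≠ p := by
  filter_upwards [eventually_pos_notMem (hΛ.finite_line hn a p 1), self_mem_nhdsWithin,
    eventually_pos_lt one_pos] with ε h1 h2 h3 h4
  exact h1 ⟨by rw [abs_of_pos h2]; exact h3.le, h4⟩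

-- A coincidence produces a lattice vector in a bounded strip, and by independence that vector
-- determines `ε`. So only finitely many `ε` are bad, uniformly in `t`: a point pushed off `q` along
-- `n` misses the whole segment in direction `m`.
open Filter Topology in
theorem IsFullLattice.eventually_transversal {Λ : AddSubgroup M} (hΛ : IsFullLattice Λ) {m n : M}
    (h : LinearIndependent ℝ ![m, n]) (a q : M) (A : ℝ) :
    ∀ᶠ ε in 𝓝[>] (0 : ℝ), ∀ t : ℝ, |t| ≤ A →
      ((a + t • m : M) : M ⧸ Λ) ≠ ((q + ε • n : M) : M ⧸ Λ) := by
  have hfin := hΛ.finite_strip (-a + q) m n A 1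
  have hbad : {ε : ℝ | |ε| ≤ 1 ∧ ∃ t : ℝ, |t| ≤ A ∧
      ((a + t • m : M) : M ⧸ Λ) = ((q + ε • n : M) : M ⧸ Λ)}.Finite := by
    classical
    let S := {l | l ∈ Λ ∧ ∃ t s : ℝ, |t| ≤ A ∧ |s| ≤ 1 ∧ l = (-a + q) + t • m + s • n}
    have : ∀ ε : {ε : ℝ // |ε| ≤ 1 ∧ ∃ t : ℝ, |t| ≤ A ∧
      ((a + t • m : M) : M ⧸ Λ) = ((q + ε • n : M) : M ⧸ Λ)}, ∃ t : ℝ,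
        (-a + q) + t • m + ε.1 • n ∈ S := by
      rintro ⟨ε, h1, t, h2, h3⟩
      refine ⟨-t, ?_, -t, ε, by rwa [abs_neg], h1, rfl⟩
      have := QuotientAddGroup.eq.1 h3
      convert this using 1
      rw [neg_smul]; abel
    choose f hf using this
    have : Finite S := hfin
    refine Set.finite_coe_iff.1 (Finite.of_injective (fun ε => (⟨_, hf ε⟩ : S)) ?_)
    intro ε ε' he
    have he' := congrArg Subtype.val he
    simp only [add_assoc, add_right_inj] at he'
    have := LinearIndependent.pair_iff.1 h (f ε - f ε') (ε.1 - ε'.1) (by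
      rw [sub_smul, sub_smul, ← sub_eq_zero.2 he']; abel)
    exact Subtype.ext (sub_eq_zero.1 this.2)
  filter_upwards [eventually_pos_notMem hbad, self_mem_nhdsWithin,
    eventually_pos_lt one_pos] with ε h1 h2 h3 t ht h4
  exact h1 ⟨by rw [abs_of_pos h2]; exact h3.le, t, ht, h4⟩

/-- Primitive vectors of `N`: nonzero, and generating `N ∩ ℝ n`. -/
def IsPrimitive (N : AddSubgroup M) (n : M) : Prop :=
  n ∈ N ∧ n ≠ 0 ∧ ∀ r : ℝ, r • n ∈ N → ∃ z : ℤ, r = z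

theorem IsPrimitive.neg {N : AddSubgroup M} {n : M} (h : IsPrimitive N n) : IsPrimitive N (-n) :=
  ⟨N.neg_mem h.1, neg_ne_zero.2 h.2.1, fun r hr => by
    obtain ⟨z, hz⟩ := h.2.2 (-r) (by rwa [neg_smul, ← smul_neg])
    exact ⟨-z, by push_cast; rw [← hz, neg_neg]⟩⟩

theorem IsPrimitive.eq_or_eq_neg {N : AddSubgroup M} {n n' : M} (h : IsPrimitive N n)
    (h' : IsPrimitive N n') {r : ℝ} (hr : n' = r • n) : n' = n ∨ n' = -n := by
  have hr0 : r ≠ 0 := by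
    rintro rfl
    exact h'.2.1 (by rw [hr, zero_smul])
  have h1 : n = r⁻¹ • n' := by rw [hr, inv_smul_smul₀ hr0]
  obtain ⟨z, hz⟩ := h.2.2 r (hr ▸ h'.1)
  obtain ⟨w, hw⟩ := h'.2.2 r⁻¹ (h1 ▸ h.1)
  have hzw : z * w = 1 := by
    have : (z : ℝ) * w = 1 := by rw [← hz, ← hw, mul_inv_cancel₀ hr0]
    exact_mod_cast this
  rcases Int.eq_one_or_neg_one_of_mul_eq_one hzw with rfl | rfl
  · left; rw [hr, hz]; simp
  · right; rw [hr, hz]; simp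

theorem IsPrimitive.linearIndependent {N : AddSubgroup M} {n n' : M} (h : IsPrimitive N n)
    (h' : IsPrimitive N n') (h1 : n' ≠ n) (h2 : n' ≠ -n) : LinearIndependent ℝ ![n, n'] := by
  refine (LinearIndependent.pair_iff' h.2.1).2 fun r hr => ?_
  rcases h.eq_or_eq_neg h' hr.symm with h3 | h3
  exacts [h1 h3, h2 h3]

/-- A nonzero lattice vector is a positive integral multiple of a primitive one. -/
theorem IsFullLattice.exists_primitive {N : AddSubgroup M} (hN : IsFullLattice N) {w : M}
    (hw : w ∈ N) (hw0 : w ≠ 0) : ∃ n, IsPrimitive N n ∧ ∃ k : ℕ, 0 < k ∧ w = k • n := by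
  obtain ⟨k, b, hb⟩ := hN
  obtain ⟨j, hj⟩ : ∃ j, b.repr w j ≠ 0 := by
    by_contra! h
    exact hw0 (b.repr.map_eq_zero_iff.1 (Finsupp.ext h))
  -- The real multiples of `w` that lie in `N` are detected by one nonzero coordinate `zw`, which
  -- embeds them in `zw⁻¹ ℤ`. They therefore form a cyclic group, and a generator gives the
  -- primitive vector.
  let S : AddSubgroup ℝ := N.comap (LinearMap.toSpanSingleton ℝ M w).toAddMonoidHom
  have hS : ∀ r, r ∈ S ↔ r • w ∈ N := fun r => Iff.rfl
  obtain ⟨zw, hzw⟩ := (hb w).1 hw j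
  let D : AddSubgroup ℤ := S.comap
    ((AddMonoidHom.mulLeft (zw : ℝ)⁻¹).comp (Int.castAddHom ℝ))
  have hD : ∀ z : ℤ, z ∈ D ↔ ((zw : ℝ)⁻¹ * z) • w ∈ N := fun z => Iff.rfl
  obtain ⟨d, hd⟩ := Int.subgroup_cyclic D
  have hzw0 : (zw : ℝ) ≠ 0 := hzw ▸ hj
  have hSD : ∀ r : ℝ, r • w ∈ N → ∃ z : ℤ, r = (zw : ℝ)⁻¹ * (z * d) := by
    intro r hr
    obtain ⟨z, hz⟩ := (hb _).1 hr j
    rw [map_smul, Finsupp.smul_apply, hzw, smul_eq_mul] at hz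
    have hr' : r = (zw : ℝ)⁻¹ * z := by rw [← hz]; field_simp
    have : z ∈ D := by rw [hD, ← hr']; exact hr
    rw [hd, ← AddSubgroup.zmultiples_eq_closure, AddSubgroup.mem_zmultiples_iff] at this
    obtain ⟨y, rfl⟩ := this
    exact ⟨y, by rw [hr']; simp⟩
  obtain ⟨y, hy⟩ := hSD 1 (by rwa [one_smul])
  have hyd : (zw : ℝ) = y * d := by
    have := congrArg (fun t => (zw : ℝ) * t) hy
    simpa [mul_inv_cancel_left₀ hzw0] using this
  have hy0 : (y : ℝ) ≠ 0 := fun h => hzw0 (by rw [hyd, h, zero_mul])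
  have hd0 : (d : ℝ) ≠ 0 := fun h => hzw0 (by rw [hyd, h, mul_zero])
  have hprim : IsPrimitive N ((y : ℝ)⁻¹ • w) := by
    refine ⟨?_, smul_ne_zero (inv_ne_zero hy0) hw0, fun r hr => ?_⟩
    · have : d ∈ D := by rw [hd]; exact AddSubgroup.subset_closure rfl
      rw [hD] at this
      convert this using 2
      rw [hyd]; field_simp
    · rw [smul_smul] at hr
      obtain ⟨z, hz⟩ := hSD _ hr
      refine ⟨z, ?_⟩
      rw [hyd] at hz
      field_simp at hz
      linarith
  rcases lt_or_gt_of_ne (show y ≠ 0 by exact_mod_cast hy0) with hneg | hpos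
  · refine ⟨_, hprim.neg, y.natAbs, by omega, ?_⟩
    rw [← Nat.cast_smul_eq_nsmul ℝ, Nat.cast_natAbs, abs_of_neg hneg, smul_neg, smul_smul]
    push_cast
    rw [neg_mul, mul_inv_cancel₀ hy0]; simp
  · refine ⟨_, hprim, y.natAbs, by omega, ?_⟩
    rw [← Nat.cast_smul_eq_nsmul ℝ, Nat.cast_natAbs, abs_of_pos hpos, smul_smul,
      mul_inv_cancel₀ hy0, one_smul]

theorem latticeIndex_nsmul {N : AddSubgroup M} {n : M} (hn : IsPrimitive N n) (k : ℕ) (hk : 0 < k) :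
    latticeIndex N (k • n) = k := by
  have hb : ∀ j ∈ {j : ℕ | ∃ m ∈ N, j • m = k • n}, j ≤ k := by
    rintro j ⟨m, hm, hj⟩
    have hj0 : j ≠ 0 := by
      rintro rfl
      rw [zero_smul, eq_comm, ← Nat.cast_smul_eq_nsmul ℝ, smul_eq_zero] at hj
      rcases hj with h | h
      · exact hk.ne' (by exact_mod_cast h)
      · exact hn.2.1 h
    have hj1 : (j : ℝ) ≠ 0 := by exact_mod_cast hj0
    have hm' : m = ((k : ℝ) / j) • n := by
      rw [← Nat.cast_smul_eq_nsmul ℝ, ← Nat.cast_smul_eq_nsmul ℝ] at hj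
      rw [div_eq_inv_mul, mul_smul, ← hj, inv_smul_smul₀ hj1]
    obtain ⟨z, hz⟩ := hn.2.2 _ (hm' ▸ hm)
    have hz' : (k : ℝ) = z * j := by rw [← hz]; field_simp
    have hz2 : (k : ℤ) = z * j := by exact_mod_cast hz'
    have hzpos : 0 < z := by
      by_contra! h
      have : z * (j : ℤ) ≤ 0 := mul_nonpos_of_nonpos_of_nonneg h (by positivity)
      omega
    have : (j : ℤ) ≤ k := by rw [hz2]; nlinarith
    exact_mod_cast this
  exact le_antisymm (csSup_le ⟨k, n, hn.1, rfl⟩ hb) (le_csSup ⟨k, hb⟩ ⟨n, hn.1, rfl⟩)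

theorem latticeIndex_zero {M : Type*} [AddCommGroup M] (N : AddSubgroup M) :
    latticeIndex N 0 = 0 := by
  rw [latticeIndex, show {k : ℕ | ∃ m ∈ N, k • m = 0} = Set.univ from
    Set.eq_univ_of_forall fun k => ⟨0, N.zero_mem, smul_zero k⟩]
  -- Every `k` is admissible for the zero vector, and `sSup` of an unbounded set of naturals is
  -- zero.
  exact Nat.sSup_of_not_bddAbove (by simp)

/-- A rational subspace that contains a nonzero vector contains a nonzero lattice vector. -/
theorem IsFullLattice.exists_mem_of_rational {L : AddSubgroup M} (hL : IsFullLattice L)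
    (H : Set (M →ₗ[ℝ] ℝ)) (hH : ∀ h ∈ H, ∀ x ∈ L, ∃ k : ℤ, h x = k) {v : M} (hv0 : v ≠ 0)
    (hv : ∀ h ∈ H, h v = 0) : ∃ w ∈ L, w ≠ 0 ∧ ∀ h ∈ H, h w = 0 := by
  obtain ⟨k, b, hb⟩ := hL
  obtain ⟨j, hj⟩ : ∃ j, b.repr v j ≠ 0 := by
    by_contra! h
    exact hv0 (b.repr.map_eq_zero_iff.1 (Finsupp.ext h))
  -- A `ℚ`-linear functional on `ℝ`, applied to all coordinates of `v`, preserves the equations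
  -- because their coefficients are integers. It yields a nonzero rational solution, and clearing
  -- denominators makes it integral.
  obtain ⟨φ, hφ⟩ : ∃ φ : ℝ →ₗ[ℚ] ℚ, φ (b.repr v j) ≠ 0 := by
    by_contra! h
    exact hj ((Module.forall_dual_apply_eq_zero_iff ℚ _).1 h)
  let q : Fin k → ℚ := fun i => φ (b.repr v i)
  obtain ⟨d, hd⟩ := IsLocalization.exist_integer_multiples_of_finite (nonZeroDivisors ℤ) q
  choose z hz using hd
  have hd0 : (d : ℤ) ≠ 0 := nonZeroDivisors.coe_ne_zero d
  have hz' : ∀ i, (z i : ℚ) = d * q i := by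
    intro i
    have := hz i
    simpa [Algebra.smul_def] using this
  have hbL : ∀ i, b i ∈ L := fun i => (hb _).2 fun i' => by
    classical
    rw [Module.Basis.repr_self, Finsupp.single_apply]
    split_ifs
    exacts [⟨1, by simp⟩, ⟨0, by simp⟩]
  refine ⟨∑ i, (z i : ℝ) • b i, (hb _).2 fun i => ⟨z i, ?_⟩, fun h => ?_, fun h hh => ?_⟩
  · rw [b.repr_sum_self]
  · have h1 : (z j : ℝ) = 0 := by
      have := congrFun (b.repr_sum_self fun i => (z i : ℝ)) j
      rw [h] at this
      simpa using this.symm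
    have h2 : (z j : ℚ) = 0 := by exact_mod_cast h1
    rw [hz' j, mul_eq_zero] at h2
    rcases h2 with h2 | h2
    · exact hd0 (by exact_mod_cast h2)
    · exact hφ h2
  · choose c hc using fun i => hH h hh (b i) (hbL i)
    have e1 : ∑ i, (c i : ℚ) • b.repr v i = 0 := by
      have := hv h hh
      rw [← b.sum_repr v, map_sum] at this
      rw [← this]
      refine Finset.sum_congr rfl fun i _ => ?_
      rw [map_smul, hc, Rat.smul_def, smul_eq_mul, mul_comm]
      push_cast; rfl
    have e2 : ∑ i, (c i : ℚ) * q i = 0 := by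
      have := congrArg φ e1
      rw [map_sum, map_zero] at this
      rw [← this]
      refine Finset.sum_congr rfl fun i _ => ?_
      rw [map_smul, smul_eq_mul]
    have e3 : ∑ i, (c i : ℚ) * z i = 0 := by
      have : ∑ i, (c i : ℚ) * z i = d * ∑ i, (c i : ℚ) * q i := by
        rw [Finset.mul_sum]
        exact Finset.sum_congr rfl fun i _ => by rw [hz' i]; ring
      rw [this, e2, mul_zero]
    rw [map_sum]
    have e4 : ((∑ i, c i * z i : ℤ) : ℝ) = 0 := by
      have : ∑ i, c i * z i = 0 := by exact_mod_cast e3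
      rw [this]; simp
    rw [← e4]
    push_cast
    exact Finset.sum_congr rfl fun i _ => by rw [map_smul, hc, smul_eq_mul, mul_comm]

end Lattice

end Trop

/-! ### Calibrations. -/

namespace Trop

variable {M : Type*} [AddCommGroup M] [Module ℝ M]

/-- A function on segments with integral coefficient vector that is additive in the coefficient,
invariant under translations by `Λ`, and vanishes on the boundary of every triangle whose plane
contains the coefficient vector. -/
structure Calibration (N Λ : AddSubgroup M) (Q : Type*) [AddCommGroup Q] where
  /-- the value on the segment from `a` to `b` with coefficient `n` -/
  val : M → M → M → Q
  add_coeff : ∀ {n n'}, n ∈ N → n' ∈ N → ∀ a b, val (n + n') a b = val n a b + val n' a b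
  translate : ∀ n a b {l}, l ∈ Λ → val n (a + l) (b + l) = val n a b
  triangle : ∀ {n}, n ∈ N → ∀ a b c, ¬ LinearIndependent ℝ ![n, b - a, c - a] →
    val n a b + val n b c = val n a c

theorem not_linearIndependent_of_eq_smul {n x y : M} {s : ℝ} (hx : x = s • n) :
    ¬ LinearIndependent ℝ ![n, x, y] := by
  intro h
  have h2 := Fintype.linearIndependent_iff.1 h ![s, -1, 0] (by simp [Fin.sum_univ_three, hx]) 1
  simp at h2

namespace Calibration

variable {N Λ : AddSubgroup M} {Q : Type*} [AddCommGroup Q] (J : Calibration N Λ Q)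

theorem val_zero (a b : M) : J.val 0 a b = 0 := by
  have := J.add_coeff N.zero_mem N.zero_mem a b
  simpa using this

theorem val_self {n : M} (hn : n ∈ N) (a : M) : J.val n a a = 0 := by
  have := J.triangle hn a a a (not_linearIndependent_of_eq_smul (s := 0) (by simp))
  simpa using this

theorem val_neg {n : M} (hn : n ∈ N) (a b : M) : J.val (-n) a b = -J.val n a b := by
  have := J.add_coeff hn (N.neg_mem hn) a b
  rw [add_neg_cancel, val_zero] at this
  exact eq_neg_of_add_eq_zero_right this.symm

theorem val_swap {n : M} (hn : n ∈ N) (a b : M) : J.val n b a = -J.val n a b := by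
  have := J.triangle hn a b a (by
    intro h
    exact h.ne_zero 2 (by simp))
  rw [J.val_self hn] at this
  exact eq_neg_of_add_eq_zero_right this

/-- Reversing a segment together with its coefficient changes nothing, so the value belongs to the
unoriented segment. -/
theorem val_neg_swap {n : M} (hn : n ∈ N) (a b : M) : J.val (-n) b a = J.val n a b := by
  rw [J.val_neg hn, J.val_swap hn, neg_neg]

/-- `val` as a homomorphism in the coefficient. -/
def coeffHom (a b : M) : N →+ Q where
  toFun n := J.val n a b
  map_zero' := J.val_zero a b
  map_add' n n' := J.add_coeff n.2 n'.2 a b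

theorem val_zsmul {n : M} (hn : n ∈ N) (k : ℤ) (a b : M) : J.val (k • n) a b = k • J.val n a b :=
  map_zsmul (J.coeffHom a b) k (⟨n, hn⟩ : N)

theorem val_sum {ι : Type*} (s : Finset ι) (n : ι → M) (hn : ∀ i ∈ s, n i ∈ N) (a b : M) :
    J.val (∑ i ∈ s, n i) a b = ∑ i ∈ s, J.val (n i) a b := by
  classical
  induction s using Finset.induction_on with
  | empty => simp [val_zero]
  | insert i s hi ih =>
    rw [Finset.sum_insert hi, Finset.sum_insert hi,
      J.add_coeff (hn i (Finset.mem_insert_self i s))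
        (N.sum_mem fun j hj => hn j (Finset.mem_insert_of_mem hj)),
      ih fun j hj => hn j (Finset.mem_insert_of_mem hj)]

theorem val_congr {n a b a' : M} (h : (a : M ⧸ Λ) = (a' : M ⧸ Λ)) :
    J.val n a (a + b) = J.val n a' (a' + b) := by
  have hl : -a + a' ∈ Λ := QuotientAddGroup.eq.1 h
  rw [← J.translate n a (a + b) hl]
  congr 1 <;> abel

end Calibration

/-- A chosen half of the nonzero vectors: exactly one of `n`, `-n` is positive. -/
def IsPos {M : Type*} [AddCommGroup M] (n : M) : Prop := WellOrderingRel n (-n)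

/-- Fixing one of `n`, `-n` makes the direction of a segment canonical: parallel segments with
positive primitive directions have equal directions and can be grouped by them. -/
theorem isPos_or_isPos_neg {n : M} (hn : n ≠ 0) : IsPos n ∨ IsPos (-n) := by
  have hne : n ≠ -n := fun h => hn (by
    have : (2 : ℝ) • n = 0 := by rw [two_smul]; nth_rw 2 [h]; abel
    exact (smul_eq_zero.1 this).resolve_left two_ne_zero)
  rcases trichotomous_of (WellOrderingRel (α := M)) n (-n) with h | h | h
  · exact Or.inl h
  · exact absurd h hne
  · right; rw [IsPos, neg_neg]; exact h

theorem not_isPos_neg {M : Type*} [AddCommGroup M] {n : M} (hn : IsPos n) : ¬ IsPos (-n) := by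
  rw [IsPos, neg_neg]
  exact asymm_of (WellOrderingRel (α := M)) hn

/-- A segment with a positive primitive direction. -/
structure DirectedSegment (N : AddSubgroup M) where
  dir : M
  start : M
  len : ℝ
  isPrimitive : IsPrimitive N dir
  isPos : IsPos dir
  len_nonneg : 0 ≤ len

namespace DirectedSegment

variable {N : AddSubgroup M}

/-- The end point of a directed segment. -/
def target (s : DirectedSegment N) : M := s.start + s.len • s.dir

/-- The underlying weight function. -/
noncomputable def germ (Λ : AddSubgroup M) (s : DirectedSegment N) : OneChain Λ :=
  ((segWeight Λ (segment ℝ s.start s.target) : M ⧸ Λ → ℝ) : OneChain Λ)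

end DirectedSegment

theorem segWeight_segment (Λ : AddSubgroup M) {n : M} (hn : n ≠ 0) (a : M) {l : ℝ} (hl : 0 ≤ l)
    (p : M ⧸ Λ) : segWeight Λ (segment ℝ a (a + l • n)) p =
      ({t : ℝ | 0 ≤ t ∧ t ≤ l ∧ ((a + t • n : M) : M ⧸ Λ) = p} : Set ℝ).ncard := by
  have hinj : Function.Injective fun t : ℝ => a + t • n :=
    fun t s h => smul_left_injective ℝ hn (add_left_cancel h)
  rw [segWeight, ← Set.ncard_image_of_injective _ hinj]
  congr 2
  ext x
  simp only [Set.mem_ofPred_eq, Set.mem_image, segment_eq_image', add_sub_cancel_left]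
  constructor
  · rintro ⟨⟨θ, ⟨h0, h1⟩, rfl⟩, h⟩
    refine ⟨θ * l, ⟨by positivity, by nlinarith, ?_⟩, by rw [mul_smul]⟩
    rw [mul_smul]; exact h
  · rintro ⟨t, ⟨h0, h1, h2⟩, rfl⟩
    refine ⟨?_, h2⟩
    rcases hl.eq_or_lt with rfl | hl
    · exact ⟨0, by simp, by simp [le_antisymm h1 h0]⟩
    · exact ⟨t / l, ⟨by positivity, (div_le_one hl).2 h1⟩, by
        rw [smul_smul, div_mul_cancel₀ _ hl.ne']⟩

/-! ### The value of a calibration depends only on the germ of the 1-chain. -/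

section Decomposition

variable {N Λ : AddSubgroup M} {Q : Type*} [AddCommGroup Q] (J : Calibration N Λ Q)

theorem finite_hits (hΛ : IsFullLattice Λ) {n : M} (hn : n ≠ 0) (a : M) (l : ℝ)
    (T : Finset (M ⧸ Λ)) :
    {t : ℝ | 0 ≤ t ∧ t < l ∧ ((a + t • n : M) : M ⧸ Λ) ∈ T}.Finite := by
  refine (T.finite_toSet.biUnion fun p _ => hΛ.finite_line hn a p l).subset ?_
  rintro t ⟨h0, h1, h2⟩
  simp only [Set.mem_iUnion]
  exact ⟨_, h2, by rw [abs_of_nonneg h0]; exact h1.le, rfl⟩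

/-- The distance from `p` to the next point of `T` in direction `n`. -/
noncomputable def nextHit (Λ : AddSubgroup M) (n : M) (T : Finset (M ⧸ Λ)) (p : M ⧸ Λ) : ℝ :=
  sInf {t : ℝ | 0 < t ∧ p + ((t • n : M) : M ⧸ Λ) ∈ T}

/-- The value of `J` on the piece between `p` and the next point of `T` in direction `n`. -/
noncomputable def Calibration.piece (n : M) (T : Finset (M ⧸ Λ)) (p : M ⧸ Λ) : Q :=
  J.val n p.out (p.out + nextHit Λ n T p • n)

/-- There are finitely many hits up to `l`, so the infimum is attained. -/
theorem nextHit_mem (hΛ : IsFullLattice Λ) {n : M} (hn : n ≠ 0) (T : Finset (M ⧸ Λ)) (a : M)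
    {l : ℝ} (hl : 0 < l) (hT : ((a + l • n : M) : M ⧸ Λ) ∈ T) :
    0 < nextHit Λ n T a ∧ nextHit Λ n T a ≤ l ∧
      ((a + nextHit Λ n T a • n : M) : M ⧸ Λ) ∈ T ∧
      ∀ t, 0 < t → t < nextHit Λ n T a → ((a + t • n : M) : M ⧸ Λ) ∉ T := by
  let S : Set ℝ := {t : ℝ | 0 < t ∧ ((a : M ⧸ Λ)) + ((t • n : M) : M ⧸ Λ) ∈ T}
  have hS : nextHit Λ n T a = sInf S := rfl
  have hbdd : BddBelow S := ⟨0, fun t ht => ht.1.le⟩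
  have hfin : (S ∩ Set.Iic l).Finite := by
    refine (finite_hits hΛ hn a (l + 1) T).subset ?_
    rintro t ⟨⟨h0, h1⟩, h2⟩
    exact ⟨h0.le, by have : t ≤ l := h2; linarith, h1⟩
  have hlS : l ∈ S ∩ Set.Iic l := ⟨⟨hl, hT⟩, Set.mem_Iic.2 le_rfl⟩
  obtain ⟨m, hm, hmin⟩ := hfin.exists_minimal ⟨l, hlS⟩
  have hle : ∀ t ∈ S, m ≤ t := by
    intro t ht
    rcases le_total t l with h | h
    · rcases le_total m t with h' | h'
      · exact h'
      · exact hmin ⟨ht, h⟩ h'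
    · exact le_trans hm.2 h
  have heq : sInf S = m := le_antisymm (csInf_le hbdd hm.1) (le_csInf ⟨m, hm.1⟩ hle)
  rw [hS, heq]
  refine ⟨hm.1.1, hm.2, hm.1.2, fun t h0 h1 h2 => ?_⟩
  exact absurd (hle t ⟨h0, h2⟩) (not_le.2 h1)

-- Cut the segment where it meets `T`. Each piece runs from a point of `T` to the next one in
-- direction `n`, so by translation invariance its value depends on that point alone. The start
-- point and length must vary in the induction, since the first piece is split off.
open Classical in
theorem Calibration.val_eq_sum_piece (hΛ : IsFullLattice Λ) {n : M} (hn : IsPrimitive N n)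
    (T : Finset (M ⧸ Λ)) (k : ℕ) : ∀ (a : M) (l : ℝ), 0 ≤ l → (a : M ⧸ Λ) ∈ T →
      ((a + l • n : M) : M ⧸ Λ) ∈ T → (finite_hits hΛ hn.2.1 a l T).toFinset.card = k →
      J.val n a (a + l • n) =
        ∑ t ∈ (finite_hits hΛ hn.2.1 a l T).toFinset, J.piece n T ((a + t • n : M) : M ⧸ Λ) := by
  induction k with
  | zero =>
    intro a l hl ha hT hk
    have hl0 : l = 0 := by
      by_contra h
      have hmem : (0 : ℝ) ∈ (finite_hits hΛ hn.2.1 a l T).toFinset := by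
        simp [lt_of_le_of_ne hl (Ne.symm h), ha]
      rw [Finset.card_eq_zero.1 hk] at hmem
      simp at hmem
    rw [Finset.card_eq_zero.1 hk, hl0]
    simp [J.val_self hn.1]
  | succ k ih =>
    intro a l hl ha hT hk
    have hl0 : 0 < l := by
      rcases hl.eq_or_lt with h | h
      · exfalso
        subst h
        have : (finite_hits hΛ hn.2.1 a 0 T).toFinset = ∅ := by
          ext t
          simp only [Set.Finite.mem_toFinset, Set.mem_ofPred_eq, Finset.notMem_empty, iff_false]
          rintro ⟨h1, h2, -⟩
          linarith
        rw [this] at hk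
        simp at hk
      · exact h
    obtain ⟨h1, h2, h3, h4⟩ := nextHit_mem hΛ hn.2.1 T a hl0 hT
    set τ := nextHit Λ n T a with hτ
    have hl' : a + τ • n + (l - τ) • n = a + l • n := by rw [sub_smul]; abel
    have hset : (finite_hits hΛ hn.2.1 a l T).toFinset = insert 0
        ((finite_hits hΛ hn.2.1 (a + τ • n) (l - τ) T).toFinset.image fun t => t + τ) := by
      ext t
      simp only [Set.Finite.mem_toFinset, Set.mem_ofPred_eq, Finset.mem_insert, Finset.mem_image]
      constructor
      · rintro ⟨t0, t1, t2⟩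
        rcases t0.eq_or_lt with rfl | t0
        · exact Or.inl rfl
        · right
          have : τ ≤ t := by
            by_contra! h
            exact h4 t t0 h t2
          refine ⟨t - τ, ⟨by linarith, by linarith, ?_⟩, by ring⟩
          rwa [show a + τ • n + (t - τ) • n = a + t • n by rw [sub_smul]; abel]
      · rintro (rfl | ⟨s, ⟨s0, s1, s2⟩, rfl⟩)
        · exact ⟨le_rfl, hl0, by simpa using ha⟩
        · refine ⟨by linarith, by linarith, ?_⟩
          rwa [show a + (s + τ) • n = a + τ • n + s • n by rw [add_smul]; abel]
    have hnot : (0 : ℝ) ∉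
        (finite_hits hΛ hn.2.1 (a + τ • n) (l - τ) T).toFinset.image fun t => t + τ := by
      simp only [Set.Finite.mem_toFinset, Set.mem_ofPred_eq, Finset.mem_image, not_exists, not_and]
      rintro t ⟨t0, -, -⟩ h
      linarith
    have hinj : Function.Injective fun t : ℝ => t + τ := add_left_injective τ
    rw [hset, Finset.card_insert_of_notMem hnot, Finset.card_image_of_injective _ hinj] at hk
    have := ih (a + τ • n) (l - τ) (by linarith) h3 (by rw [hl']; exact hT) (by omega)
    rw [hl'] at this
    rw [hset, Finset.sum_insert hnot, Finset.sum_image (fun x _ y _ h => hinj h),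
      ← J.triangle hn.1 a (a + τ • n) (a + l • n)
        (not_linearIndependent_of_eq_smul (s := τ) (by simp)), this]
    congr 1
    · rw [zero_smul, add_zero, Calibration.piece, ← hτ]
      exact J.val_congr (QuotientAddGroup.out_eq' _).symm
    · refine Finset.sum_congr rfl fun t _ => ?_
      congr 2
      rw [add_smul]; abel

/-- The number of times a half-open segment passes through a point. -/
noncomputable def hitCount (Λ : AddSubgroup M) (n a : M) (l : ℝ) (p : M ⧸ Λ) : ℕ :=
  {t : ℝ | 0 ≤ t ∧ t < l ∧ ((a + t • n : M) : M ⧸ Λ) = p}.ncard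

theorem Calibration.val_eq_sum_hitCount (hΛ : IsFullLattice Λ) {n : M} (hn : IsPrimitive N n)
    (T : Finset (M ⧸ Λ)) (a : M) (l : ℝ) (hl : 0 ≤ l) (ha : (a : M ⧸ Λ) ∈ T)
    (hb : ((a + l • n : M) : M ⧸ Λ) ∈ T) :
    J.val n a (a + l • n) = ∑ p ∈ T, hitCount Λ n a l p • J.piece n T p := by
  classical
  rw [J.val_eq_sum_piece hΛ hn T _ a l hl ha hb rfl,
    ← Finset.sum_fiberwise_of_maps_to (t := T) (g := fun t : ℝ => ((a + t • n : M) : M ⧸ Λ))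
      (fun t ht => by simpa using ((Set.Finite.mem_toFinset _).1 ht).2.2)]
  refine Finset.sum_congr rfl fun p hp => ?_
  rw [Finset.sum_congr rfl (g := fun _ => J.piece n T p) (fun t ht => by
    rw [(Finset.mem_filter.1 ht).2]), Finset.sum_const]
  congr 1
  rw [hitCount, ← Set.ncard_coe_finset]
  congr 1
  ext t
  simp only [Finset.coe_filter, Set.Finite.mem_toFinset, Set.mem_ofPred_eq]
  constructor
  · rintro ⟨⟨h0, h1, -⟩, h2⟩
    exact ⟨h0, h1, h2⟩
  · rintro ⟨h0, h1, h2⟩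
    exact ⟨⟨h0, h1, h2 ▸ hp⟩, h2⟩

-- Germs ignore finitely many points, so the weight is sampled just past `q` in direction `n`. This
-- shift turns the count on the closed segment into the count on the half-open one: a hit at the far
-- end is lost and one at the start is kept.
open Filter Topology in
theorem eventually_segWeight_eq_hitCount (hΛ : IsFullLattice Λ) {n : M} (hn : n ≠ 0) (a : M)
    {l : ℝ} (hl : 0 ≤ l) (q : M) :
    ∀ᶠ ε in 𝓝[>] (0 : ℝ), segWeight Λ (segment ℝ a (a + l • n)) ((q + ε • n : M) : M ⧸ Λ) =
      hitCount Λ n a l q := by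
  have hfin := hΛ.finite_line hn a (q : M ⧸ Λ) (l + 1)
  have hev : ∀ᶠ ε in 𝓝[>] (0 : ℝ), ∀ t ∈ {t : ℝ | |t| ≤ l + 1 ∧
      ((a + t • n : M) : M ⧸ Λ) = (q : M ⧸ Λ)}, (t < 0 → t < -ε) ∧ (t < l → t ≤ l - ε) := by
    rw [Filter.eventually_all_finite hfin]
    intro t _
    have h1 : ∀ᶠ ε in 𝓝[>] (0 : ℝ), t < 0 → t < -ε := by
      by_cases ht : t < 0
      · filter_upwards [eventually_pos_lt (neg_pos.2 ht)] with ε hε _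
        linarith
      · exact Filter.Eventually.of_forall fun _ h => absurd h ht
    have h2 : ∀ᶠ ε in 𝓝[>] (0 : ℝ), t < l → t ≤ l - ε := by
      by_cases ht : t < l
      · filter_upwards [eventually_pos_lt (sub_pos.2 ht)] with ε hε _
        linarith
      · exact Filter.Eventually.of_forall fun _ h => absurd h ht
    exact h1.and h2
  filter_upwards [hev, self_mem_nhdsWithin, eventually_pos_lt one_pos] with ε h1 h2 h3
  have h2 : 0 < ε := h2
  rw [segWeight_segment Λ hn a hl, hitCount,
    ← Set.ncard_image_of_injective {t : ℝ | 0 ≤ t ∧ t < l ∧ _} (add_left_injective ε)]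
  congr 2
  ext t
  simp only [Set.mem_ofPred_eq, Set.mem_image]
  have hshift : ∀ s : ℝ, ((a + (s + ε) • n : M) : M ⧸ Λ) = ((q + ε • n : M) : M ⧸ Λ) ↔
      ((a + s • n : M) : M ⧸ Λ) = (q : M ⧸ Λ) := by
    intro s
    rw [QuotientAddGroup.eq, QuotientAddGroup.eq]
    rw [show -(a + (s + ε) • n) + (q + ε • n) = -(a + s • n) + q by rw [add_smul]; abel]
  constructor
  · rintro ⟨t0, t1, t2⟩
    have t3 := (hshift (t - ε)).1 (by rwa [sub_add_cancel])
    have t4 := h1 (t - ε) ⟨abs_le.2 ⟨by linarith, by linarith⟩, t3⟩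
    refine ⟨t - ε, ⟨?_, by linarith, t3⟩, by ring⟩
    by_contra! h
    have := t4.1 h
    linarith
  · rintro ⟨s, ⟨s0, s1, s2⟩, rfl⟩
    have t4 := h1 s ⟨abs_le.2 ⟨by linarith, by linarith⟩, s2⟩
    exact ⟨by linarith, by linarith [t4.2 s1], (hshift s).2 s2⟩

open Filter Topology in
theorem eventually_segWeight_eq_zero (hΛ : IsFullLattice Λ) {m n : M}
    (h : LinearIndependent ℝ ![m, n]) (a : M) {l : ℝ} (hl : 0 ≤ l) (q : M) :
    ∀ᶠ ε in 𝓝[>] (0 : ℝ),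
      segWeight Λ (segment ℝ a (a + l • m)) ((q + ε • n : M) : M ⧸ Λ) = 0 := by
  filter_upwards [hΛ.eventually_transversal h a q l] with ε hε
  rw [segWeight_segment Λ (show m ≠ 0 from h.ne_zero 0) a hl]
  rw [show {t : ℝ | 0 ≤ t ∧ t ≤ l ∧ ((a + t • m : M) : M ⧸ Λ) = ((q + ε • n : M) : M ⧸ Λ)} = ∅ from
    Set.eq_empty_of_forall_notMem fun t ⟨h0, h1, h2⟩ => hε t (by rwa [abs_of_nonneg h0]) h2]
  simp

open Filter Topology in
/-- If the weighted sum of segments is the zero germ then so is the sum of the values of `J`. -/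
theorem Calibration.sum_val_eq_zero (hΛ : IsFullLattice Λ) (c : DirectedSegment N →₀ ℤ)
    (hc : c.sum (fun s z => z • s.germ Λ) = 0) :
    c.sum (fun s z => z • J.val s.dir s.start s.target) = 0 := by
  classical
  -- All end points are included, so that every segment of the sum is cut into pieces of one common
  -- subdivision.
  let T : Finset (M ⧸ Λ) := c.support.image (fun s => (s.start : M ⧸ Λ)) ∪
    c.support.image (fun s => (s.target : M ⧸ Λ))
  have hval : ∀ s ∈ c.support, J.val s.dir s.start s.target =
      ∑ p ∈ T, hitCount Λ s.dir s.start s.len p • J.piece s.dir T p := by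
    intro s hs
    exact J.val_eq_sum_hitCount hΛ s.isPrimitive T s.start s.len s.len_nonneg
      (Finset.mem_union_left _ (Finset.mem_image_of_mem (fun s => (s.start : M ⧸ Λ)) hs))
      (Finset.mem_union_right _ (Finset.mem_image_of_mem (fun s => (s.target : M ⧸ Λ)) hs))
  have hgerm : ∀ᶠ p in (Filter.cofinite : Filter (M ⧸ Λ)),
      ∑ s ∈ c.support, (c s : ℝ) * segWeight Λ (segment ℝ s.start s.target) p = 0 := by
    have h1 : ((fun p => ∑ s ∈ c.support, (c s : ℝ) *
        segWeight Λ (segment ℝ s.start s.target) p : M ⧸ Λ → ℝ) : OneChain Λ) = 0 := by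
      rw [← hc, Finsupp.sum]
      have : ∀ S : Finset (DirectedSegment N), ((fun p => ∑ s ∈ S, (c s : ℝ) *
          segWeight Λ (segment ℝ s.start s.target) p : M ⧸ Λ → ℝ) : OneChain Λ) =
          ∑ s ∈ S, c s • s.germ Λ := by
        intro S
        induction S using Finset.induction_on with
        | empty => simp only [Finset.sum_empty]; rfl
        | insert s S hs ih =>
          rw [Finset.sum_insert hs, ← ih, DirectedSegment.germ, ← Filter.Germ.coe_smul,
            ← Filter.Germ.coe_add]
          congr 1
          ext p
          simp [Finset.sum_insert hs]
      exact this _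
    exact Filter.Germ.coe_eq.1 h1
  -- Sampling past `p` along `n` isolates the segments of direction `n`, because transversal ones
  -- are missed for small `ε`. The vanishing of the germ thus splits by direction and by point.
  have hcount : ∀ (n : M), IsPrimitive N n → IsPos n → ∀ p : M ⧸ Λ,
      ∑ s ∈ c.support with s.dir = n, c s * (hitCount Λ s.dir s.start s.len p : ℤ) = 0 := by
    intro n hn hpos p
    obtain ⟨q, rfl⟩ := QuotientAddGroup.mk_surjective p
    have e1 : ∀ᶠ ε in 𝓝[>] (0 : ℝ), ∑ s ∈ c.support, (c s : ℝ) *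
        segWeight Λ (segment ℝ s.start s.target) ((q + ε • n : M) : M ⧸ Λ) = 0 := by
      have hbad := Filter.eventually_cofinite.1 hgerm
      have : ∀ᶠ ε in 𝓝[>] (0 : ℝ), ∀ r ∈ {p : M ⧸ Λ | ¬ ∑ s ∈ c.support, (c s : ℝ) *
          segWeight Λ (segment ℝ s.start s.target) p = 0}, ((q + ε • n : M) : M ⧸ Λ) ≠ r :=
        (Filter.eventually_all_finite hbad).2 fun r _ => hΛ.eventually_ne hn.2.1 q r
      filter_upwards [this] with ε hε
      by_contra h
      exact hε _ h rfl
    have e2 : ∀ᶠ ε in 𝓝[>] (0 : ℝ), ∀ s ∈ c.support,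
        segWeight Λ (segment ℝ s.start s.target) ((q + ε • n : M) : M ⧸ Λ) =
          if s.dir = n then (hitCount Λ s.dir s.start s.len (q : M ⧸ Λ) : ℝ) else 0 := by
      rw [Filter.eventually_all_finset]
      intro s _
      split_ifs with h
      · subst h
        exact eventually_segWeight_eq_hitCount hΛ hn.2.1 s.start s.len_nonneg q
      · refine eventually_segWeight_eq_zero hΛ ?_ s.start s.len_nonneg q
        refine s.isPrimitive.linearIndependent hn (Ne.symm h) fun h' => ?_
        exact not_isPos_neg s.isPos (h' ▸ hpos)
    obtain ⟨ε, h1, h2⟩ := (e1.and e2).exists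
    rw [Finset.sum_congr rfl fun s hs => by rw [h2 s hs]] at h1
    simp only [mul_ite, mul_zero] at h1
    rw [← Finset.sum_filter] at h1
    exact_mod_cast h1
  rw [Finsupp.sum, Finset.sum_congr rfl fun s hs => by rw [hval s hs, Finset.smul_sum],
    ← Finset.sum_fiberwise_of_maps_to (t := c.support.image (·.dir)) (g := (·.dir))
      (fun s hs => Finset.mem_image_of_mem _ hs)]
  refine Finset.sum_eq_zero fun n hn => ?_
  obtain ⟨s₀, hs₀, rfl⟩ := Finset.mem_image.1 hn
  rw [Finset.sum_comm]
  refine Finset.sum_eq_zero fun p _ => ?_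
  have := hcount s₀.dir s₀.isPrimitive s₀.isPos p
  rw [Finset.sum_congr rfl (g := fun s =>
    (c s * (hitCount Λ s.dir s.start s.len p : ℤ)) • J.piece s₀.dir T p) (fun s hs => by
      rw [(Finset.mem_filter.1 hs).2, mul_smul, natCast_zsmul]), ← Finset.sum_smul, this, zero_smul]

/-- The pairs consisting of a weighted sum of segments and its value under `J`. -/
noncomputable def Calibration.graph : Submodule ℤ (OneChain Λ × Q) :=
  Submodule.span ℤ (Set.range fun s : DirectedSegment N =>
    (s.germ Λ, J.val s.dir s.start s.target))

/-- This makes `graph` the graph of a partial function, so values can be compared through germs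
without choosing decompositions into segments. -/
theorem Calibration.eq_zero_of_mem_graph (hΛ : IsFullLattice Λ) {q : Q}
    (h : ((0 : OneChain Λ), q) ∈ J.graph) : q = 0 := by
  obtain ⟨c, hc⟩ := Finsupp.mem_span_range_iff_exists_finsupp.1 h
  have h1 := congrArg (AddMonoidHom.fst (OneChain Λ) Q) hc
  have h2 := congrArg (AddMonoidHom.snd (OneChain Λ) Q) hc
  rw [Finsupp.sum, map_sum] at h1 h2
  exact h2.symm.trans (J.sum_val_eq_zero hΛ c h1)

theorem Calibration.mem_graph {n : M} (hn : IsPrimitive N n) {a b : M} {t : ℝ} (ht : 0 ≤ t)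
    (h : b - a = t • n) :
    (((segWeight Λ (segment ℝ a b) : M ⧸ Λ → ℝ) : OneChain Λ), J.val n a b) ∈ J.graph := by
  have main : ∀ (n a b : M), IsPrimitive N n → IsPos n → b - a = t • n →
      (((segWeight Λ (segment ℝ a b) : M ⧸ Λ → ℝ) : OneChain Λ), J.val n a b) ∈ J.graph := by
    intro n a b hn hp h
    have hs : (⟨n, a, t, hn, hp, ht⟩ : DirectedSegment N).target = b := by
      change a + t • n = b
      rw [← h]; abel
    refine Submodule.subset_span ⟨⟨n, a, t, hn, hp, ht⟩, ?_⟩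
    change (((segWeight Λ (segment ℝ a _) : M ⧸ Λ → ℝ) : OneChain Λ), J.val n a _) = _
    rw [hs]
  rcases isPos_or_isPos_neg hn.2.1 with hp | hp
  · exact main n a b hn hp h
  · rw [← J.val_neg_swap hn.1, segment_symm]
    exact main (-n) b a hn.neg hp (by rw [smul_neg, ← h]; abel)

end Decomposition

end Trop

/-! ### Plane polygons: oriented sides and the boundary of the boundary. -/

namespace Trop

variable {U : Type*} [AddCommGroup U] [Module ℝ U]

/-- An area form on a plane `T` in a real vector space. -/
structure AreaForm (T : Submodule ℝ U) where
  form : U →ₗ[ℝ] U →ₗ[ℝ] ℝ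
  swap : ∀ x y, form x y = -form y x
  plucker : ∀ x ∈ T, ∀ y ∈ T, ∀ z ∈ T, form x y • z + form y z • x + form z x • y = 0
  nondeg : ∀ x ∈ T, x ≠ 0 → ∃ e ∈ T, form x e = 1

/-- The determinant in a basis of `T`, with both coordinate functionals extended to `U` so that the
form is defined everywhere. -/
theorem AreaForm.exists_of_finrank {T : Submodule ℝ U} (hT : Module.finrank ℝ T = 2) :
    Nonempty (AreaForm T) := by
  have : Module.Finite ℝ T := Module.finite_of_finrank_pos (by omega)
  let b : Module.Basis (Fin 2) ℝ T := Module.finBasisOfFinrankEq ℝ T hT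
  obtain ⟨f, hf⟩ := (b.coord 0).exists_extend
  obtain ⟨g, hg⟩ := (b.coord 1).exists_extend
  have hf' : ∀ x : T, f x = b.coord 0 x := fun x => by rw [← hf]; rfl
  have hg' : ∀ x : T, g x = b.coord 1 x := fun x => by rw [← hg]; rfl
  have hexp : ∀ x (hx : x ∈ T), x = f x • (b 0 : U) + g x • (b 1 : U) := by
    intro x hx
    have := congrArg Subtype.val (b.sum_repr ⟨x, hx⟩)
    rw [Fin.sum_univ_two] at this
    rw [hf' ⟨x, hx⟩, hg' ⟨x, hx⟩]
    simpa using this.symm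
  have h00 : f (b 0) = 1 := by rw [hf']; simp
  have h01 : f (b 1) = 0 := by rw [hf']; simp
  have h10 : g (b 0) = 0 := by rw [hg']; simp
  have h11 : g (b 1) = 1 := by rw [hg']; simp
  let ω : U →ₗ[ℝ] U →ₗ[ℝ] ℝ := LinearMap.mk₂ ℝ (fun x y => f x * g y - g x * f y)
    (by intros; simp; ring) (by intros; simp; ring) (by intros; simp; ring) (by intros; simp; ring)
  have hω : ∀ x y, ω x y = f x * g y - g x * f y := fun _ _ => rfl
  refine ⟨⟨ω, fun x y => by rw [hω, hω]; ring, ?_, ?_⟩⟩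
  · intro x hx y hy z hz
    rw [hω, hω, hω]
    rw [hexp x hx, hexp y hy, hexp z hz]
    simp only [map_add, map_smul, h00, h01, h10, h11, smul_eq_mul]
    module
  · intro x hx hx0
    by_cases h : f x = 0
    · have hg0 : g x ≠ 0 := by
        intro h'
        exact hx0 (by rw [hexp x hx, h, h']; simp)
      refine ⟨-(g x)⁻¹ • b 0, T.smul_mem _ (b 0).2, ?_⟩
      rw [hω, map_smul, map_smul, h00, h10, h]
      simp [hg0]
    · refine ⟨(f x)⁻¹ • b 1, T.smul_mem _ (b 1).2, ?_⟩
      rw [hω, map_smul, map_smul, h01, h11]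
      simp [h]

namespace AreaForm

variable {T : Submodule ℝ U} (ω : AreaForm T)

theorem self_eq_zero (x : U) : ω.form x x = 0 := by
  have := ω.swap x x
  linarith

theorem expand {d e x : U} (hd : d ∈ T) (he : e ∈ T) (hx : x ∈ T) (h : ω.form d e = 1) :
    x = ω.form x e • d + ω.form d x • e := by
  have := ω.plucker d hd e he x hx
  rw [h, one_smul, ω.swap e x, ω.swap x d] at this
  rw [neg_smul, neg_smul] at this
  rw [← sub_eq_zero, ← this]; abel

theorem eq_smul_of_eq_zero {d x : U} (hd : d ∈ T) (hx : x ∈ T) (hd0 : d ≠ 0)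
    (h : ω.form d x = 0) : ∃ r : ℝ, x = r • d := by
  obtain ⟨e, he, h1⟩ := ω.nondeg d hd hd0
  refine ⟨ω.form x e, ?_⟩
  have := ω.expand hd he hx h1
  rwa [h, zero_smul, add_zero] at this

theorem form_eq {d e x y : U} (hd : d ∈ T) (he : e ∈ T) (hx : x ∈ T)
    (h : ω.form d e = 1) :
    ω.form x y = ω.form x e * ω.form d y - ω.form y e * ω.form d x := by
  conv_lhs => rw [ω.expand hd he hx h]
  simp only [map_add, map_smul, LinearMap.add_apply, LinearMap.smul_apply, smul_eq_mul]
  rw [ω.swap e y]; ring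

end AreaForm

/-- `[a, b]` is a side of `P`, oriented so that `P` lies to the left. -/
structure IsOrientedSide (ω : U →ₗ[ℝ] U →ₗ[ℝ] ℝ) (P : Set U) (a b : U) : Prop where
  left_mem : a ∈ P
  right_mem : b ∈ P
  ne : a ≠ b
  nonneg : ∀ y ∈ P, 0 ≤ ω (b - a) (y - a)
  mem_segment : ∀ y ∈ P, ω (b - a) (y - a) = 0 → y ∈ segment ℝ a b

section Polygon

variable {P : Set U} {S : Finset U}

theorem exists_form_ne_zero (hP : P = convexHull ℝ (S : Set U))
    (ω : AreaForm (vectorSpan ℝ P))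
    {d b : U} (hd : d ∈ vectorSpan ℝ P) (hd0 : d ≠ 0)
    (hb : b ∈ P) : ∃ y ∈ S, ω.form d (y - b) ≠ 0 := by
  by_contra! h
  have h1 : ∀ y ∈ P, ω.form d (y - b) = 0 := by
    have : P ⊆ {y | ω.form d y = ω.form d b} := by
      conv_lhs => rw [hP]
      refine convexHull_min (fun y hy => ?_) (convex_hyperplane (ω.form d).isLinear _)
      have := h y hy
      rwa [map_sub, sub_eq_zero] at this
    intro y hy
    rw [map_sub, this hy, sub_self]
  obtain ⟨e, he, h2⟩ := ω.nondeg d hd hd0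
  have h3 : vectorSpan ℝ P ≤ LinearMap.ker (ω.form d) := by
    refine (vectorSpan_eq_span_vsub_set_right ℝ hb).le.trans (Submodule.span_le.2 ?_)
    rintro _ ⟨y, hy, rfl⟩
    exact h1 y hy
  have h4 : ω.form d e = 0 := h3 he
  linarith

/-- A supporting line through two points of a polygon carries a side. -/
theorem exists_orientedSide (hP : P = convexHull ℝ (S : Set U))
    (ω : AreaForm (vectorSpan ℝ P))
    {b c d : U} (hb : b ∈ P) (hc : c ∈ P) (hbc : b ≠ c)
    (hd : d ∈ vectorSpan ℝ P) (hd0 : d ≠ 0) (hpos : ∀ y ∈ P, 0 ≤ ω.form d (y - b))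
    (h0 : ω.form d (c - b) = 0) :
    ∃ x z, IsOrientedSide ω.form P x z ∧ (∃ t : ℝ, 0 < t ∧ z - x = t • d) ∧
      b ∈ segment ℝ x z ∧ ω.form d (x - b) = 0 := by
  classical
  obtain ⟨e, he, h1⟩ := ω.nondeg d hd hd0
  have hsub : ∀ y ∈ P, ∀ z ∈ P, y - z ∈ vectorSpan ℝ P := fun y hy z hz =>
    vsub_mem_vectorSpan ℝ hy hz
  let κ : U → ℝ := fun y => ω.form (y - b) e
  have hκ : ∀ y ∈ P, ω.form d (y - b) = 0 → y = b + κ y • d := by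
    intro y hy hy0
    have := ω.expand hd he (hsub y hy b hb) h1
    rw [hy0, zero_smul, add_zero] at this
    rw [← this]; abel
  have hconv : Convex ℝ P := hP ▸ convex_convexHull ℝ _
  let SF : Finset U := S.filter fun y => ω.form d (y - b) = 0
  have hSP : ∀ y ∈ S, y ∈ P := fun y hy => hP ▸ subset_convexHull ℝ _ hy
  -- In a convex combination of points of `S` the terms `w i * ω(d, i - b)` are nonnegative with sum
  -- zero, so only points on the supporting line carry weight.
  have hF : ∀ y ∈ P, ω.form d (y - b) = 0 → y ∈ convexHull ℝ (SF : Set U) := by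
    intro y hy hy0
    rw [hP, Finset.convexHull_eq] at hy
    obtain ⟨w, hw0, hw1, hwy⟩ := hy
    rw [Finset.centerMass_eq_of_sum_1 _ _ hw1] at hwy
    have hsum : ∑ i ∈ S, w i * ω.form d (i - b) = 0 := by
      rw [← hy0, ← hwy]
      have : (∑ i ∈ S, w i • id i) - b = ∑ i ∈ S, w i • (i - b) := by
        simp only [smul_sub, Finset.sum_sub_distrib, ← Finset.sum_smul, hw1, one_smul, id]
      rw [this, map_sum]
      exact Finset.sum_congr rfl fun i _ => by rw [map_smul, smul_eq_mul]
    have hz := (Finset.sum_eq_zero_iff_of_nonneg fun i hi =>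
      mul_nonneg (hw0 i hi) (hpos i (hSP i hi))).1 hsum
    have hzero : ∀ i ∈ S, i ∉ SF → w i = 0 := by
      intro i hi hiF
      refine (mul_eq_zero.1 (hz i hi)).resolve_right fun h => hiF ?_
      exact Finset.mem_filter.2 ⟨hi, h⟩
    rw [Finset.convexHull_eq]
    have hsub' : SF ⊆ S := Finset.filter_subset _ _
    have hw1' : ∑ i ∈ SF, w i = 1 := by rw [← hw1]; exact Finset.sum_subset hsub' hzero
    refine ⟨w, fun i hi => hw0 i (hsub' hi), hw1', ?_⟩
    rw [Finset.centerMass_eq_of_sum_1 _ _ hw1', ← hwy]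
    exact Finset.sum_subset hsub' fun i hi hiF => by rw [hzero i hi hiF, zero_smul]
  have hne : SF.Nonempty := by
    have := hF b hb (by simp)
    by_contra h
    rw [Finset.not_nonempty_iff_eq_empty.1 h] at this
    simp at this
  -- The ends of the side are the extreme points of `S` on the line for the coordinate `κ` along
  -- `d`.
  obtain ⟨x, hx, hxmin⟩ := SF.exists_min_image κ hne
  obtain ⟨z, hz, hzmax⟩ := SF.exists_max_image κ hne
  have hκlin : ∀ r : ℝ, Convex ℝ {y | κ y ≤ r} ∧ Convex ℝ {y | r ≤ κ y} := by
    intro r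
    have hlin : IsLinearMap ℝ fun y => ω.form y e := ⟨fun _ _ => by simp, fun _ _ => by simp⟩
    constructor
    · have := convex_halfSpace_le hlin (r + ω.form b e)
      convert this using 2
      simp [κ]
    · have := convex_halfSpace_ge hlin (r + ω.form b e)
      convert this using 2
      simp [κ, le_sub_iff_add_le]
  have hle : ∀ y ∈ P, ω.form d (y - b) = 0 → κ x ≤ κ y ∧ κ y ≤ κ z := fun y hy hy0 =>
    ⟨convexHull_min (fun i hi => hxmin i hi) (hκlin _).2 (hF y hy hy0),
      convexHull_min (fun i hi => hzmax i hi) (hκlin _).1 (hF y hy hy0)⟩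
  obtain ⟨hxS, hx0⟩ := Finset.mem_filter.1 hx
  obtain ⟨hzS, hz0⟩ := Finset.mem_filter.1 hz
  have hxP := hSP x hxS
  have hzP := hSP z hzS
  have ex := hκ x hxP hx0
  have ez := hκ z hzP hz0
  have hlt : κ x < κ z := by
    have b1 := hle b hb (by simp)
    have c1 := hle c hc h0
    have : κ b ≠ κ c := by
      intro h
      apply hbc
      rw [hκ b hb (by simp), hκ c hc h0, h]
    rcases lt_or_gt_of_ne this with h | h <;> linarith
  have hzx : z - x = (κ z - κ x) • d := by
    rw [sub_smul, sub_eq_sub_iff_add_eq_add]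
    nth_rw 1 [ez]
    nth_rw 2 [ex]
    abel
  have hseg : ∀ y ∈ P, ω.form d (y - b) = 0 → y ∈ segment ℝ x z := by
    intro y hy hy0
    obtain ⟨l1, l2⟩ := hle y hy hy0
    have hpos' : 0 < κ z - κ x := by linarith
    rw [segment_eq_image']
    refine ⟨(κ y - κ x) / (κ z - κ x), ⟨div_nonneg (by linarith) hpos'.le,
      (div_le_one hpos').2 (by linarith)⟩, ?_⟩
    change x + _ = y
    rw [hzx, smul_smul, div_mul_cancel₀ _ hpos'.ne', sub_smul]
    rw [hκ y hy hy0]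
    nth_rw 1 [ex]
    have : κ (b + κ y • d) = κ y := congrArg κ (hκ y hy hy0).symm
    rw [this]; abel
  have hform : ∀ y, ω.form (z - x) (y - x) = (κ z - κ x) * ω.form d (y - b) := by
    intro y
    rw [hzx, map_smul, LinearMap.smul_apply, smul_eq_mul,
      show y - x = (y - b) - (x - b) by abel, map_sub, hx0, sub_zero]
  refine ⟨x, z, ⟨hxP, hzP, ?_, ?_, ?_⟩, ⟨κ z - κ x, by linarith, hzx⟩, hseg b hb (by simp), hx0⟩
  · rintro rfl
    exact lt_irrefl _ hlt
  · intro y hy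
    rw [hform]
    exact mul_nonneg (by linarith) (hpos y hy)
  · intro y hy h
    rw [hform] at h
    exact hseg y hy ((mul_eq_zero.1 h).resolve_left (by linarith))

/-- On `P` the functional that cuts out the face is constant plus a nonzero multiple of `ω(q - p, ·
- p)`, for two points `p`, `q` of the face. So the face is the part of `P` on a supporting line, and
the sign of the multiple fixes the orientation. -/
theorem IsFace.exists_orientedSide (hP : P = convexHull ℝ (S : Set U))
    (ω : AreaForm (vectorSpan ℝ P))
    {F : Set U} (hdim : dim P = 2) (hF : IsFace F P)
    (hF1 : dim F = 1) : ∃ a b, IsOrientedSide ω.form P a b ∧ F = segment ℝ a b := by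
  obtain ⟨⟨p, hp⟩, f, hf⟩ := hF
  have hFP : ∀ x ∈ F, x ∈ P := fun x hx => by rw [hf] at hx; exact hx.1
  have hmax : ∀ x ∈ F, ∀ y ∈ P, f y ≤ f x := fun x hx => by rw [hf] at hx; exact hx.2
  obtain ⟨q, hq, hpq⟩ : ∃ q ∈ F, p ≠ q := by
    by_contra! h
    have hs : F = {p} := Set.eq_singleton_iff_unique_mem.2 ⟨hp, fun y hy => (h y hy).symm⟩
    rw [dim, hs, vectorSpan_singleton] at hF1
    simp at hF1
  have hd : q - p ∈ vectorSpan ℝ P := vsub_mem_vectorSpan ℝ (hFP q hq) (hFP p hp)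
  have hd0 : q - p ≠ 0 := sub_ne_zero.2 hpq.symm
  obtain ⟨e, he, h1⟩ := ω.nondeg _ hd hd0
  have hfq : f q = f p := le_antisymm (hmax p hp q (hFP q hq)) (hmax q hq p (hFP p hp))
  have hfx : ∀ y ∈ P, f y - f p = ω.form (q - p) (y - p) * f e := by
    intro y hy
    have := congrArg f (ω.expand hd he (vsub_mem_vectorSpan ℝ hy (hFP p hp)) h1)
    rw [map_add, map_smul, map_smul, map_sub f q, hfq, sub_self, smul_zero, zero_add] at this
    rw [← map_sub]; exact this
  have hfe : f e ≠ 0 := by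
    intro h
    have : F = P := by
      refine Set.Subset.antisymm hFP fun y hy => ?_
      rw [hf]
      refine ⟨hy, fun y' hy' => ?_⟩
      have := hfx y hy
      have := hmax p hp y' hy'
      simp only [h, mul_zero] at *
      linarith
    rw [this, hdim] at hF1
    omega
  have hFeq : ∀ y ∈ P, ω.form (q - p) (y - p) = 0 → y ∈ F := by
    intro y hy h
    have h2 := hfx y hy
    rw [h, zero_mul, sub_eq_zero] at h2
    rw [hf]
    exact ⟨hy, fun y' hy' => h2 ▸ hmax p hp y' hy'⟩
  have hFeq' : ∀ y ∈ F, ω.form (q - p) (y - p) = 0 := by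
    intro y hy
    have h2 := hfx y (hFP y hy)
    have h3 : f y = f p := le_antisymm (hmax p hp y (hFP y hy)) (hmax y hy p (hFP p hp))
    rw [h3, sub_self] at h2
    exact (mul_eq_zero.1 h2.symm).resolve_right hfe
  have key : ∀ s : ℝ, s ≠ 0 → (∀ y ∈ P, 0 ≤ ω.form (s • (q - p)) (y - p)) →
      ∃ a b, IsOrientedSide ω.form P a b ∧ F = segment ℝ a b := by
    intro s hs hpos
    obtain ⟨x, z, hxz, ⟨t, ht, hzx⟩, hbs, hx0⟩ := Trop.exists_orientedSide hP ω (hFP p hp)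
      (hFP q hq) hpq (Submodule.smul_mem _ s hd) (smul_ne_zero hs hd0) hpos
      (by rw [map_smul, LinearMap.smul_apply, ω.self_eq_zero, smul_zero])
    refine ⟨x, z, hxz, ?_⟩
    have e1 : ∀ y, ω.form (z - x) (y - x) = t * (s * ω.form (q - p) (y - p)) := by
      intro y
      rw [hzx, show y - x = (y - p) - (x - p) by abel, map_sub]
      rw [map_smul, LinearMap.smul_apply, LinearMap.smul_apply, hx0]
      simp
    ext y
    constructor
    · intro hy
      refine hxz.mem_segment y (hFP y hy) ?_
      rw [e1, hFeq' y hy]; simp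
    · intro hy
      have hyP : y ∈ P := (hP ▸ convex_convexHull ℝ (S : Set U) : Convex ℝ P).segment_subset
        hxz.left_mem hxz.right_mem hy
      refine hFeq y hyP ?_
      have h2 : ω.form (z - x) (y - x) = 0 := by
        rw [segment_eq_image'] at hy
        obtain ⟨θ, -, rfl⟩ := hy
        simp only [add_sub_cancel_left, map_smul, ω.self_eq_zero, smul_zero]
      rw [e1] at h2
      simpa [ht.ne', hs] using h2
  rcases lt_or_gt_of_ne hfe with h | h
  · refine key 1 one_ne_zero fun y hy => ?_
    rw [one_smul]
    have h2 := hfx y hy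
    have h3 := hmax p hp y (hy)
    by_contra! h4
    have := mul_pos_of_neg_of_neg h4 h
    linarith
  · refine key (-1) (by norm_num) fun y hy => ?_
    rw [neg_one_smul, map_neg, LinearMap.neg_apply]
    have h2 := hfx y hy
    have h3 := hmax p hp y (hy)
    by_contra! h4
    have := mul_pos (show 0 < ω.form (q - p) (y - p) by linarith) h
    linarith

theorem vectorSpan_segment (a b : U) :
    vectorSpan ℝ (segment ℝ a b) = Submodule.span ℝ {b - a} := by
  rw [← convexHull_pair, ← direction_affineSpan, affineSpan_convexHull, direction_affineSpan,
    vectorSpan_pair_rev]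
  rfl

theorem dim_segment {a b : U} (h : a ≠ b) : dim (segment ℝ a b) = 1 := by
  rw [dim, vectorSpan_segment, finrank_span_singleton (sub_ne_zero.2 h.symm)]

theorem IsOrientedSide.isFace (ω : AreaForm (vectorSpan ℝ P))
    {a b : U} (hconv : Convex ℝ P)
    (h : IsOrientedSide ω.form P a b) : IsFace (segment ℝ a b) P := by
  refine ⟨⟨a, left_mem_segment ℝ a b⟩, -ω.form (b - a), ?_⟩
  ext y
  have hzero : ∀ y ∈ segment ℝ a b, ω.form (b - a) (y - a) = 0 := by
    intro y hy
    rw [segment_eq_image'] at hy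
    obtain ⟨θ, -, rfl⟩ := hy
    simp only [add_sub_cancel_left, map_smul, ω.self_eq_zero, smul_zero]
  constructor
  · intro hy
    refine ⟨hconv.segment_subset h.left_mem h.right_mem hy, fun z hz => ?_⟩
    have h1 := h.nonneg z hz
    have h2 := hzero y hy
    rw [map_sub] at h1 h2
    simp only [LinearMap.neg_apply]
    linarith
  · rintro ⟨hy, hmax⟩
    refine h.mem_segment y hy ?_
    have h1 := h.nonneg y hy
    have h2 := hmax a h.left_mem
    simp only [LinearMap.neg_apply] at h2
    rw [map_sub] at h1 ⊢
    linarith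

/-- Each of the two starting points lies weakly to the left of the other side, and these conditions
have opposite signs. So both sides lie on one line and each contains the other's starting point. -/
theorem IsOrientedSide.left_unique (ω : AreaForm (vectorSpan ℝ P))
    {a a' b : U} (h : IsOrientedSide ω.form P a b)
    (h' : IsOrientedSide ω.form P a' b) : a = a' := by
  have h1 := h.nonneg a' h'.left_mem
  have h2 := h'.nonneg a h.left_mem
  have e1 : ω.form (b - a) (a' - a) = -ω.form (b - a) (b - a') := by
    rw [show a' - a = (b - a) - (b - a') by abel, map_sub, ω.self_eq_zero, zero_sub]
  have e2 : ω.form (b - a') (a - a') = ω.form (b - a) (b - a') := by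
    rw [show a - a' = (b - a') - (b - a) by abel, map_sub, ω.self_eq_zero, zero_sub,
      ← ω.swap]
  have h3 : ω.form (b - a) (b - a') = 0 := by linarith
  have m1 := h.mem_segment a' h'.left_mem (by rw [e1, h3, neg_zero])
  have m2 := h'.mem_segment a h.left_mem (by rw [e2, h3])
  rw [segment_eq_image'] at m1 m2
  obtain ⟨s, hs, e3⟩ := m1
  obtain ⟨r, hr, e4⟩ := m2
  simp only at e3 e4
  have hne : b - a ≠ 0 := sub_ne_zero.2 h.ne.symm
  have e5 : (s + r * (1 - s)) • (b - a) = 0 := by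
    have : a + s • (b - a) + r • (b - (a + s • (b - a))) = a := by rw [e3]; exact e4
    rw [← sub_eq_zero] at this
    rw [← this]
    module
  have e6 := (smul_eq_zero.1 e5).resolve_right hne
  have : s = 0 := by
    have := mul_nonneg hr.1 (sub_nonneg.2 hs.2)
    linarith [hs.1]
  rw [← e3, this, zero_smul, add_zero]

/-- A point of the polygon off the line lies to the left of both orientations, so the two directions
are nonnegatively proportional. -/
theorem IsOrientedSide.eq_of_segment_eq (hP : P = convexHull ℝ (S : Set U))
    (ω : AreaForm (vectorSpan ℝ P))
    {a b a' b' : U} (h : IsOrientedSide ω.form P a b)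
    (h' : IsOrientedSide ω.form P a' b') (hs : segment ℝ a b = segment ℝ a' b') :
    a = a' ∧ b = b' := by
  have hsp : Submodule.span ℝ {b - a} = Submodule.span ℝ {b' - a'} := by
    rw [← vectorSpan_segment, ← vectorSpan_segment, hs]
  have hne : b - a ≠ 0 := sub_ne_zero.2 h.ne.symm
  have hT : b - a ∈ vectorSpan ℝ P := vsub_mem_vectorSpan ℝ h.right_mem h.left_mem
  obtain ⟨r, hr⟩ : ∃ r : ℝ, r • (b - a) = b' - a' := by
    rw [← Submodule.mem_span_singleton, hsp]
    exact Submodule.mem_span_singleton_self _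
  have ma : a ∈ segment ℝ a' b' := hs ▸ left_mem_segment ℝ a b
  have mb : b ∈ segment ℝ a' b' := hs ▸ right_mem_segment ℝ a b
  have ma' : a' ∈ segment ℝ a b := hs ▸ left_mem_segment ℝ a' b'
  have mb' : b' ∈ segment ℝ a b := hs ▸ right_mem_segment ℝ a' b'
  rw [segment_eq_image'] at ma mb ma' mb'
  obtain ⟨s, hs, e3⟩ := ma'
  obtain ⟨q, hq, e4⟩ := ma
  obtain ⟨s', hs', e3'⟩ := mb'
  obtain ⟨q', hq', e4'⟩ := mb
  simp only at e3 e4 e3' e4'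
  have hr0 : 0 ≤ r := by
    obtain ⟨y, hy, hy0⟩ := exists_form_ne_zero hP ω hT hne
      h.left_mem
    have hyP : y ∈ P := hP ▸ subset_convexHull ℝ _ hy
    have h1 := h.nonneg y hyP
    have h2 := h'.nonneg y hyP
    rw [← hr, map_smul, LinearMap.smul_apply, smul_eq_mul, ← e3,
      show y - (a + s • (b - a)) = (y - a) - s • (b - a) by abel, map_sub, map_smul,
      ω.self_eq_zero, smul_zero, sub_zero] at h2
    by_contra! h3
    have := mul_neg_of_neg_of_pos h3 (lt_of_le_of_ne h1 hy0.symm)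
    linarith
  have hs0 : s = 0 := by
    have : (s + q * r) • (b - a) = 0 := by
      rw [← hr, ← e3] at e4
      rw [← sub_eq_zero] at e4
      rw [← e4]; module
    have := (smul_eq_zero.1 this).resolve_right hne
    have h2 := mul_nonneg hq.1 hr0
    linarith [hs.1]
  have ea : a = a' := by rw [← e3, hs0, zero_smul, add_zero]
  refine ⟨ea, ?_⟩
  subst ea
  have h1 : s' = r := by
    have : (s' - r) • (b - a) = 0 := by rw [sub_smul, hr, ← e3']; abel
    have := (smul_eq_zero.1 this).resolve_right hne
    linarith
  have h2 : q' * r = 1 := by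
    have : (q' * r - 1) • (b - a) = 0 := by
      rw [sub_smul, mul_smul, hr, one_smul, sub_eq_zero, eq_sub_iff_add_eq, add_comm]
      exact e4'
    have := (smul_eq_zero.1 this).resolve_right hne
    linarith
  have h3 : r = 1 := by nlinarith [hq'.1, hq'.2, hs'.1, hs'.2]
  rw [h3, one_smul] at hr
  exact sub_left_injective hr

/-- At the end of every side another side begins, in a different direction. -/
theorem IsOrientedSide.exists_next (hP : P = convexHull ℝ (S : Set U))
    (ω : AreaForm (vectorSpan ℝ P))
    {a b : U} (h : IsOrientedSide ω.form P a b) :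
    ∃ c, IsOrientedSide ω.form P b c ∧ ω.form (b - a) (c - b) ≠ 0 := by
  classical
  have hne : b - a ≠ 0 := sub_ne_zero.2 h.ne.symm
  have hu : b - a ∈ vectorSpan ℝ P := vsub_mem_vectorSpan ℝ h.right_mem h.left_mem
  obtain ⟨e, he, h1⟩ := ω.nondeg _ hu hne
  have hSP : ∀ y ∈ S, y ∈ P := fun y hy => hP ▸ subset_convexHull ℝ _ hy
  have hb : ∀ y, ω.form (b - a) (y - b) = ω.form (b - a) (y - a) := by
    intro y
    rw [show y - b = (y - a) - (b - a) by abel, map_sub, ω.self_eq_zero, sub_zero]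
  have hnn : ∀ y ∈ P, 0 ≤ ω.form (b - a) (y - b) := fun y hy => by rw [hb]; exact h.nonneg y hy
  let S' := S.filter fun y => 0 < ω.form (b - a) (y - b)
  have hS' : S'.Nonempty := by
    obtain ⟨y, hy, hy0⟩ := exists_form_ne_zero hP ω hu hne
      h.right_mem
    exact ⟨y, Finset.mem_filter.2 ⟨hy, lt_of_le_of_ne (hnn y (hSP y hy)) hy0.symm⟩⟩
  -- Seen from `b`, the next side has the extreme direction: maximality of this slope is exactly `0
  -- ≤ ω(c - b, y - b)` after expanding in the frame `b - a`, `e`.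
  obtain ⟨c, hc, hmax⟩ := S'.exists_max_image
    (fun y => ω.form (y - b) e / ω.form (b - a) (y - b)) hS'
  obtain ⟨hcS, hc0⟩ := Finset.mem_filter.1 hc
  have hcP := hSP c hcS
  have hcT : c - b ∈ vectorSpan ℝ P := vsub_mem_vectorSpan ℝ hcP h.right_mem
  have hcb : c ≠ b := by
    rintro rfl
    simp at hc0
  have hpos : ∀ y ∈ P, 0 ≤ ω.form (c - b) (y - b) := by
    have hS : ∀ y ∈ S, 0 ≤ ω.form (c - b) (y - b) := by
      intro y hy
      rcases (hnn y (hSP y hy)).eq_or_lt with h0 | h0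
      · have hm := h.mem_segment y (hSP y hy) (by rw [← hb]; exact h0.symm)
        rw [segment_symm, segment_eq_image'] at hm
        obtain ⟨θ, hθ, rfl⟩ := hm
        simp only [add_sub_cancel_left, map_smul, smul_eq_mul]
        rw [← neg_sub b a, map_neg, ← ω.swap]
        exact mul_nonneg hθ.1 hc0.le
      · have := hmax y (Finset.mem_filter.2 ⟨hy, h0⟩)
        rw [div_le_div_iff₀ h0 hc0] at this
        rw [ω.form_eq hu he hcT h1]
        linarith
    have : P ⊆ {y | ω.form (c - b) b ≤ ω.form (c - b) y} := by
      conv_lhs => rw [hP]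
      refine convexHull_min (fun y hy => ?_) (convex_halfSpace_ge (ω.form (c - b)).isLinear _)
      have := hS y hy
      rw [map_sub] at this
      exact sub_nonneg.1 this
    intro y hy
    rw [map_sub]
    exact sub_nonneg.2 (this hy)
  obtain ⟨x, z, hxz, ⟨t, ht, hzx⟩, hbs, hx0⟩ := Trop.exists_orientedSide hP ω h.right_mem hcP
    hcb.symm hcT (sub_ne_zero.2 hcb) hpos (ω.self_eq_zero _)
  -- The new side cannot begin strictly before `b`, since that part of its line lies strictly to the
  -- right of `[a, b]`.
  have hbx : b = x := by
    rw [segment_eq_image'] at hbs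
    obtain ⟨θ, hθ, e1⟩ := hbs
    simp only at e1
    have h2 := hnn x hxz.left_mem
    have : x - b = -((θ * t) • (c - b)) := by rw [mul_smul, ← hzx, ← e1]; abel
    rw [this, map_neg, map_smul, smul_eq_mul] at h2
    have h3 : θ = 0 := by
      by_contra h3
      have : 0 < θ * t * ω.form (b - a) (c - b) :=
        mul_pos (mul_pos (lt_of_le_of_ne hθ.1 (Ne.symm h3)) ht) hc0
      linarith
    rw [← e1, h3, zero_smul, add_zero]
  subst hbx
  refine ⟨z, hxz, ?_⟩
  rw [hzx, map_smul, smul_eq_mul]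
  exact (mul_pos ht hc0).ne'

/-- The boundary of the boundary of a polygon vanishes. -/
theorem sum_orientedSide (hP : P = convexHull ℝ (S : Set U))
    (ω : AreaForm (vectorSpan ℝ P))
    {sides : Finset (Set U)}
    (hsides : ∀ F, F ∈ sides ↔ IsFace F P ∧ dim F = 1) {A : Type*} [AddCommGroup A]
    (l r : Set U → U) (hl : ∀ F ∈ sides, IsOrientedSide ω.form P (l F) (r F))
    (hF : ∀ F ∈ sides, F = segment ℝ (l F) (r F)) (g : U → A) :
    ∑ F ∈ sides, g (r F) = ∑ F ∈ sides, g (l F) := by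
  classical
  have hconv : Convex ℝ P := hP ▸ convex_convexHull ℝ (S : Set U)
  have hnext : ∀ F : sides, ∃ F' : sides, l F' = r F := by
    rintro ⟨F, hFs⟩
    obtain ⟨c, hc, -⟩ := (hl F hFs).exists_next hP ω
    have hmem : segment ℝ (r F) c ∈ sides :=
      (hsides _).2 ⟨hc.isFace ω hconv, dim_segment hc.ne⟩
    exact ⟨⟨_, hmem⟩, ((hl _ hmem).eq_of_segment_eq hP ω hc (hF _ hmem).symm).1⟩
  -- The successor map is injective because a side is determined by its end point. On a finite set
  -- it is then a permutation, which matches the two sums.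
  choose nx hnx using hnext
  have hinj : Function.Injective nx := by
    intro F F' h
    have h1 : r F = r F' := by rw [← hnx F, ← hnx F', h]
    have h2 := hl F F.2
    rw [h1] at h2
    have h3 := h2.left_unique ω (hl F' F'.2)
    apply Subtype.ext
    rw [hF F F.2, hF F' F'.2, h1, h3]
  have hbij : Function.Bijective nx := Finite.injective_iff_bijective.1 hinj
  rw [← Finset.sum_coe_sort, ← Finset.sum_coe_sort sides fun F => g (l F),
    ← (Equiv.ofBijective nx hbij).sum_comp fun F => g (l F)]
  exact Finset.sum_congr rfl fun F _ => by rw [Equiv.ofBijective_apply, hnx]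

end Polygon

end Trop

/-! ### Rational polygons: lattice bases adapted to a side. -/

namespace Trop

section RationalPolygon

variable {U : Type*} [AddCommGroup U] [Module ℝ U] {L : AddSubgroup U} {P : Set U}

open Filter Topology in
/-- The sides of a rational polygon have rational directions. -/
theorem IsOrientedSide.exists_primitive (hL : IsFullLattice L) (hP : IsRationalPolytope L P)
    (ω : AreaForm (vectorSpan ℝ P)) {a b : U} (h : IsOrientedSide ω.form P a b) :
    ∃ u, IsPrimitive L u ∧ ∃ t : ℝ, 0 < t ∧ b - a = t • u := by
  obtain ⟨-, H, hH, hPH⟩ := hP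
  have hne : b - a ≠ 0 := sub_ne_zero.2 h.ne.symm
  have hu : b - a ∈ vectorSpan ℝ P := vsub_mem_vectorSpan ℝ h.right_mem h.left_mem
  set x : U := a + (1 / 2 : ℝ) • (b - a) with hx
  have hle : ∀ y ∈ P, ∀ f ∈ H, f.1 y ≤ f.2 := by
    intro y hy
    rw [hPH] at hy
    exact hy
  have hfx : ∀ f : U →ₗ[ℝ] ℝ, f x = (f a + f b) / 2 := by
    intro f
    rw [hx, map_add, map_smul, map_sub, smul_eq_mul]; ring
  -- The constraints that are tight at the midpoint of the side vanish on `b - a`, so they vanish on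
  -- some nonzero lattice vector `w`. Moving from the midpoint by a small multiple of `± w` stays
  -- inside `P`, which forces `w` to be parallel to the side.
  let H' : Set (U →ₗ[ℝ] ℝ) := {f | ∃ c, (f, c) ∈ H ∧ f x = c}
  have hH' : ∀ f ∈ H', f (b - a) = 0 := by
    rintro f ⟨c, hc, hfc⟩
    have h1 := hle a h.left_mem _ hc
    have h2 := hle b h.right_mem _ hc
    have h3 := hfx f
    rw [map_sub]
    simp only at h1 h2
    linarith
  obtain ⟨w, hwL, hw0, hw⟩ := hL.exists_mem_of_rational H'
    (fun f ⟨c, hc, _⟩ => hH _ hc) hne hH'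
  have hev : ∀ᶠ ε in 𝓝[>] (0 : ℝ), ∀ f ∈ H, f.1 (x + ε • w) ≤ f.2 ∧ f.1 (x - ε • w) ≤ f.2 := by
    rw [Filter.eventually_all_finset]
    intro f hf
    by_cases hfc : f.1 x = f.2
    · have : f.1 w = 0 := hw f.1 ⟨f.2, hf, hfc⟩
      refine Filter.Eventually.of_forall fun ε => ?_
      simp [this, hfc]
    · have hlt : f.1 x < f.2 := by
        refine lt_of_le_of_ne ?_ hfc
        rw [hfx]
        linarith [hle a h.left_mem f hf, hle b h.right_mem f hf]
      have hc : 0 < (f.2 - f.1 x) / (|f.1 w| + 1) := div_pos (by linarith) (by positivity)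
      filter_upwards [eventually_pos_lt hc, self_mem_nhdsWithin] with ε h1 h2
      have h2 : 0 < ε := h2
      rw [lt_div_iff₀ (by positivity)] at h1
      have h3 : |ε * f.1 w| ≤ f.2 - f.1 x := by
        rw [abs_mul, abs_of_pos h2]
        nlinarith [abs_nonneg (f.1 w)]
      have h4 := abs_le.1 h3
      simp only [map_add, map_sub, map_smul, smul_eq_mul]
      constructor <;> linarith
  obtain ⟨ε, hε, hε0⟩ := (hev.and self_mem_nhdsWithin).exists
  have hε0 : 0 < ε := hε0
  have m1 : x + ε • w ∈ P := by rw [hPH]; exact fun f hf => (hε f hf).1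
  have m2 : x - ε • w ∈ P := by rw [hPH]; exact fun f hf => (hε f hf).2
  have hwT : w ∈ vectorSpan ℝ P := by
    have := vsub_mem_vectorSpan ℝ m1 m2
    rw [vsub_eq_sub, show x + ε • w - (x - ε • w) = (2 * ε) • w by module] at this
    exact (Submodule.smul_mem_iff _ (by positivity)).1 this
  have hxa : ω.form (b - a) (x - a) = 0 := by
    rw [hx, add_sub_cancel_left, map_smul, ω.self_eq_zero, smul_zero]
  have n1 := h.nonneg _ m1
  have n2 := h.nonneg _ m2
  rw [show x + ε • w - a = (x - a) + ε • w by abel, map_add, hxa, map_smul, zero_add,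
    smul_eq_mul] at n1
  rw [show x - ε • w - a = (x - a) - ε • w by abel, map_sub, hxa, map_smul, zero_sub,
    smul_eq_mul] at n2
  have hzero : ω.form (b - a) w = 0 := by
    have : ε * ω.form (b - a) w = 0 := by linarith
    exact (mul_eq_zero.1 this).resolve_left hε0.ne'
  obtain ⟨r, hr⟩ := ω.eq_smul_of_eq_zero hu hwT hne hzero
  have hr0 : r ≠ 0 := by
    rintro rfl
    exact hw0 (by rw [hr, zero_smul])
  obtain ⟨n, hn, k, hk, hwk⟩ := hL.exists_primitive hwL hw0
  have hk' : (0 : ℝ) < k := by exact_mod_cast hk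
  have hbn : b - a = (r⁻¹ * k) • n := by
    rw [mul_smul, Nat.cast_smul_eq_nsmul, ← hwk, hr, inv_smul_smul₀ hr0]
  rcases lt_or_gt_of_ne hr0 with hneg | hpos
  · refine ⟨-n, hn.neg, -(r⁻¹ * k), ?_, by rw [hbn]; module⟩
    have := mul_neg_of_neg_of_pos (inv_lt_zero.2 hneg) hk'
    linarith
  · exact ⟨n, hn, r⁻¹ * k, by positivity, hbn⟩

/-- The lattice of a polygon is generated by the direction of a side and a primitive normal. -/
theorem IsPrimitiveNormal.exists_combination {a b u ν : U} (hu : IsPrimitive L u) {t : ℝ}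
    (hbu : b - a = t • u) (hν : IsPrimitiveNormal L (segment ℝ a b) P ν) {z : U} (hz : z ∈ L)
    (hzT : z ∈ vectorSpan ℝ P) : ∃ k j : ℤ, z = k • ν + j • u := by
  obtain ⟨k, hk⟩ := hν.2.2.1 z hz hzT
  rw [vectorSpan_segment, Submodule.mem_span_singleton] at hk
  obtain ⟨s, hs⟩ := hk
  rw [hbu, smul_smul] at hs
  obtain ⟨j, hj⟩ := hu.2.2 (s * t) (hs ▸ L.sub_mem hz (L.zsmul_mem hν.1 k))
  refine ⟨k, j, ?_⟩
  rw [hj, Int.cast_smul_eq_zsmul] at hs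
  rw [hs]; abel

/-- The next side supplies a lattice vector not parallel to `u`. It is an integral combination of
`u` and `ν`, so `ω(u, ν)` is nonzero, and the sign comes from `ν` pointing into `P`. -/
theorem IsOrientedSide.form_normal_pos (hL : IsFullLattice L) (hP : IsRationalPolytope L P)
    (ω : AreaForm (vectorSpan ℝ P)) {a b u ν : U} (h : IsOrientedSide ω.form P a b)
    (hu : IsPrimitive L u) {t : ℝ} (ht : 0 < t) (hbu : b - a = t • u)
    (hν : IsPrimitiveNormal L (segment ℝ a b) P ν) : 0 < ω.form u ν := by
  obtain ⟨S, -, hS⟩ := hP.1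
  obtain ⟨c, hc, hc0⟩ := h.exists_next hS ω
  obtain ⟨u', hu', t', ht', hcu⟩ := hc.exists_primitive hL hP ω
  have hu'T : u' ∈ vectorSpan ℝ P := by
    have := vsub_mem_vectorSpan ℝ hc.right_mem hc.left_mem
    rw [vsub_eq_sub, hcu] at this
    exact (Submodule.smul_mem_iff _ ht'.ne').1 this
  obtain ⟨k, j, hkj⟩ := hν.exists_combination hu hbu hu'.1 hu'T
  have h1 : ω.form (b - a) (c - b) = t * t' * k * ω.form u ν := by
    rw [hbu, hcu, hkj, ← Int.cast_smul_eq_zsmul ℝ, ← Int.cast_smul_eq_zsmul ℝ]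
    simp only [map_smul, map_add, LinearMap.smul_apply, smul_eq_mul, ω.self_eq_zero]
    ring
  have h2 : ω.form u ν ≠ 0 := fun h => hc0 (by rw [h1, h, mul_zero])
  refine lt_of_le_of_ne ?_ h2.symm
  obtain ⟨x, hx, ε, hε, hxε⟩ := hν.2.2.2
  have h3 := h.nonneg _ hxε
  rw [segment_eq_image'] at hx
  obtain ⟨θ, -, rfl⟩ := hx
  simp only at h3
  rw [show a + θ • (b - a) + ε • ν - a = θ • (b - a) + ε • ν by abel, map_add, map_smul,
    ω.self_eq_zero, smul_zero, zero_add, hbu, map_smul, map_smul, LinearMap.smul_apply,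
    smul_eq_mul, smul_eq_mul] at h3
  by_contra! h4
  have := mul_neg_of_pos_of_neg ht h4
  have := mul_neg_of_pos_of_neg hε this
  linarith

theorem eq_of_mul_int {x y : ℝ} (hx : 0 < x) (hy : 0 < y) {k j : ℤ} (h1 : x = k * y)
    (h2 : y = j * x) : x = y := by
  have hk : 0 < k := by
    by_contra! h
    have : (k : ℝ) * y ≤ 0 := mul_nonpos_of_nonpos_of_nonneg (by exact_mod_cast h) hy.le
    linarith
  have hj : 0 < j := by
    by_contra! h
    have : (j : ℝ) * x ≤ 0 := mul_nonpos_of_nonpos_of_nonneg (by exact_mod_cast h) hx.le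
    linarith
  have hk1 : (1 : ℝ) ≤ k := by exact_mod_cast hk
  have hj1 : (1 : ℝ) ≤ j := by exact_mod_cast hj
  apply le_antisymm
  · rw [h2]; nlinarith
  · rw [h1]; nlinarith

/-- Both `u, ν` and `u', ν'` generate the lattice of the plane, so the two areas are integral
multiples of each other. Being positive, they agree. -/
theorem form_normal_eq (ω : AreaForm (vectorSpan ℝ P)) {a b u ν a' b' u' ν' : U}
    (hu : IsPrimitive L u) {t : ℝ} (hbu : b - a = t • u)
    (hν : IsPrimitiveNormal L (segment ℝ a b) P ν) (huT : u ∈ vectorSpan ℝ P)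
    (hpos : 0 < ω.form u ν)
    (hu' : IsPrimitive L u') {t' : ℝ} (hbu' : b' - a' = t' • u')
    (hν' : IsPrimitiveNormal L (segment ℝ a' b') P ν') (huT' : u' ∈ vectorSpan ℝ P)
    (hpos' : 0 < ω.form u' ν') : ω.form u ν = ω.form u' ν' := by
  obtain ⟨k₁, j₁, e₁⟩ := hν.exists_combination hu hbu hu'.1 huT'
  obtain ⟨k₂, j₂, e₂⟩ := hν.exists_combination hu hbu hν'.1 hν'.2.1
  obtain ⟨k₃, j₃, e₃⟩ := hν'.exists_combination hu' hbu' hu.1 huT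
  obtain ⟨k₄, j₄, e₄⟩ := hν'.exists_combination hu' hbu' hν.1 hν.2.1
  have key : ∀ (x y : U) (k j k' j' : ℤ), ω.form (k • y + j • x) (k' • y + j' • x) =
      ((j * k' - k * j' : ℤ) : ℝ) * ω.form x y := by
    intro x y k j k' j'
    simp only [← Int.cast_smul_eq_zsmul ℝ]
    simp only [map_smul, map_add, LinearMap.smul_apply, LinearMap.add_apply, smul_eq_mul,
      ω.self_eq_zero]
    rw [ω.swap y x]
    push_cast; ring
  refine eq_of_mul_int hpos hpos' (k := j₃ * k₄ - k₃ * j₄) (j := j₁ * k₂ - k₁ * j₂) ?_ ?_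
  · conv_lhs => rw [e₃, e₄]
    exact key _ _ _ _ _ _
  · conv_lhs => rw [e₁, e₂]
    exact key _ _ _ _ _ _

end RationalPolygon

theorem segment_eq_segment_iff {U : Type*} [AddCommGroup U] [Module ℝ U] {a b a' b' : U}
    (h : segment ℝ a b = segment ℝ a' b') : (a = a' ∧ b = b') ∨ (a = b' ∧ b = a') := by
  by_cases hab : a = b
  · subst hab
    rw [segment_same] at h
    have h1 : a' ∈ ({a} : Set U) := h ▸ left_mem_segment ℝ a' b'
    have h2 : b' ∈ ({a} : Set U) := h ▸ right_mem_segment ℝ a' b'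
    exact Or.inl ⟨h1.symm, h2.symm⟩
  have hne : b - a ≠ 0 := sub_ne_zero.2 (Ne.symm hab)
  have m1 : a' ∈ segment ℝ a b := h ▸ left_mem_segment ℝ a' b'
  have m2 : b' ∈ segment ℝ a b := h ▸ right_mem_segment ℝ a' b'
  have m3 : a ∈ segment ℝ a' b' := h ▸ left_mem_segment ℝ a b
  have m4 : b ∈ segment ℝ a' b' := h ▸ right_mem_segment ℝ a b
  rw [segment_eq_image'] at m1 m2 m3 m4
  obtain ⟨s, hs, rfl⟩ := m1
  obtain ⟨r, hr, rfl⟩ := m2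
  obtain ⟨p, hp, e3⟩ := m3
  obtain ⟨q, hq, e4⟩ := m4
  simp only at e3 e4
  have f3 : s + p * (r - s) = 0 := by
    have : (s + p * (r - s)) • (b - a) = 0 := by
      rw [← sub_eq_zero] at e3
      rw [← e3]; module
    exact (smul_eq_zero.1 this).resolve_right hne
  have f4 : s + q * (r - s) = 1 := by
    have : (s + q * (r - s) - 1) • (b - a) = 0 := by
      rw [← sub_eq_zero] at e4
      rw [← e4]; module
    have := (smul_eq_zero.1 this).resolve_right hne
    linarith
  have hp' := hp.1
  have hp'' := hp.2
  have hq' := hq.1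
  have hq'' := hq.2
  rcases le_total s r with hsr | hsr
  · have s0 : s = 0 := by nlinarith [hs.1]
    have r1 : r = 1 := by
      subst s0
      have : q * r = 1 := by linarith
      nlinarith [hr.2]
    left; simp [s0, r1]
  · have r0 : r = 0 := by nlinarith [hr.1]
    have s1 : s = 1 := by
      subst r0
      have : s * (1 - q) = 1 := by linarith
      nlinarith [hs.2, hs.1]
    right; simp [s1, r0]

/-! ### The horizontal vector of a facet and the value of its boundary. -/

section Facet

variable {M : Type*} [AddCommGroup M] [Module ℝ M] {N Λ : AddSubgroup M}
  {Q : Type*} [AddCommGroup Q]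

/-- The horizontal vector `dt(ν) u - dt(u) ν`. -/
def horizontal (u ν : M × ℝ) : M := (ν.2 • u - u.2 • ν).1

theorem exists_int_snd {M : Type*} [AddCommGroup M] {N : AddSubgroup M} {x : M × ℝ}
    (hx : x ∈ prodLattice N) : ∃ k : ℤ, x.2 = k := by
  obtain ⟨k, hk⟩ := AddSubgroup.mem_zmultiples_iff.1 (AddSubgroup.mem_prod.1 hx).2
  exact ⟨k, by rw [← hk]; simp⟩

theorem horizontal_mem {u ν : M × ℝ} (hu : u ∈ prodLattice N) (hν : ν ∈ prodLattice N) :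
    horizontal u ν ∈ N := by
  obtain ⟨j, hj⟩ := exists_int_snd hu
  obtain ⟨k, hk⟩ := exists_int_snd hν
  rw [horizontal, hj, hk, Int.cast_smul_eq_zsmul, Int.cast_smul_eq_zsmul]
  exact (AddSubgroup.mem_prod.1 ((prodLattice N).sub_mem ((prodLattice N).zsmul_mem hu k)
    ((prodLattice N).zsmul_mem hν j))).1

/-- On a plane `horizontal` is bilinear and alternating, hence a fixed vector times the area form.
-/
theorem horizontal_eq_of_form {T : Submodule ℝ (M × ℝ)} (ω : AreaForm T) {u ν u' ν' : M × ℝ}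
    (hu : u ∈ T) (hν : ν ∈ T) (hu' : u' ∈ T) (hν' : ν' ∈ T) (hpos : 0 < ω.form u ν)
    (h : ω.form u ν = ω.form u' ν') : horizontal u ν = horizontal u' ν' := by
  have hu0 : u ≠ 0 := by
    rintro rfl
    simp at hpos
  obtain ⟨e, he, h1⟩ := ω.nondeg u hu hu0
  have key : ∀ x ∈ T, ∀ y ∈ T, horizontal x y = ω.form x y • horizontal u e := by
    intro x hx y hy
    rw [ω.form_eq hu he hx h1]
    have ex := ω.expand hu he hx h1
    have ey := ω.expand hu he hy h1
    set p := ω.form x e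
    set q := ω.form u x
    set r := ω.form y e
    set s := ω.form u y
    rw [ex, ey]
    simp only [horizontal, Prod.fst_sub, Prod.smul_fst, Prod.fst_add, Prod.snd_add, Prod.smul_snd,
      smul_eq_mul]
    module
  rw [key u hu ν hν, key u' hu' ν' hν', h]

theorem not_linearIndependent_fst {T : Submodule ℝ (M × ℝ)} (hT : Module.finrank ℝ T = 2)
    {x y z : M × ℝ} (hx : x ∈ T) (hy : y ∈ T) (hz : z ∈ T) :
    ¬ LinearIndependent ℝ ![x.1, y.1, z.1] := by
  intro h
  have : Module.Finite ℝ T := Module.finite_of_finrank_pos (by omega)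
  have h1 : LinearIndependent ℝ (![⟨x, hx⟩, ⟨y, hy⟩, ⟨z, hz⟩] : Fin 3 → T) := by
    refine LinearIndependent.of_comp ((LinearMap.fst ℝ M ℝ).comp T.subtype) ?_
    convert h using 1
    ext i
    fin_cases i <;> rfl
  have := h1.fintype_card_le_finrank
  rw [hT] at this
  simp at this

/-- The boundary of a facet, swept by its horizontal vector, has value zero. -/
theorem exists_facetData (hN : IsFullLattice N) (J : Calibration N Λ Q) {P : Set (M × ℝ)}
    (hP : IsRationalPolytope (prodLattice N) P) (hdim : dim P = 2) {sides : Finset (Set (M × ℝ))}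
    (hsides : ∀ F, F ∈ sides ↔ IsFace F P ∧ dim F = 1) (ν : Set (M × ℝ) → M × ℝ)
    (hν : ∀ F ∈ sides, IsPrimitiveNormal (prodLattice N) F P (ν F)) :
    ∃ l r u : Set (M × ℝ) → M × ℝ,
      (∀ F ∈ sides, F = segment ℝ (l F) (r F) ∧ IsPrimitive (prodLattice N) (u F) ∧
        ∃ t : ℝ, 0 < t ∧ r F - l F = t • u F) ∧
      ∑ F ∈ sides, J.val (horizontal (u F) (ν F)) (l F).1 (r F).1 = 0 := by
  classical
  have hL := hN.prodLattice
  obtain ⟨S, ⟨s₀, hs₀⟩, hS⟩ := hP.1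
  obtain ⟨ω⟩ := AreaForm.exists_of_finrank hdim
  have h1 : ∀ F ∈ sides, ∃ a b u, (IsOrientedSide ω.form P a b ∧ F = segment ℝ a b) ∧
      IsPrimitive (prodLattice N) u ∧ ∃ t : ℝ, 0 < t ∧ b - a = t • u := by
    intro F hF
    obtain ⟨a, b, hab, hFab⟩ := ((hsides F).1 hF).1.exists_orientedSide hS ω hdim
      ((hsides F).1 hF).2
    obtain ⟨u, hu, t, ht, hbu⟩ := hab.exists_primitive hL hP ω
    exact ⟨a, b, u, ⟨hab, hFab⟩, hu, t, ht, hbu⟩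
  choose! l r u h2 using h1
  refine ⟨l, r, u, fun F hF => ⟨(h2 F hF).1.2, (h2 F hF).2⟩, ?_⟩
  rcases sides.eq_empty_or_nonempty with rfl | ⟨F₀, hF₀⟩
  · simp
  have huT : ∀ F ∈ sides, u F ∈ vectorSpan ℝ P := by
    intro F hF
    obtain ⟨⟨hab, -⟩, -, t, ht, hbu⟩ := h2 F hF
    have := vsub_mem_vectorSpan ℝ hab.right_mem hab.left_mem
    rw [vsub_eq_sub, hbu] at this
    exact (Submodule.smul_mem_iff _ ht.ne').1 this
  have hν' : ∀ F ∈ sides, IsPrimitiveNormal (prodLattice N) (segment ℝ (l F) (r F)) P (ν F) := by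
    intro F hF
    have h3 := hν F hF
    have h4 := (h2 F hF).1.2
    generalize ν F = x at h3 ⊢
    rwa [h4] at h3
  have hpos : ∀ F ∈ sides, 0 < ω.form (u F) (ν F) := by
    intro F hF
    obtain ⟨⟨hab, -⟩, hu, t, ht, hbu⟩ := h2 F hF
    exact hab.form_normal_pos hL hP ω hu ht hbu (hν' F hF)
  -- All sides have the same normalized area, so they share a single coefficient vector `n`.
  have hZ : ∀ F ∈ sides, horizontal (u F) (ν F) = horizontal (u F₀) (ν F₀) := by
    intro F hF
    obtain ⟨⟨hab, -⟩, hu, t, ht, hbu⟩ := h2 F hF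
    obtain ⟨⟨hab', -⟩, hu', t', ht', hbu'⟩ := h2 F₀ hF₀
    refine horizontal_eq_of_form ω (huT F hF) (hν F hF).2.1 (huT F₀ hF₀) (hν F₀ hF₀).2.1
      (hpos F hF) ?_
    exact form_normal_eq ω hu hbu (hν' F hF) (huT F hF) (hpos F hF) hu' hbu' (hν' F₀ hF₀)
      (huT F₀ hF₀) (hpos F₀ hF₀)
  set n := horizontal (u F₀) (ν F₀) with hn
  have hnN : n ∈ N := horizontal_mem (h2 F₀ hF₀).2.1.1 (hν F₀ hF₀).1
  have hoP : s₀ ∈ P := hS ▸ subset_convexHull ℝ _ hs₀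
  -- Cone from `s₀`. The vector `n` and the triangle come from the plane of the facet, so their
  -- projections to `M` are dependent and the triangle rule applies; the cone terms then telescope
  -- around the polygon.
  have hterm : ∀ F ∈ sides, J.val (horizontal (u F) (ν F)) (l F).1 (r F).1 =
      J.val n s₀.1 (r F).1 - J.val n s₀.1 (l F).1 := by
    intro F hF
    obtain ⟨⟨hab, -⟩, -⟩ := h2 F hF
    rw [hZ F hF, eq_sub_iff_add_eq, add_comm]
    refine J.triangle hnN _ _ _ ?_
    have hZT : (ν F₀).2 • u F₀ - (u F₀).2 • ν F₀ ∈ vectorSpan ℝ P :=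
      Submodule.sub_mem _ (Submodule.smul_mem _ _ (huT F₀ hF₀))
        (Submodule.smul_mem _ _ (hν F₀ hF₀).2.1)
    have hlT : l F - s₀ ∈ vectorSpan ℝ P := vsub_mem_vectorSpan ℝ hab.left_mem hoP
    have hrT : r F - s₀ ∈ vectorSpan ℝ P := vsub_mem_vectorSpan ℝ hab.right_mem hoP
    have h3 := not_linearIndependent_fst hdim hZT hlT hrT
    rw [Prod.fst_sub (l F), Prod.fst_sub (r F)] at h3
    exact h3
  rw [Finset.sum_congr rfl hterm, Finset.sum_sub_distrib, sub_eq_zero]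
  exact sum_orientedSide hS ω hsides l r (fun F hF => (h2 F hF).1.1)
    (fun F hF => (h2 F hF).1.2) fun x => J.val n s₀.1 x.1

end Facet

end Trop

/-! ### Surfaces: values of fibres and of elementary equivalences. -/

namespace Trop

theorem sum_eq_zero_of_fiberwise {α K A : Type*} [AddCommMonoid A] (s : Finset α) (key : α → K)
    (f : α → A) (h : ∀ x₀ ∈ s, (letI := Classical.decEq K; ∑ x ∈ s with key x = key x₀, f x) = 0) :
    ∑ x ∈ s, f x = 0 := by
  classical
  rw [← Finset.sum_fiberwise_of_maps_to (t := s.image key) (g := key)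
    fun x hx => Finset.mem_image_of_mem key hx]
  refine Finset.sum_eq_zero fun κ hκ => ?_
  obtain ⟨x₀, hx₀, rfl⟩ := Finset.mem_image.1 hκ
  rw [← h x₀ hx₀]

theorem sum_eq_sum_of_fiberwise {α β K A : Type*} [AddCommMonoid A] (s : Finset α) (s' : Finset β)
    (key : α → K) (key' : β → K) (f : α → A) (f' : β → A)
    (h : ∀ κ, (κ ∈ Set.range key ∨ κ ∈ Set.range key') → (letI := Classical.decEq K
      ∑ x ∈ s with key x = κ, f x = ∑ x ∈ s' with key' x = κ, f' x)) :
    ∑ x ∈ s, f x = ∑ x ∈ s', f' x := by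
  classical
  rw [← Finset.sum_fiberwise_of_maps_to (t := s.image key ∪ s'.image key') (g := key)
      fun x hx => Finset.mem_union_left _ (Finset.mem_image_of_mem key hx),
    ← Finset.sum_fiberwise_of_maps_to (t := s.image key ∪ s'.image key') (g := key')
      fun x hx => Finset.mem_union_right _ (Finset.mem_image_of_mem key' hx)]
  refine Finset.sum_congr rfl fun κ hκ => ?_
  have := h κ (by
    rcases Finset.mem_union.1 hκ with h | h
    · obtain ⟨x, -, rfl⟩ := Finset.mem_image.1 h
      exact Or.inl ⟨x, rfl⟩
    · obtain ⟨x, -, rfl⟩ := Finset.mem_image.1 h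
      exact Or.inr ⟨x, rfl⟩)
  convert this

variable {M : Type*} [AddCommGroup M] [Module ℝ M] {N Λ : AddSubgroup M}
  {Q : Type*} [AddCommGroup Q] (J : Calibration N Λ Q)

theorem IsPrimitive.eq_of_smul_eq {U : Type*} [AddCommGroup U] [Module ℝ U] {L : AddSubgroup U}
    {u u' : U} (hu : IsPrimitive L u) (hu' : IsPrimitive L u') {t t' : ℝ} (ht : 0 < t)
    (ht' : 0 < t') (h : t • u = t' • u') : u = u' := by
  have h1 : u = (t⁻¹ * t') • u' := by rw [mul_smul, ← h, inv_smul_smul₀ ht.ne']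
  rcases hu'.eq_or_eq_neg hu h1 with h2 | h2
  · exact h2
  · exfalso
    rw [h2] at h
    have : (t + t') • u' = 0 := by rw [add_smul, ← h]; module
    exact (smul_ne_zero (by linarith) hu'.2.1) this

/-- Translation of `M × ℝ` in the first factor. -/
def shift (l : M) (y : M × ℝ) : M × ℝ := (y.1 + l, y.2)

theorem shift_image_segment (l : M) (a b : M × ℝ) :
    shift l '' segment ℝ a b = segment ℝ (shift l a) (shift l b) := by
  have h : ∀ y : M × ℝ, shift l y = (l, 0) + y := fun y => by ext <;> simp [shift, add_comm]
  rw [h a, h b, ← segment_translate_image]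
  exact Set.image_congr fun y _ => h y

theorem horizontal_neg_left {u ν : M × ℝ} : horizontal (-u) ν = -horizontal u ν := by
  simp only [horizontal, smul_neg, Prod.snd_neg, neg_smul, sub_neg_eq_add, Prod.fst_add,
    Prod.fst_neg, Prod.fst_sub]
  abel

/-- `horizontal u ν` changes sign with `u`, so a reversed orientation is harmless, and translations
are absorbed by `Λ`. Sides of different facets over the same cell can thus be compared with one
reference segment. -/
theorem Calibration.val_horizontal_eq {l r u l₀ r₀ u₀ ν : M × ℝ} {t t₀ : ℝ} (ht : 0 < t)
    (ht₀ : 0 < t₀) (hu : IsPrimitive (prodLattice N) u) (hu₀ : IsPrimitive (prodLattice N) u₀)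
    (hν : ν ∈ prodLattice N) (h : r - l = t • u) (h₀ : r₀ - l₀ = t₀ • u₀) {x : M} (hx : x ∈ Λ)
    (hF : segment ℝ l r = shift x '' segment ℝ l₀ r₀) :
    J.val (horizontal u ν) l.1 r.1 = J.val (horizontal u₀ ν) l₀.1 r₀.1 := by
  rw [shift_image_segment] at hF
  have hsub : shift x r₀ - shift x l₀ = t₀ • u₀ := by
    rw [← h₀]; ext <;> simp [shift]
  rcases segment_eq_segment_iff hF with ⟨rfl, rfl⟩ | ⟨rfl, rfl⟩
  · have : u = u₀ := hu.eq_of_smul_eq hu₀ ht ht₀ (by rw [← h, hsub])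
    rw [this]
    exact J.translate _ _ _ hx
  · have : u = -u₀ := hu.eq_of_smul_eq hu₀.neg ht ht₀ (by rw [← h, smul_neg, ← hsub]; abel)
    rw [this, horizontal_neg_left, J.val_neg_swap (horizontal_mem hu₀.1 hν)]
    exact J.translate _ _ _ hx

variable {VB EB : Type} {m : EB → ℝ}

/-- Orientations and primitive directions of the sides of all facets. -/
structure Framing (W : SurfaceData N m) where
  l : W.ι → Set (M × ℝ) → M × ℝ
  r : W.ι → Set (M × ℝ) → M × ℝ
  u : W.ι → Set (M × ℝ) → M × ℝ
  eq_segment : ∀ i, ∀ F ∈ W.sides i, F = segment ℝ (l i F) (r i F)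
  isPrimitive : ∀ i, ∀ F ∈ W.sides i, IsPrimitive (prodLattice N) (u i F)
  sub_eq : ∀ i, ∀ F ∈ W.sides i, ∃ t : ℝ, 0 < t ∧ r i F - l i F = t • u i F
  sum_eq_zero : ∀ i, ∑ F ∈ W.sides i,
    J.val (horizontal (u i F) (W.normal i F)) (l i F).1 (r i F).1 = 0

theorem exists_framing (hN : IsFullLattice N) (W : SurfaceData N m) : Nonempty (Framing J W) := by
  have := fun i => exists_facetData hN J (W.rational i) (W.dim_poly i) (W.mem_sides i) (W.normal i)
    (W.normal_spec i)
  choose l r u h1 h2 using this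
  exact ⟨⟨l, r, u, fun i F hF => (h1 i F hF).1, fun i F hF => (h1 i F hF).2.1,
    fun i F hF => (h1 i F hF).2.2, h2⟩⟩

namespace Framing

variable {J} {W : SurfaceData N m} (R : Framing J W)

/-- For a fixed reference direction `u₀` the vector `horizontal u₀ ν` is additive in `ν`, so the
contributions of the class combine into one with coefficient `horizontal u₀ (normalSum)`. Balancing
makes that normal sum parallel to `u₀`, on which `horizontal u₀` vanishes. -/
theorem sum_class_eq_zero (e : EB) {i₀ : W.ι} {τ : Set (M × ℝ)} (hτ : τ ∈ W.sides i₀)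
    (hbal : W.normalSum Λ e τ ∈ vectorSpan ℝ τ) :
    (letI := Classical.decEq EB; letI := Classical.propDecidable
      ∑ i with W.edge i = e, ∑ F ∈ W.sides i with ∃ x ∈ Λ, F = shift x '' τ,
        W.weight i • J.val (horizontal (R.u i F) (W.normal i F)) (R.l i F).1 (R.r i F).1) = 0 := by
  classical
  obtain ⟨t₀, ht₀, h₀⟩ := R.sub_eq i₀ τ hτ
  have hu₀ := R.isPrimitive i₀ τ hτ
  have hs₀ := R.eq_segment i₀ τ hτ
  set u₀ := R.u i₀ τ
  set l₀ := R.l i₀ τ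
  set r₀ := R.r i₀ τ
  let H : M × ℝ →+ M :=
    { toFun := fun ν => horizontal u₀ ν
      map_zero' := by simp [horizontal]
      map_add' := by
        intro x y
        simp only [horizontal, Prod.snd_add, Prod.fst_sub, Prod.smul_fst, Prod.fst_add]
        module }
  have hH : ∀ ν, H ν = horizontal u₀ ν := fun _ => rfl
  have hmem : ∀ i, ∀ F ∈ W.sides i, W.normal i F ∈ prodLattice N :=
    fun i F hF => (W.normal_spec i F hF).1
  have key : ∀ i, ∀ F ∈ W.sides i, (∃ x ∈ Λ, F = shift x '' τ) →
      W.weight i • J.val (horizontal (R.u i F) (W.normal i F)) (R.l i F).1 (R.r i F).1 =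
        J.val (H (W.weight i • W.normal i F)) l₀.1 r₀.1 := by
    rintro i F hF ⟨x, hx, hFx⟩
    obtain ⟨t, ht, h⟩ := R.sub_eq i F hF
    rw [map_zsmul, hH, J.val_zsmul (horizontal_mem hu₀.1 (hmem i F hF))]
    congr 1
    refine J.val_horizontal_eq ht ht₀ (R.isPrimitive i F hF) hu₀ (hmem i F hF) h h₀ hx ?_
    rw [← R.eq_segment i F hF, ← hs₀]
    exact hFx
  have hfin : W.normalSum Λ e τ = ∑ x ∈ (Finset.univ.filter fun i => W.edge i = e).sigma
      fun i => (W.sides i).filter fun F => ∃ l ∈ Λ, F = shift l '' τ,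
        W.weight x.1 • W.normal x.1 x.2 := by
    rw [Finset.sum_sigma, SurfaceData.normalSum]
    rfl
  rw [Finset.sum_sigma']
  have h1 : ∀ x ∈ (Finset.univ.filter fun i => W.edge i = e).sigma
      fun i => (W.sides i).filter fun F => ∃ l ∈ Λ, F = shift l '' τ,
      W.weight x.1 • J.val (horizontal (R.u x.1 x.2) (W.normal x.1 x.2)) (R.l x.1 x.2).1
        (R.r x.1 x.2).1 = J.val (H (W.weight x.1 • W.normal x.1 x.2)) l₀.1 r₀.1 := by
    intro x hx
    rw [Finset.mem_sigma, Finset.mem_filter, Finset.mem_filter] at hx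
    exact key _ _ hx.2.1 hx.2.2
  have h2 : ∀ x ∈ (Finset.univ.filter fun i => W.edge i = e).sigma
      fun i => (W.sides i).filter fun F => ∃ l ∈ Λ, F = shift l '' τ,
      H (W.weight x.1 • W.normal x.1 x.2) ∈ N := by
    intro x hx
    rw [Finset.mem_sigma, Finset.mem_filter, Finset.mem_filter] at hx
    exact horizontal_mem hu₀.1 ((prodLattice N).zsmul_mem (hmem _ _ hx.2.1) _)
  have h3 : H (W.normalSum Λ e τ) = 0 := by
    rw [hs₀, vectorSpan_segment, Submodule.mem_span_singleton] at hbal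
    rw [← hs₀] at hbal
    obtain ⟨s, hs⟩ := hbal
    rw [← hs, h₀]
    change horizontal u₀ _ = 0
    simp only [horizontal, Prod.smul_snd, Prod.fst_sub, Prod.smul_fst, smul_eq_mul]
    module
  refine Eq.trans (Finset.sum_congr (by congr!) h1) ?_
  rw [← J.val_sum _ _ h2, ← map_sum, ← hfin, h3, J.val_zero]

open Classical in
/-- The value of `J` on the fibre over the end of a half-edge. -/
noncomputable def fibreValue (h : EB × Bool) : Q :=
  ∑ i with W.edge i = h.1, ∑ F ∈ W.sides i with F ⊆ {y | y.2 = hLevel m h},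
    (W.weight i * ((if h.2 then -1 else 1) * ⌊(W.normal i F).2⌋)) •
      J.val (R.u i F).1 (R.l i F).1 (R.r i F).1

/-- The slope of a normal is integral but recorded as a real number; `⌊·⌋` recovers the integer that
can act on `Q`. -/
theorem cast_floor_normal {i : W.ι} {F : Set (M × ℝ)} (hF : F ∈ W.sides i) :
    ((⌊(W.normal i F).2⌋ : ℤ) : ℝ) = (W.normal i F).2 := by
  obtain ⟨k, hk⟩ := exists_int_snd (W.normal_spec i F hF).1
  rw [hk, Int.floor_intCast]

theorem snd_eq_zero {i : W.ι} {F : Set (M × ℝ)} (hF : F ∈ W.sides i) {c : ℝ}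
    (hc : F ⊆ {y | y.2 = c}) : (R.u i F).2 = 0 := by
  obtain ⟨t, ht, h⟩ := R.sub_eq i F hF
  have hs := R.eq_segment i F hF
  have h1 : (R.l i F).2 = c := hc (by
    have := left_mem_segment ℝ (R.l i F) (R.r i F)
    rwa [← hs] at this)
  have h2 : (R.r i F).2 = c := hc (by
    have := right_mem_segment ℝ (R.l i F) (R.r i F)
    rwa [← hs] at this)
  have h3 := congrArg Prod.snd h
  rw [Prod.snd_sub, h1, h2, sub_self, Prod.smul_snd, smul_eq_mul] at h3
  exact (mul_eq_zero.1 h3.symm).resolve_left ht.ne'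

theorem isPrimitive_fst {i : W.ι} {F : Set (M × ℝ)} (hF : F ∈ W.sides i) {c : ℝ}
    (hc : F ⊆ {y | y.2 = c}) : IsPrimitive N (R.u i F).1 := by
  have h0 := R.snd_eq_zero hF hc
  have hp := R.isPrimitive i F hF
  refine ⟨(AddSubgroup.mem_prod.1 hp.1).1, fun h => hp.2.1 (Prod.ext h h0), fun s hs => ?_⟩
  refine hp.2.2 s (AddSubgroup.mem_prod.2 ⟨hs, ?_⟩)
  rw [Prod.smul_snd, h0, smul_zero]
  exact AddSubgroup.zero_mem _

/-- Along a side inside a fibre `dt(u) = 0`, so the horizontal vector is just `dt(ν) u`. -/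
theorem val_level {i : W.ι} {F : Set (M × ℝ)} (hF : F ∈ W.sides i) {c : ℝ}
    (hc : F ⊆ {y | y.2 = c}) :
    J.val (horizontal (R.u i F) (W.normal i F)) (R.l i F).1 (R.r i F).1 =
      ⌊(W.normal i F).2⌋ • J.val (R.u i F).1 (R.l i F).1 (R.r i F).1 := by
  rw [← J.val_zsmul (R.isPrimitive_fst hF hc).1, horizontal, R.snd_eq_zero hF hc, zero_smul,
    sub_zero, Prod.smul_fst, ← Int.cast_smul_eq_zsmul ℝ, cast_floor_normal hF]

theorem fibreValue_mem_graph (h : EB × Bool) :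
    (((W.fibre Λ h : M ⧸ Λ → ℝ) : OneChain Λ), R.fibreValue h) ∈ J.graph := by
  classical
  have key : ∀ (s : Finset ((_ : W.ι) × Set (M × ℝ)))
      (f : ((_ : W.ι) × Set (M × ℝ)) → M ⧸ Λ → ℝ) (q : ((_ : W.ι) × Set (M × ℝ)) → Q),
      (∀ x ∈ s, (((f x : M ⧸ Λ → ℝ) : OneChain Λ), q x) ∈ J.graph) →
      (((∑ x ∈ s, f x : M ⧸ Λ → ℝ) : OneChain Λ), ∑ x ∈ s, q x) ∈ J.graph := by
    intro s f q hs
    convert J.graph.sum_mem hs using 1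
    refine Prod.ext ?_ ?_
    · rw [Prod.fst_sum]
      exact map_sum (Filter.Germ.coeAddHom Filter.cofinite) f s
    · rw [Prod.snd_sum]
  rw [fibreValue, Finset.sum_sigma']
  have hfib : W.fibre Λ h = ∑ x ∈ (Finset.univ.filter fun i => W.edge i = h.1).sigma
      fun i => (W.sides i).filter fun F => F ⊆ {y | y.2 = hLevel m h},
        fun p => W.weight x.1 * (hSign h * (W.normal x.1 x.2).2) *
          segWeight Λ (Prod.fst '' x.2) p := by
    ext p
    rw [Finset.sum_apply, Finset.sum_sigma, SurfaceData.fibre]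
  rw [hfib]
  refine key _ _ _ fun x hx => ?_
  rw [Finset.mem_sigma, Finset.mem_filter, Finset.mem_filter] at hx
  obtain ⟨-, hF, hc⟩ := hx
  obtain ⟨t, ht, hsub⟩ := R.sub_eq _ _ hF
  have hg := J.mem_graph (R.isPrimitive_fst hF hc) ht.le
    (a := (R.l x.1 x.2).1) (b := (R.r x.1 x.2).1) (congrArg Prod.fst hsub)
  have himg : Prod.fst '' x.2 = segment ℝ (R.l x.1 x.2).1 (R.r x.1 x.2).1 := by
    conv_lhs => rw [R.eq_segment _ _ hF]
    exact image_segment ℝ (LinearMap.fst ℝ M ℝ).toAffineMap _ _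
  convert J.graph.smul_mem (W.weight x.1 * ((if h.2 then -1 else 1) *
    ⌊(W.normal x.1 x.2).2⌋) : ℤ) hg using 1
  refine Prod.ext ?_ rfl
  rw [Prod.smul_fst, ← Filter.Germ.coe_smul, himg]
  refine congrArg (fun f : M ⧸ Λ → ℝ => (f : OneChain Λ)) (funext fun p => ?_)
  rw [Pi.smul_apply, zsmul_eq_mul]
  push_cast
  rw [cast_floor_normal hF, hSign]

/-- Sum the values of all sides of all facets over `e`. Facet by facet this is zero. Grouped by
classes modulo `Λ`, the sides lying in neither end fibre cancel by balancing, and the end fibres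
contribute `fibreValue` with opposite signs, as the outgoing slopes are opposite. -/
theorem fibreValue_edge (hm : ∀ e, 0 < m e)
    (hbal : ∀ (e : EB) (τ : Set (M × ℝ)), ¬ τ ⊆ {y | y.2 = 0} → ¬ τ ⊆ {y | y.2 = m e} →
      W.normalSum Λ e τ ∈ vectorSpan ℝ τ) (e : EB) :
    R.fibreValue (e, false) = R.fibreValue (e, true) := by
  classical
  let A : Finset ((_ : W.ι) × Set (M × ℝ)) :=
    (Finset.univ.filter fun i => W.edge i = e).sigma W.sides
  let f : ((_ : W.ι) × Set (M × ℝ)) → Q := fun x =>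
    W.weight x.1 • J.val (horizontal (R.u x.1 x.2) (W.normal x.1 x.2)) (R.l x.1 x.2).1
      (R.r x.1 x.2).1
  have htot : ∑ x ∈ A, f x = 0 := by
    rw [Finset.sum_sigma]
    refine Finset.sum_eq_zero fun i _ => ?_
    change ∑ F ∈ W.sides i, W.weight i • _ = 0
    rw [← Finset.smul_sum, R.sum_eq_zero, smul_zero]
  let A' := (A.filter fun x => ¬ x.2 ⊆ {y | y.2 = 0}).filter fun x => ¬ x.2 ⊆ {y | y.2 = m e}
  have hA' : ∑ x ∈ A', f x = 0 := by
    refine sum_eq_zero_of_fiberwise A' (fun x => {σ | ∃ l ∈ Λ, σ = shift l '' x.2}) f ?_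
    intro x₀ hx₀
    obtain ⟨hx₀', hm0⟩ := Finset.mem_filter.1 hx₀
    obtain ⟨hx₀A, h00⟩ := Finset.mem_filter.1 hx₀'
    obtain ⟨-, hside⟩ := Finset.mem_sigma.1 hx₀A
    rw [← R.sum_class_eq_zero e hside (hbal e x₀.2 h00 hm0), Finset.sum_sigma']
    refine Finset.sum_congr ?_ fun _ _ => rfl
    have hlev : ∀ (c : ℝ) (l : M) (τ : Set (M × ℝ)),
        shift l '' τ ⊆ {y | y.2 = c} ↔ τ ⊆ {y | y.2 = c} := by
      intro c l τ
      rw [Set.image_subset_iff]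
      rfl
    ext x
    simp only [A', A, Finset.mem_filter, Finset.mem_sigma, Finset.mem_univ, true_and]
    constructor
    · rintro ⟨⟨⟨⟨he, hF⟩, -⟩, -⟩, hk⟩
      have : x.2 ∈ {σ | ∃ l ∈ Λ, σ = shift l '' x.2} := ⟨0, Λ.zero_mem, by
        rw [show (shift (0 : M) : M × ℝ → M × ℝ) = id from funext fun y => by simp [shift]]
        simp⟩
      rw [hk] at this
      exact ⟨he, hF, this⟩
    · rintro ⟨he, hF, l, hl, hxl⟩
      refine ⟨⟨⟨⟨he, hF⟩, ?_⟩, ?_⟩, ?_⟩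
      · rwa [hxl, hlev]
      · rwa [hxl, hlev]
      · have hcomp : ∀ a b : M, ∀ τ : Set (M × ℝ),
            shift a '' (shift b '' τ) = shift (b + a) '' τ := by
          intro a b τ
          rw [Set.image_image]
          exact Set.image_congr fun y _ => by simp [shift, add_assoc]
        ext σ
        constructor
        · rintro ⟨k, hk, rfl⟩
          exact ⟨l + k, Λ.add_mem hl hk, by rw [hxl, hcomp]⟩
        · rintro ⟨k, hk, rfl⟩
          exact ⟨k - l, Λ.sub_mem hk hl, by rw [hxl, hcomp]; congr 2; abel⟩
  have hsplit : ∑ x ∈ A, f x = ∑ x ∈ A with x.2 ⊆ {y | y.2 = 0}, f x +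
      (∑ x ∈ A with x.2 ⊆ {y | y.2 = m e}, f x + ∑ x ∈ A', f x) := by
    rw [← Finset.sum_filter_add_sum_filter_not A fun x => x.2 ⊆ {y | y.2 = 0}]
    congr 1
    rw [← Finset.sum_filter_add_sum_filter_not
      (A.filter fun x => ¬ x.2 ⊆ {y | y.2 = 0}) fun x => x.2 ⊆ {y | y.2 = m e}]
    congr 1
    refine Finset.sum_congr ?_ fun _ _ => rfl
    ext x
    simp only [Finset.mem_filter]
    constructor
    · rintro ⟨⟨h1, -⟩, h3⟩
      exact ⟨h1, h3⟩
    · rintro ⟨h1, h3⟩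
      -- No side lies in both end fibres, because the edge has positive length.
      refine ⟨⟨h1, fun h2 => ?_⟩, h3⟩
      have hF := (Finset.mem_sigma.1 h1).2
      have hmem : R.l x.1 x.2 ∈ x.2 := by
        have := left_mem_segment ℝ (R.l x.1 x.2) (R.r x.1 x.2)
        rwa [← R.eq_segment _ _ hF] at this
      have e1 : (R.l x.1 x.2).2 = 0 := h2 hmem
      have e2 : (R.l x.1 x.2).2 = m e := h3 hmem
      linarith [hm e]
  have hval : ∀ b : Bool, ∑ x ∈ A with x.2 ⊆ {y | y.2 = hLevel m (e, b)}, f x =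
      (if b then -1 else 1 : ℤ) • R.fibreValue (e, b) := by
    intro b
    rw [fibreValue, Finset.sum_sigma', Finset.smul_sum]
    refine Finset.sum_congr ?_ fun x hx => ?_
    · ext x
      simp only [A, Finset.mem_filter, Finset.mem_sigma, Finset.mem_univ, true_and, and_assoc]
    · rw [Finset.mem_sigma, Finset.mem_filter, Finset.mem_filter] at hx
      simp only [f]
      rw [R.val_level hx.2.1 hx.2.2, smul_smul, smul_smul]
      congr 1
      cases b <;> simp
  rw [htot, hA', add_zero] at hsplit
  have v0 := hval false
  have v1 := hval true
  simp only [hLevel] at v0 v1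
  simp only [if_true, Bool.false_eq_true, if_false] at v0 v1
  rw [v0, v1, one_smul, neg_one_smul] at hsplit
  exact (sub_eq_zero.1 (by rw [sub_eq_add_neg]; exact hsplit.symm))

end Framing

theorem segWeight_translate {M : Type*} [AddCommGroup M] (Λ : AddSubgroup M) {l : M} (hl : l ∈ Λ)
    (σ : Set M) (p : M ⧸ Λ) :
    segWeight Λ ((fun x => x + l) '' σ) p = segWeight Λ σ p := by
  rw [segWeight, segWeight, 
    ← Set.ncard_image_of_injective {x | x ∈ σ ∧ (x : M ⧸ Λ) = p} (add_left_injective l)]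
  congr 2
  ext x
  have hq : ∀ y : M, ((y + l : M) : M ⧸ Λ) = (y : M ⧸ Λ) := fun y =>
    (QuotientAddGroup.eq.2 (by simpa using hl)).symm
  constructor
  · rintro ⟨⟨y, hy, rfl⟩, h⟩
    exact ⟨y, ⟨hy, (hq y).symm.trans h⟩, rfl⟩
  · rintro ⟨y, ⟨hy, h⟩, rfl⟩
    exact ⟨⟨y, hy, rfl⟩, (hq y).trans h⟩

/-- All sides of a class project to translates of `τ` and have the same weight function, so their
coefficients add up to the slope of `endSum`. -/
theorem SurfaceData.sum_fibre_class (W : SurfaceData N m) (Λ : AddSubgroup M) (h : EB × Bool)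
    (τ : Set M) (p : M ⧸ Λ) :
    (letI := Classical.propDecidable
      ∑ x ∈ ((Finset.univ.filter fun i => W.edge i = h.1).sigma
        fun i => (W.sides i).filter fun F => F ⊆ {y | y.2 = hLevel m h}) with
        {σ | ∃ l ∈ Λ, σ = (fun y => y + l) '' (Prod.fst '' x.2)} =
          {σ | ∃ l ∈ Λ, σ = (fun y => y + l) '' τ},
        W.weight x.1 * (hSign h * (W.normal x.1 x.2).2) * segWeight Λ (Prod.fst '' x.2) p) =
      hSign h * (W.endSum Λ h τ).2 * segWeight Λ τ p := by
  classical
  have hcomp : ∀ a b : M, ∀ τ : Set M,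
      (fun y => y + a) '' ((fun y => y + b) '' τ) = (fun y => y + (b + a)) '' τ := by
    intro a b τ
    rw [Set.image_image]
    exact Set.image_congr fun y _ => by simp [add_assoc]
  have hset : ∀ F : Set (M × ℝ), (F ⊆ {y | y.2 = hLevel m h} ∧
      {σ | ∃ l ∈ Λ, σ = (fun y => y + l) '' (Prod.fst '' F)} =
        {σ | ∃ l ∈ Λ, σ = (fun y => y + l) '' τ}) ↔
      ∃ l ∈ Λ, F = (fun y : M × ℝ => (y.1 + l, y.2)) '' ((fun x : M => (x, hLevel m h)) '' τ) := by
    intro F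
    constructor
    · rintro ⟨h1, h2⟩
      have : Prod.fst '' F ∈ {σ | ∃ l ∈ Λ, σ = (fun y => y + l) '' (Prod.fst '' F)} :=
        ⟨0, Λ.zero_mem, by simp⟩
      rw [h2] at this
      obtain ⟨l, hl, h3⟩ := this
      refine ⟨l, hl, ?_⟩
      rw [Set.image_image]
      ext y
      constructor
      · intro hy
        have : y.1 ∈ Prod.fst '' F := ⟨y, hy, rfl⟩
        rw [h3] at this
        obtain ⟨x, hx, hxy⟩ := this
        exact ⟨x, hx, Prod.ext hxy (h1 hy).symm⟩
      · rintro ⟨x, hx, rfl⟩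
        have : x + l ∈ Prod.fst '' F := by rw [h3]; exact ⟨x, hx, rfl⟩
        obtain ⟨y, hy, hyx⟩ := this
        have hy2 : y.2 = hLevel m h := h1 hy
        change (x + l, hLevel m h) ∈ F
        rwa [show (x + l, hLevel m h) = y from Prod.ext hyx.symm hy2.symm]
    · rintro ⟨l, hl, rfl⟩
      have hfst : Prod.fst '' ((fun y : M × ℝ => (y.1 + l, y.2)) ''
          ((fun x : M => (x, hLevel m h)) '' τ)) = (fun y => y + l) '' τ := by
        rw [Set.image_image, Set.image_image]
      refine ⟨?_, ?_⟩
      · rintro _ ⟨_, ⟨x, _, rfl⟩, rfl⟩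
        rfl
      · rw [hfst]
        ext σ
        constructor
        · rintro ⟨k, hk, rfl⟩
          exact ⟨l + k, Λ.add_mem hl hk, hcomp _ _ _⟩
        · rintro ⟨k, hk, rfl⟩
          refine ⟨k - l, Λ.sub_mem hk hl, ?_⟩
          rw [hcomp]; congr 2; ext y; abel
  have hend : (W.endSum Λ h τ).2 = ∑ x ∈ (Finset.univ.filter fun i => W.edge i = h.1).sigma
      fun i => (W.sides i).filter fun F => ∃ l ∈ Λ, F = (fun y : M × ℝ => (y.1 + l, y.2)) ''
        ((fun x : M => (x, hLevel m h)) '' τ), (W.weight x.1 : ℝ) * (W.normal x.1 x.2).2 := by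
    rw [Finset.sum_sigma, endSum, normalSum, Prod.snd_sum]
    refine Finset.sum_congr (by congr!) fun i _ => ?_
    rw [Prod.snd_sum]
    refine Finset.sum_congr (by congr!) fun F _ => ?_
    rw [Prod.smul_snd, zsmul_eq_mul]
  rw [hend, Finset.mul_sum, Finset.sum_mul]
  refine Finset.sum_congr ?_ fun x hx => ?_
  · ext x
    simp only [Finset.mem_filter, Finset.mem_sigma, Finset.mem_univ, true_and, and_assoc]
    rw [hset]
  · rw [Finset.mem_sigma, Finset.mem_filter, Finset.mem_filter] at hx
    have h2 := ((hset x.2).2 hx.2.2).2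
    have : Prod.fst '' x.2 ∈ {σ | ∃ l ∈ Λ, σ = (fun y => y + l) '' (Prod.fst '' x.2)} :=
      ⟨0, Λ.zero_mem, by simp⟩
    rw [h2] at this
    obtain ⟨l, hl, h3⟩ := this
    rw [h3, segWeight_translate Λ hl]
    ring

/-- Group the sides of both fibres by their projected class modulo `Λ`; the balancing condition at
the vertex equates the coefficients class by class. -/
theorem SurfaceData.fibre_eq_of_vertex (W : SurfaceData N m) (Λ : AddSubgroup M) {h h' : EB × Bool}
    (hbal : ∀ τ, hSign h * (W.endSum Λ h τ).2 = hSign h' * (W.endSum Λ h' τ).2) :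
    W.fibre Λ h = W.fibre Λ h' := by
  classical
  ext p
  rw [fibre, fibre, Finset.sum_sigma', Finset.sum_sigma']
  refine sum_eq_sum_of_fiberwise _ _
    (fun x => {σ | ∃ l ∈ Λ, σ = (fun y => y + l) '' (Prod.fst '' x.2)})
    (fun x => {σ | ∃ l ∈ Λ, σ = (fun y => y + l) '' (Prod.fst '' x.2)}) _ _ fun κ hκ => ?_
  obtain ⟨τ, rfl⟩ : ∃ τ : Set M, {σ | ∃ l ∈ Λ, σ = (fun y => y + l) '' τ} = κ := by
    rcases hκ with ⟨x, rfl⟩ | ⟨x, rfl⟩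
    · exact ⟨_, rfl⟩
    · exact ⟨_, rfl⟩
  have h1 := W.sum_fibre_class Λ h τ p
  have h2 := W.sum_fibre_class Λ h' τ p
  rw [hbal τ, ← h2] at h1
  convert h1

/-- Elementary algebraic equivalences have value zero. -/
theorem Calibration.mem_graph_of_isElementary (hN : IsFullLattice N) (hΛ : IsFullLattice Λ)
    {A : OneChain Λ} (hA : IsElementary N Λ A) : (A, (0 : Q)) ∈ J.graph := by
  obtain ⟨VB, EB, _, _, B, m, W, h₀, h₁, hB, hm, hW, rfl⟩ := hA
  obtain ⟨R⟩ := exists_framing J hN W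
  have hedge := R.fibreValue_edge hm hW.1
  -- At a vertex the fibres agree as weight functions, although they come from facets over different
  -- edges. Equality of their values is where well-definedness on germs is needed.
  have hvert : ∀ h h', hVert B h = hVert B h' → R.fibreValue h = R.fibreValue h' := by
    intro h h' hv
    have hf := W.fibre_eq_of_vertex Λ (h := h) (h' := h') fun τ => (hW.2 _ τ).2 h h' rfl hv.symm
    have h1 := R.fibreValue_mem_graph h
    have h2 := R.fibreValue_mem_graph h'
    rw [hf] at h1
    have h3 := J.graph.sub_mem h1 h2
    rw [Prod.mk_sub_mk, sub_self] at h3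
    exact sub_eq_zero.1 (J.eq_zero_of_mem_graph hΛ h3)
  have hpath : ∀ b, Relation.ReflTransGen (B.AdjVia Set.univ) (hVert B h₀) b → ∀ h, hVert B h = b →
      R.fibreValue h = R.fibreValue h₀ := by
    intro b hb
    induction hb with
    | refl => exact fun h hh => hvert _ _ hh
    | tail _ hadj ih =>
      intro h hh
      obtain ⟨e, -, ⟨h1, h2⟩ | ⟨h1, h2⟩⟩ := hadj
      · rw [← ih (e, false) h1, hedge]
        exact hvert _ _ (hh.trans h2.symm)
      · rw [← ih (e, true) h2, ← hedge]
        exact hvert _ _ (hh.trans h1.symm)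
  have h3 := J.graph.sub_mem (R.fibreValue_mem_graph h₀) (R.fibreValue_mem_graph h₁)
  rw [Prod.mk_sub_mk, hpath _ (hB.2 _ _) h₁ rfl, sub_self] at h3
  exact h3

theorem Calibration.mem_graph_of_algTrivial (hN : IsFullLattice N) (hΛ : IsFullLattice Λ)
    {A : OneChain Λ} (hA : AlgTrivial N Λ A) : (A, (0 : Q)) ∈ J.graph := by
  induction hA using AddSubgroup.closure_induction with
  | mem x hx => exact J.mem_graph_of_isElementary hN hΛ hx
  | zero => exact J.graph.zero_mem
  | add x y _ _ hx hy => simpa using J.graph.add_mem hx hy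
  | neg x _ hx => simpa using J.graph.neg_mem hx

end Trop

/-! ### Wedge products and the segment period. -/

namespace MultiGraph

variable {V E : Type*} [Fintype E] (G : MultiGraph V E)

section Wedge

variable {A : Type*} [CommRing A]

/-- The alternating form `n ∧ u ∧ w`, as a function of three cycles. -/
noncomputable def wedge (n u w : G.Coh A) (γ : Fin 3 → G.H1) : A :=
  n (γ 0) * (u (γ 1) * w (γ 2) - u (γ 2) * w (γ 1)) +
    n (γ 1) * (u (γ 2) * w (γ 0) - u (γ 0) * w (γ 2)) +
    n (γ 2) * (u (γ 0) * w (γ 1) - u (γ 1) * w (γ 0))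

variable {G}

theorem wedge_add_left (n n' u w : G.Coh A) :
    G.wedge (n + n') u w = G.wedge n u w + G.wedge n' u w := by
  funext γ; simp only [wedge, LinearMap.add_apply, Pi.add_apply]; ring

theorem wedge_zero_left (u w : G.Coh A) : G.wedge 0 u w = 0 := by
  funext γ; simp [wedge]

theorem wedge_add_mid (n u u' w : G.Coh A) :
    G.wedge n (u + u') w = G.wedge n u w + G.wedge n u' w := by
  funext γ; simp only [wedge, LinearMap.add_apply, Pi.add_apply]; ring

theorem wedge_zero_mid (n w : G.Coh A) : G.wedge n 0 w = 0 := by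
  funext γ; simp [wedge]

/-- Each coefficient of the relation times the determinant vanishes, by cofactor expansion. -/
theorem wedge_eq_zero_of_not_linearIndependent {n u w : G.Coh ℝ}
    (h : ¬ LinearIndependent ℝ ![n, u, w]) : G.wedge n u w = 0 := by
  obtain ⟨g, hg, i, hi⟩ := Fintype.not_linearIndependent_iff.1 h
  rw [Fin.sum_univ_three] at hg
  have hγ : ∀ γ, g 0 * n γ + g 1 * u γ + g 2 * w γ = 0 := fun γ => by
    simpa using LinearMap.congr_fun hg γ
  funext γ
  have h0 := hγ (γ 0)
  have h1 := hγ (γ 1)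
  have h2 := hγ (γ 2)
  have : ∀ i, g i * G.wedge n u w γ = 0 := by
    intro i
    simp only [wedge]
    fin_cases i
    · simp only [Fin.zero_eta]
      linear_combination (u (γ 1) * w (γ 2) - u (γ 2) * w (γ 1)) * h0 +
        (u (γ 2) * w (γ 0) - u (γ 0) * w (γ 2)) * h1 + (u (γ 0) * w (γ 1) - u (γ 1) * w (γ 0)) * h2
    · simp only [Fin.mk_one]
      linear_combination (w (γ 1) * n (γ 2) - w (γ 2) * n (γ 1)) * h0 +
        (w (γ 2) * n (γ 0) - w (γ 0) * n (γ 2)) * h1 + (w (γ 0) * n (γ 1) - w (γ 1) * n (γ 0)) * h2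
    · simp only [Fin.reduceFinMk]
      linear_combination (n (γ 1) * u (γ 2) - n (γ 2) * u (γ 1)) * h0 +
        (n (γ 2) * u (γ 0) - n (γ 0) * u (γ 2)) * h1 + (n (γ 0) * u (γ 1) - n (γ 1) * u (γ 0)) * h2
  exact (mul_eq_zero.1 (this i)).resolve_left hi

end Wedge

section Balance

theorem sum_edgeCoord_balance :
    ∑ e, (Finsupp.single (G.head e) (G.edgeCoord e) - Finsupp.single (G.tail e) (G.edgeCoord e)) =
      0 := by
  classical
  ext w γ
  have hγ : G.bdry γ = 0 := γ.2
  have := DFunLike.congr_fun hγ w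
  simp only [bdry, Fintype.linearCombination_apply, Finsupp.coe_finsetSum, Finset.sum_apply,
    Finsupp.smul_apply, Finsupp.sub_apply, Finsupp.single_apply, Finsupp.coe_zero,
    Pi.zero_apply] at this
  simp only [Finsupp.coe_finsetSum, Finset.sum_apply, Finsupp.sub_apply, LinearMap.sum_apply,
    LinearMap.sub_apply, Finsupp.single_apply, Finsupp.coe_zero, Pi.zero_apply,
    LinearMap.zero_apply]
  rw [← this]
  refine Finset.sum_congr rfl fun e _ => ?_
  by_cases h1 : G.head e = w <;> by_cases h2 : G.tail e = w <;> simp [h1, h2, edgeCoord]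

/-- Sums over the edges of head minus tail contributions telescope. -/
theorem sum_head_sub_tail {B : Type*} [AddCommGroup B] (f : V → G.Coh ℤ →+ B) :
    ∑ e, (f (G.head e) (G.edgeCoord e) - f (G.tail e) (G.edgeCoord e)) = 0 := by
  have := congrArg (Finsupp.liftAddHom f) G.sum_edgeCoord_balance
  rw [map_zero, map_sum] at this
  rw [← this]
  exact Finset.sum_congr rfl fun e _ => by
    rw [map_sub, Finsupp.liftAddHom_apply_single, Finsupp.liftAddHom_apply_single]

end Balance

section SegmentPeriod

variable {A : Type*} [CommRing A] (x : E → A)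

/-- The subgroup generated by the `2 n ∧ π(h) ∧ π(k)`, for integral `n` and cycles `h`, `k`. -/
def periodGroup : AddSubgroup ((Fin 3 → G.H1) → A) :=
  AddSubgroup.closure {f | ∃ (n : G.Coh ℤ) (h k : G.H1),
    f = (2 : ℤ) • G.wedge (G.cohCast A n) (G.projInt x h) (G.projInt x k)}

/-- A basis of the group of cycles. -/
noncomputable def cycleBasis : Module.Basis (Fin (Module.finrank ℤ G.H1)) ℤ G.H1 :=
  Module.finBasis ℤ G.H1

/-- The part `i < j` of the expansion of `n ∧ π(h) ∧ π(k)` in a basis of the cycles. -/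
noncomputable def upperWedge (n : G.Coh A) (h h' : G.H1) : (Fin 3 → G.H1) → A :=
  ∑ i, ∑ j, if i < j then (G.cycleBasis.repr h i * G.cycleBasis.repr h' j) •
    G.wedge n (G.projInt x (G.cycleBasis i : E → ℤ)) (G.projInt x (G.cycleBasis j : E → ℤ)) else 0

theorem upperWedge_add_left (n : G.Coh A) (h k h' : G.H1) :
    G.upperWedge x n (h + k) h' = G.upperWedge x n h h' + G.upperWedge x n k h' := by
  simp only [upperWedge, ← Finset.sum_add_distrib]
  refine Finset.sum_congr rfl fun i _ => Finset.sum_congr rfl fun j _ => ?_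
  split_ifs
  · rw [map_add, Finsupp.add_apply, add_mul, add_smul]
  · rw [add_zero]

theorem upperWedge_add_right (n : G.Coh A) (h h' k : G.H1) :
    G.upperWedge x n h (h' + k) = G.upperWedge x n h h' + G.upperWedge x n h k := by
  simp only [upperWedge, ← Finset.sum_add_distrib]
  refine Finset.sum_congr rfl fun i _ => Finset.sum_congr rfl fun j _ => ?_
  split_ifs
  · rw [map_add, Finsupp.add_apply, mul_add, add_smul]
  · rw [add_zero]

theorem upperWedge_add_coeff (n n' : G.Coh A) (h h' : G.H1) :
    G.upperWedge x (n + n') h h' = G.upperWedge x n h h' + G.upperWedge x n' h h' := by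
  simp only [upperWedge, ← Finset.sum_add_distrib]
  refine Finset.sum_congr rfl fun i _ => Finset.sum_congr rfl fun j _ => ?_
  split_ifs
  · rw [wedge_add_left, smul_add]
  · rw [add_zero]

theorem two_smul_upperWedge_mem (n : G.Coh ℤ) (h h' : G.H1) :
    (2 : ℤ) • G.upperWedge x (G.cohCast A n) h h' ∈ G.periodGroup x := by
  simp only [upperWedge, Finset.smul_sum]
  refine AddSubgroup.sum_mem _ fun i _ => AddSubgroup.sum_mem _ fun j _ => ?_
  split_ifs
  · rw [smul_comm]
    refine AddSubgroup.zsmul_mem _ ?_ _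
    exact AddSubgroup.subset_closure ⟨n, G.cycleBasis i, G.cycleBasis j, rfl⟩
  · rw [smul_zero]
    exact AddSubgroup.zero_mem _

theorem projInt_eq_sum (h : G.H1) : G.projInt x h =
    ∑ i, G.cycleBasis.repr h i • G.projInt x (G.cycleBasis i : E → ℤ) := by
  conv_lhs => rw [← G.cycleBasis.sum_repr h]
  simp only [Submodule.coe_sum, map_sum, Submodule.coe_smul, map_zsmul]

/-- An alternating bilinear form is its strictly upper triangular part minus the transpose. That
part is what makes the quadratic correction in `segPeriod` possible without dividing by two. -/
theorem wedge_projInt (n : G.Coh A) (h h' : G.H1) :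
    G.wedge n (G.projInt x h) (G.projInt x h') =
      G.upperWedge x n h h' - G.upperWedge x n h' h := by
  let W : Fin (Module.finrank ℤ G.H1) → Fin (Module.finrank ℤ G.H1) → (Fin 3 → G.H1) → A :=
    fun i j => G.wedge n (G.projInt x (G.cycleBasis i : E → ℤ))
      (G.projInt x (G.cycleBasis j : E → ℤ))
  have hanti : ∀ i j, W i j = -W j i := fun i j => by
    funext γ; simp only [W, wedge, Pi.neg_apply]; ring
  have hdiag : ∀ i, W i i = 0 := fun i => by
    funext γ; simp only [W, wedge, Pi.zero_apply]; ring
  have hexp : G.wedge n (G.projInt x h) (G.projInt x h') =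
      ∑ i, ∑ j, (G.cycleBasis.repr h i * G.cycleBasis.repr h' j) • W i j := by
    let B : G.Coh A →+ G.Coh A →+ ((Fin 3 → G.H1) → A) := AddMonoidHom.mk' (fun u =>
      AddMonoidHom.mk' (fun w => G.wedge n u w) fun w w' => by
        funext γ; simp only [wedge, LinearMap.add_apply, Pi.add_apply]; ring) fun u u' => by
          ext1 w; exact wedge_add_mid n u u' w
    change B _ _ = ∑ i, ∑ j, (_ * _ : ℤ) • B _ _
    rw [G.projInt_eq_sum x h, G.projInt_eq_sum x h']
    simp only [map_sum, map_zsmul, AddMonoidHom.finsetSum_apply, AddMonoidHom.smul_apply, mul_smul,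
      Finset.smul_sum]
    rw [Finset.sum_comm]
    exact Finset.sum_congr rfl fun i _ => Finset.sum_congr rfl fun j _ => smul_comm _ _ _
  rw [hexp, upperWedge, upperWedge, Finset.sum_comm (f := fun i j => if i < j then
    (G.cycleBasis.repr h' i * G.cycleBasis.repr h j) • _ else _), ← Finset.sum_sub_distrib]
  refine Finset.sum_congr rfl fun i _ => ?_
  rw [← Finset.sum_sub_distrib]
  refine Finset.sum_congr rfl fun j _ => ?_
  rcases lt_trichotomy i j with hij | rfl | hij
  · rw [if_pos hij, if_neg hij.not_gt, sub_zero]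
  · rw [if_neg (lt_irrefl _), hdiag, smul_zero, if_neg (lt_irrefl _), sub_zero]
  · rw [if_neg hij.not_gt, if_pos hij, zero_sub, hanti, smul_neg, mul_comm]

/-- The length pairing has no isotropic cycles; more precisely, `π` is injective on cycles. -/
def IsAnisotropic : Prop := ∀ h : G.H1, G.projInt x h = 0 → h = 0

open Classical in
/-- A cycle that represents a given element of the lattice. -/
noncomputable def cycleOf (l : G.Coh A) : G.H1 :=
  if hl : l ∈ G.lattice x then ⟨hl.choose, hl.choose_spec.1⟩ else 0

theorem projInt_cycleOf {l : G.Coh A} (hl : l ∈ G.lattice x) : G.projInt x (G.cycleOf x l) = l := by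
  rw [cycleOf, dif_pos hl]
  exact hl.choose_spec.2

-- Injectivity of `π` on cycles makes the chosen representative unique, hence additive.
variable {x} in
theorem IsAnisotropic.cycleOf_add (hx : G.IsAnisotropic x) {l l' : G.Coh A} (hl : l ∈ G.lattice x)
    (hl' : l' ∈ G.lattice x) : G.cycleOf x (l + l') = G.cycleOf x l + G.cycleOf x l' := by
  rw [← sub_eq_zero]
  apply hx
  rw [Submodule.coe_sub, Submodule.coe_add, map_sub, map_add, projInt_cycleOf G x hl,
    projInt_cycleOf G x hl', projInt_cycleOf G x ((G.lattice x).add_mem hl hl'), sub_self]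

/-- A representative modulo the lattice. -/
noncomputable def rep (a : G.Coh A) : G.Coh A := Quotient.out (a : G.Coh A ⧸ G.lattice x)

theorem rep_add (a : G.Coh A) {l : G.Coh A} (hl : l ∈ G.lattice x) :
    G.rep x (a + l) = G.rep x a := by
  have : ((a + l : G.Coh A) : G.Coh A ⧸ G.lattice x) = (a : G.Coh A ⧸ G.lattice x) :=
    (QuotientAddGroup.eq.2 (by simpa using hl)).symm
  rw [rep, rep, this]

theorem rep_sub_mem (a : G.Coh A) : a - G.rep x a ∈ G.lattice x := by
  have : ((G.rep x a : G.Coh A) : G.Coh A ⧸ G.lattice x) = (a : G.Coh A ⧸ G.lattice x) :=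
    QuotientAddGroup.out_eq' _
  have h := QuotientAddGroup.eq.1 this
  rwa [neg_add_eq_sub] at h

/-- The translation that relates the chosen representatives of the ends of a segment. -/
noncomputable def segShift (a b : G.Coh A) : G.Coh A := G.rep x a + (b - a) - G.rep x b

theorem segShift_mem (a b : G.Coh A) : G.segShift x a b ∈ G.lattice x := by
  have := (G.lattice x).sub_mem (G.rep_sub_mem x b) (G.rep_sub_mem x a)
  rwa [show b - G.rep x b - (a - G.rep x a) = G.rep x a + (b - a) - G.rep x b by abel] at this

/-- The value modulo periods of `Θ` on a standard filling of the segment from `a` to `b` with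
coefficient `n`, corrected by a quadratic refinement of `(h, k) ↦ n ∧ π(h) ∧ π(k)` modulo two. -/
noncomputable def segPeriod (n a b : G.Coh A) : ((Fin 3 → G.H1) → A) ⧸ G.periodGroup x :=
  QuotientAddGroup.mk (G.wedge n (G.rep x a) (b - a) -
    G.wedge n (G.segShift x a b) (G.rep x b) +
    G.upperWedge x n (G.cycleOf x (G.segShift x a b)) (G.cycleOf x (G.segShift x a b)))

theorem segPeriod_add (n n' a b : G.Coh A) :
    G.segPeriod x (n + n') a b = G.segPeriod x n a b + G.segPeriod x n' a b := by
  rw [segPeriod, segPeriod, segPeriod, ← QuotientAddGroup.mk_add, wedge_add_left, wedge_add_left,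
    upperWedge_add_coeff]
  congr 1; abel

theorem segPeriod_zero (a b : G.Coh A) : G.segPeriod x 0 a b = 0 := by
  have := G.segPeriod_add x 0 0 a b
  rwa [add_zero, left_eq_add] at this

theorem segPeriod_neg (n a b : G.Coh A) : G.segPeriod x (-n) a b = -G.segPeriod x n a b := by
  rw [eq_neg_iff_add_eq_zero, ← segPeriod_add, neg_add_cancel, segPeriod_zero]

theorem segPeriod_translate (n a b : G.Coh A) {l : G.Coh A} (hl : l ∈ G.lattice x) :
    G.segPeriod x n (a + l) (b + l) = G.segPeriod x n a b := by
  rw [segPeriod, segPeriod, segShift, segShift, rep_add G x a hl, rep_add G x b hl,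
    add_sub_add_right_eq_sub]

-- The shifts along `ab` and `bc`, with cycles `k` and `k'`, add up to the shift along `ac`. The
-- uncorrected expression violates the identity by `n ∧ π(k) ∧ π(k')` up to sign. The correction
-- `U(k, k)` changes under addition by `U(k, k') + U(k', k)`, which differs from `U(k, k') - U(k',
-- k) = n ∧ π(k) ∧ π(k')` by twice a value of `U`, a period.
variable {x} in
theorem IsAnisotropic.segPeriod_triangle (hx : G.IsAnisotropic x) (n : G.Coh ℤ) (a b c : G.Coh A) :
    G.segPeriod x (G.cohCast A n) a b + G.segPeriod x (G.cohCast A n) b c =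
      G.segPeriod x (G.cohCast A n) a c +
        QuotientAddGroup.mk (G.wedge (G.cohCast A n) (b - a) (c - a)) := by
  rw [segPeriod, segPeriod, segPeriod, ← QuotientAddGroup.mk_add, ← QuotientAddGroup.mk_add,
    QuotientAddGroup.eq]
  set m := G.cohCast A n
  set k := G.cycleOf x (G.segShift x a b)
  set k' := G.cycleOf x (G.segShift x b c)
  have hk : G.cycleOf x (G.segShift x a c) = k + k' := by
    rw [← hx.cycleOf_add G (G.segShift_mem x a b) (G.segShift_mem x b c)]
    congr 1
    rw [segShift, segShift, segShift]
    abel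
  have hw := G.wedge_projInt x m k k'
  rw [projInt_cycleOf G x (G.segShift_mem x a b), projInt_cycleOf G x (G.segShift_mem x b c)] at hw
  rw [hk, upperWedge_add_left, upperWedge_add_right, upperWedge_add_right]
  convert G.two_smul_upperWedge_mem x n k k' using 1
  rw [show (2 : ℤ) • G.upperWedge x m k k' = G.upperWedge x m k k' + G.upperWedge x m k' k +
    (G.upperWedge x m k k' - G.upperWedge x m k' k) by rw [two_smul]; abel, ← hw]
  simp only [segShift]
  generalize G.rep x a = ra
  generalize G.rep x b = rb
  generalize G.rep x c = rc
  funext γ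
  simp only [wedge, LinearMap.add_apply, LinearMap.sub_apply, Pi.add_apply, Pi.sub_apply,
    Pi.neg_apply]
  ring

/-- The class `-2 ∑ n_e ∧ u(e⁻) ∧ u(e⁺)`. -/
noncomputable def ceresaForm (u : V → G.Coh A) : (Fin 3 → G.H1) → A :=
  (-2 : ℤ) • ∑ e, G.wedge (G.cohCast A (G.edgeCoord e)) (u (G.tail e)) (u (G.head e))

/-- Bilinearity leaves `n_e ∧ t ∧ (u(e⁺) - u(e⁻))`, which telescopes because the `n_e` balance at
every vertex. -/
theorem ceresaForm_translate (u : V → G.Coh A) (t : G.Coh A) :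
    G.ceresaForm (fun w => u w + t) = G.ceresaForm u := by
  have h := G.sum_head_sub_tail fun w =>
    ({ toFun := fun n => G.wedge (G.cohCast A n) t (u w)
       map_zero' := by rw [map_zero, wedge_zero_left]
       map_add' := fun n n' => by rw [map_add, wedge_add_left] } :
      G.Coh ℤ →+ ((Fin 3 → G.H1) → A))
  rw [ceresaForm, ceresaForm, ← sub_eq_zero, ← smul_sub, ← Finset.sum_sub_distrib]
  rw [← smul_zero (-2 : ℤ), ← h]
  congr 1
  refine Finset.sum_congr rfl fun e _ => ?_
  funext γ
  simp only [AddMonoidHom.coe_mk, ZeroHom.coe_mk, wedge, LinearMap.add_apply, Pi.sub_apply]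
  ring

/-- `u` is a lift of the vertex part of an Abel-Jacobi map. -/
def IsPotential (u : V → G.Coh A) : Prop :=
  ∀ e, u (G.tail e) + G.edgeProj x e - u (G.head e) ∈ G.lattice x

-- Write each segment as a difference of segments from `0`. Adding the reflected segment makes the
-- lattice periods cancel, and the remaining even function of the vertices telescopes by balancing.
-- The only residue is the cross term of the lattice shift between `u(e⁻) + π(e)` and `u(e⁺)`; the
-- segment and its reflection contribute it equally, hence the factor `-2`.
variable {x} in
theorem IsAnisotropic.sum_segPeriod (hx : G.IsAnisotropic x) {u : V → G.Coh A}
    (hu : G.IsPotential x u) :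
    ∑ e, (G.segPeriod x (G.cohCast A (G.edgeCoord e)) (u (G.tail e))
          (u (G.tail e) + G.edgeProj x e) +
        G.segPeriod x (G.cohCast A (G.edgeCoord e)) (-u (G.tail e))
          (-(u (G.tail e) + G.edgeProj x e))) =
      QuotientAddGroup.mk (G.ceresaForm u) := by
  let S := G.segPeriod x
  let W : G.Coh A → G.Coh A → G.Coh A → ((Fin 3 → G.H1) → A) ⧸ G.periodGroup x :=
    fun a b c => QuotientAddGroup.mk (G.wedge a b c)
  have tri : ∀ (n : G.Coh ℤ) a b, S (G.cohCast A n) 0 a + S (G.cohCast A n) a b =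
      S (G.cohCast A n) 0 b + W (G.cohCast A n) a b := by
    intro n a b
    have := hx.segPeriod_triangle G n 0 a b
    rwa [sub_zero, sub_zero] at this
  have hper : ∀ (n : G.Coh ℤ) (a l : G.Coh A), l ∈ G.lattice x →
      S (G.cohCast A n) 0 (a + l) = S (G.cohCast A n) 0 l + S (G.cohCast A n) 0 a -
        W (G.cohCast A n) l a := by
    intro n a l hl
    have h1 := tri n l (a + l)
    have h2 : S (G.cohCast A n) l (a + l) = S (G.cohCast A n) 0 a := by
      have := G.segPeriod_translate x (G.cohCast A n) 0 a hl
      rwa [zero_add] at this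
    have h3 : W (G.cohCast A n) l (a + l) = W (G.cohCast A n) l a := by
      refine congrArg QuotientAddGroup.mk ?_
      funext γ
      simp only [wedge, LinearMap.add_apply]
      ring
    rw [h2, h3] at h1
    rw [h1]; abel
  have hzero : ∀ (n : G.Coh ℤ) (l : G.Coh A), l ∈ G.lattice x →
      S (G.cohCast A n) 0 l + S (G.cohCast A n) 0 (-l) = 0 := by
    intro n l hl
    have h1 := tri n l 0
    have h2 : S (G.cohCast A n) l 0 = S (G.cohCast A n) 0 (-l) := by
      have := G.segPeriod_translate x (G.cohCast A n) 0 (-l) hl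
      rwa [zero_add, neg_add_cancel] at this
    have h3 : W (G.cohCast A n) l 0 = 0 := by
      refine (congrArg QuotientAddGroup.mk ?_).trans (QuotientAddGroup.mk_zero _)
      funext γ
      simp [wedge]
    have h4 : S (G.cohCast A n) 0 0 = 0 := by
      have := tri n 0 0
      have h5 : W (G.cohCast A n) 0 0 = 0 := by
        refine (congrArg QuotientAddGroup.mk ?_).trans (QuotientAddGroup.mk_zero _)
        exact G.wedge_zero_mid _ _
      rw [h5] at this
      simpa using this
    rw [h2, h3, h4, add_zero] at h1
    exact h1
  -- The reflection-invariant primitive at a vertex, whose head minus tail contributions telescope.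
  let K : V → G.Coh ℤ →+ ((Fin 3 → G.H1) → A) ⧸ G.periodGroup x := fun w =>
    { toFun := fun n => S (G.cohCast A n) 0 (u w) + S (G.cohCast A n) 0 (-u w)
      map_zero' := by simp only [S, map_zero, segPeriod_zero, add_zero]
      map_add' := fun n n' => by
        simp only [S, map_add, segPeriod_add]
        abel }
  have hK : ∀ w n, K w n = S (G.cohCast A n) 0 (u w) + S (G.cohCast A n) 0 (-u w) :=
    fun _ _ => rfl
  have key : ∀ e, S (G.cohCast A (G.edgeCoord e)) (u (G.tail e)) (u (G.tail e) + G.edgeProj x e) +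
      S (G.cohCast A (G.edgeCoord e)) (-u (G.tail e)) (-(u (G.tail e) + G.edgeProj x e)) =
      (K (G.head e) (G.edgeCoord e) - K (G.tail e) (G.edgeCoord e)) +
        (-2 : ℤ) • W (G.cohCast A (G.edgeCoord e)) (u (G.tail e)) (u (G.head e)) := by
    intro e
    obtain ⟨l, hl, hle⟩ : ∃ l ∈ G.lattice x,
        u (G.tail e) + G.edgeProj x e = u (G.head e) + l :=
      ⟨_, hu e, by abel⟩
    set n := G.edgeCoord e
    have t1 := tri n (u (G.tail e)) (u (G.tail e) + G.edgeProj x e)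
    have t2 := tri n (-u (G.tail e)) (-(u (G.tail e) + G.edgeProj x e))
    have hW : W (G.cohCast A n) (u (G.tail e)) (u (G.tail e) + G.edgeProj x e) = 0 := by
      refine (congrArg QuotientAddGroup.mk ?_).trans (QuotientAddGroup.mk_zero _)
      funext γ
      simp only [wedge, LinearMap.add_apply, edgeProj, LinearMap.smul_apply, smul_eq_mul, n,
        Pi.zero_apply]
      ring
    have hW' : W (G.cohCast A n) (-u (G.tail e)) (-(u (G.tail e) + G.edgeProj x e)) = 0 := by
      rw [← hW]
      refine congrArg QuotientAddGroup.mk ?_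
      funext γ
      simp only [wedge, LinearMap.neg_apply]
      ring
    rw [hW, add_zero] at t1
    rw [hW', add_zero] at t2
    have p1 := hper n (u (G.head e)) l hl
    have p2 := hper n (-u (G.head e)) (-l) ((G.lattice x).neg_mem hl)
    have p3 := hzero n l hl
    rw [← neg_add, ← hle] at p2
    rw [← hle] at p1
    -- Here `l = u(e⁻) + π(e) - u(e⁺)`; `π(e)` is a multiple of `n` and `u(e⁺)` is repeated, so only
    -- `u(e⁻)` counts.
    have hWl : W (G.cohCast A n) l (u (G.head e)) =
        W (G.cohCast A n) (u (G.tail e)) (u (G.head e)) := by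
      refine congrArg QuotientAddGroup.mk ?_
      have : l = u (G.tail e) + G.edgeProj x e - u (G.head e) := by rw [hle]; abel
      funext γ
      simp only [this, wedge, LinearMap.add_apply, LinearMap.sub_apply, edgeProj,
        LinearMap.smul_apply, smul_eq_mul, n]
      ring
    have hWl' : W (G.cohCast A n) (-l) (-u (G.head e)) = W (G.cohCast A n) l (u (G.head e)) := by
      refine congrArg QuotientAddGroup.mk ?_
      funext γ
      simp only [wedge, LinearMap.neg_apply]
      ring
    rw [hWl', hWl] at p2
    rw [hWl] at p1
    rw [hK, hK, eq_sub_of_add_eq' t1, eq_sub_of_add_eq' t2, p1, p2, eq_neg_of_add_eq_zero_right p3,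
      neg_smul, two_smul]
    abel
  rw [Finset.sum_congr rfl fun e _ => key e, Finset.sum_add_distrib, G.sum_head_sub_tail K,
    zero_add, ceresaForm, QuotientAddGroup.mk_zsmul, ← Finset.smul_sum]
  congr 1
  exact (map_sum (QuotientAddGroup.mk' (G.periodGroup x)) _ _).symm

variable {x} in
/-- The class of the form modulo periods depends on the potential only modulo the lattice. -/
theorem IsAnisotropic.mk_ceresaForm_congr (hx : G.IsAnisotropic x) {u u' : V → G.Coh A}
    (hu : G.IsPotential x u)
    (hu' : G.IsPotential x u') (h : ∀ w, u' w - u w ∈ G.lattice x) :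
    (QuotientAddGroup.mk (G.ceresaForm u) : ((Fin 3 → G.H1) → A) ⧸ G.periodGroup x) =
      QuotientAddGroup.mk (G.ceresaForm u') := by
  rw [← hx.sum_segPeriod G hu, ← hx.sum_segPeriod G hu']
  refine Finset.sum_congr rfl fun e _ => ?_
  have hl := h (G.tail e)
  rw [← G.segPeriod_translate x _ (u (G.tail e)) _ hl,
    ← G.segPeriod_translate x _ (-u (G.tail e)) _ ((G.lattice x).neg_mem hl)]
  congr 2 <;> abel

theorem edgeProj_eq_projInt [DecidableEq E] (e : E) :
    G.edgeProj x e = G.projInt x (Pi.single e 1) := by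
  ext γ
  simp [edgeProj, edgeCoord, cohCast, projInt, proj, lengthPairing, Pi.single_apply]

theorem isPotential_of_bdry {δ : V → E → ℤ} {v : V}
    (hδ : ∀ w, G.bdry (δ w) = Finsupp.single w 1 - Finsupp.single v 1) :
    G.IsPotential x fun w => G.projInt x (δ w) := by
  classical
  intro e
  refine ⟨δ (G.tail e) + Pi.single e 1 - δ (G.head e), ?_, ?_⟩
  · change G.bdry _ = 0
    rw [map_sub, map_add, hδ, hδ]
    simp [bdry]
  · rw [map_sub, map_add, edgeProj_eq_projInt]

variable {x} in
/-- Whether the Ceresa form is a period depends neither on the basepoint nor on the paths. -/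
theorem IsAnisotropic.ceresaForm_mem_of_bdry (hx : G.IsAnisotropic x) {δ δ' : V → E → ℤ} {v v' : V}
    (hδ : ∀ w, G.bdry (δ w) = Finsupp.single w 1 - Finsupp.single v 1)
    (hδ' : ∀ w, G.bdry (δ' w) = Finsupp.single w 1 - Finsupp.single v' 1)
    (h : G.ceresaForm (fun w => G.projInt x (δ w)) ∈ G.periodGroup x) :
    G.ceresaForm (fun w => G.projInt x (δ' w)) ∈ G.periodGroup x := by
  let u : V → G.Coh A := fun w => G.projInt x (δ w)
  -- Translation by `π` of the new path to the old basepoint moves the basepoint. Afterwards the two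
  -- potentials differ by cycles.
  let s : G.Coh A := G.projInt x (δ' v)
  have hus : G.IsPotential x fun w => u w + s := by
    intro e
    have := G.isPotential_of_bdry x hδ e
    rwa [show u (G.tail e) + s + G.edgeProj x e - (u (G.head e) + s) =
      u (G.tail e) + G.edgeProj x e - u (G.head e) by abel]
  rw [← QuotientAddGroup.eq_zero_iff] at h ⊢
  rw [← G.ceresaForm_translate u s,
    hx.mk_ceresaForm_congr G hus (G.isPotential_of_bdry x hδ') fun w => ?_] at h
  · exact h
  · refine ⟨δ' w - (δ w + δ' v), ?_, ?_⟩
    · change G.bdry _ = 0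
      rw [map_sub, map_add, hδ, hδ', hδ']
      abel
    · rw [map_sub, map_add]

end SegmentPeriod

end MultiGraph

namespace Trop

variable {M : Type*} [AddCommGroup M] [Module ℝ M]

theorem segWeight_neg (Λ : AddSubgroup M) (a b : M) (p : M ⧸ Λ) :
    segWeight Λ (segment ℝ a b) (-p) = segWeight Λ (segment ℝ (-a) (-b)) p := by
  rw [segWeight, segWeight,
    ← Set.ncard_image_of_injective {x | x ∈ segment ℝ a b ∧ (x : M ⧸ Λ) = -p} neg_injective]
  congr 2
  have himg : segment ℝ (-a) (-b) = (fun x : M => -x) '' segment ℝ a b :=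
    (image_segment ℝ (-LinearMap.id : M →ₗ[ℝ] M).toAffineMap a b).symm
  rw [himg]
  ext x
  constructor
  · rintro ⟨y, ⟨hy, h⟩, rfl⟩
    exact ⟨⟨y, hy, rfl⟩, by rw [QuotientAddGroup.mk_neg, h, neg_neg]⟩
  · rintro ⟨⟨y, hy, rfl⟩, h⟩
    exact ⟨y, ⟨hy, by rw [← h, QuotientAddGroup.mk_neg, neg_neg]⟩, rfl⟩

end Trop

/-! ### The tropical Jacobian and the value of the tropical Ceresa cycle. -/

namespace MultiGraph

open Trop

variable {V E : Type*} [Fintype E] (G : MultiGraph V E)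

section Lattices

/-- The basis of `H¹(G, A)` dual to the basis of the cycles. -/
noncomputable def cohBasis (A : Type*) [CommRing A] :
    Module.Basis (Fin (Module.finrank ℤ G.H1)) A (G.Coh A) :=
  Module.Basis.ofEquivFun (G.cycleBasis.constr A).symm

theorem cohBasis_repr {A : Type*} [CommRing A] (u : G.Coh A) (j) :
    (G.cohBasis A).repr u j = u (G.cycleBasis j) := rfl

theorem coh_apply_eq_sum {A : Type*} [CommRing A] (u : G.Coh A) (γ : G.H1) :
    u γ = ∑ j, (G.cycleBasis.repr γ j : A) * u (G.cycleBasis j) := by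
  conv_lhs => rw [← G.cycleBasis.sum_repr γ]
  rw [map_sum]
  exact Finset.sum_congr rfl fun j _ => by rw [map_smul, zsmul_eq_mul]

theorem isFullLattice_integral : IsFullLattice G.integral := by
  refine ⟨_, G.cohBasis ℝ, fun u => ⟨fun h j => h _, fun h γ => ?_⟩⟩
  choose z hz using h
  refine ⟨∑ j, G.cycleBasis.repr γ j * z j, ?_⟩
  rw [coh_apply_eq_sum]
  push_cast
  exact Finset.sum_congr rfl fun j _ => by rw [← hz j, cohBasis_repr]

theorem exists_cohCast_eq {u : G.Coh ℝ} (hu : u ∈ G.integral) : ∃ n, G.cohCast ℝ n = u := by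
  choose z hz using hu
  refine ⟨⟨⟨z, fun γ γ' => ?_⟩, fun k γ => ?_⟩, LinearMap.ext fun γ => ?_⟩
  · have := map_add u γ γ'
    rw [hz, hz, hz] at this
    exact_mod_cast this
  · have := map_smul u k γ
    rw [hz, hz, zsmul_eq_mul] at this
    exact_mod_cast this
  · rw [hz]; rfl

theorem cohCast_mem_integral (n : G.Coh ℤ) : G.cohCast ℝ n ∈ G.integral := fun γ => ⟨n γ, rfl⟩

theorem isFullLattice_int_pi (g : ℕ) : IsFullLattice
    ((AddMonoidHom.compLeft (Int.castAddHom ℝ) (Fin g)).range) := by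
  refine ⟨g, Pi.basisFun ℝ (Fin g), fun c => ?_⟩
  simp only [Pi.basisFun_repr]
  constructor
  · rintro ⟨z, rfl⟩ j
    exact ⟨z j, rfl⟩
  · intro h
    choose z hz using h
    exact ⟨z, funext fun j => (hz j).symm⟩

theorem projInt_apply {A : Type*} [CommRing A] (x : E → A) (c : E → ℤ) (γ : G.H1) :
    G.projInt x c γ = ∑ e, x e * c e * ((γ : E → ℤ) e : A) := rfl

theorem isAnisotropic_realLen (len : Lengths E) : G.IsAnisotropic (realLen len) := by
  intro h hh
  have h0 := LinearMap.congr_fun hh h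
  rw [projInt_apply, LinearMap.zero_apply] at h0
  have hpos : ∀ e, 0 < realLen len e := fun e => (len e).2
  refine Subtype.ext (funext fun e => ?_)
  have := (Finset.sum_eq_zero_iff_of_nonneg fun e _ => by
    rw [mul_assoc]
    exact mul_nonneg (hpos e).le (mul_self_nonneg _)).1 h0 e (Finset.mem_univ e)
  rw [mul_assoc, mul_eq_zero] at this
  exact_mod_cast mul_self_eq_zero.1 (this.resolve_left (hpos e).ne')

/-- A real relation gives a real combination `z` of cycles that is orthogonal to all cycles, hence
to itself, so `z = 0` as the lengths are positive. Thus the basis cycles would be dependent over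
`ℝ`; since their entries are integers they would be dependent over `ℤ`. -/
theorem linearIndependent_projInt_cycleBasis (len : Lengths E) :
    LinearIndependent ℝ fun j => G.projInt (realLen len) (G.cycleBasis j : E → ℤ) := by
  rw [Fintype.linearIndependent_iff]
  intro c hc
  let b : Fin _ → E → ℤ := fun j => (G.cycleBasis j : E → ℤ)
  let z : E → ℝ := fun e => ∑ j, c j * b j e
  have hz : ∀ γ : G.H1, ∑ e, realLen len e * z e * ((γ : E → ℤ) e : ℝ) = 0 := by
    intro γ
    have := LinearMap.congr_fun hc γ
    rw [LinearMap.sum_apply, LinearMap.zero_apply] at this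
    rw [← this]
    simp only [LinearMap.smul_apply, smul_eq_mul, projInt_apply, Finset.mul_sum, z, Finset.sum_mul]
    rw [Finset.sum_comm]
    exact Finset.sum_congr rfl fun j _ => Finset.sum_congr rfl fun e _ => by simp only [b]; ring
  have hzz : ∑ e, realLen len e * z e * z e = 0 := by
    have : ∑ e, realLen len e * z e * z e =
        ∑ j, c j * ∑ e, realLen len e * z e * (b j e : ℝ) := by
      simp only [Finset.mul_sum]
      rw [Finset.sum_comm]
      refine Finset.sum_congr rfl fun e _ => ?_
      have hs : realLen len e * z e * z e = realLen len e * z e * ∑ j, c j * b j e := rfl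
      rw [hs, Finset.mul_sum]
      exact Finset.sum_congr rfl fun j _ => by ring
    rw [this]
    exact Finset.sum_eq_zero fun j _ => by rw [hz, mul_zero]
  have hpos : ∀ e, 0 < realLen len e := fun e => (len e).2
  have hz0 : ∀ e, z e = 0 := by
    intro e
    have := (Finset.sum_eq_zero_iff_of_nonneg fun e _ => by
      rw [mul_assoc]
      exact mul_nonneg (hpos e).le (mul_self_nonneg (z e))).1 hzz e (Finset.mem_univ e)
    rw [mul_assoc, mul_eq_zero] at this
    exact mul_self_eq_zero.1 (this.resolve_left (hpos e).ne')
  by_contra! hne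
  obtain ⟨j₀, hj₀⟩ := hne
  let H : E → ((Fin (Module.finrank ℤ G.H1) → ℝ) →ₗ[ℝ] ℝ) := fun e =>
    Fintype.linearCombination ℝ fun j => (b j e : ℝ)
  have hH : ∀ e c, H e c = ∑ j, c j * b j e := fun e c => by
    simp [H, Fintype.linearCombination_apply]
  obtain ⟨w, ⟨y, rfl⟩, hw0, hw⟩ := (isFullLattice_int_pi _).exists_mem_of_rational (Set.range H)
    (by
      rintro _ ⟨e, rfl⟩ _ ⟨y, rfl⟩
      refine ⟨∑ j, y j * b j e, ?_⟩
      rw [hH]; push_cast; rfl)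
    (v := c) (fun h => hj₀ (by rw [h]; rfl)) (by
      rintro _ ⟨e, rfl⟩
      rw [hH]; exact hz0 e)
  apply hw0
  have hsum : ∑ j, y j • G.cycleBasis j = 0 := by
    apply Subtype.ext
    funext e
    have := hw (H e) ⟨e, rfl⟩
    rw [hH] at this
    change ∑ j, (y j : ℝ) * (b j e : ℝ) = 0 at this
    have h2 : ∑ j, y j * b j e = 0 := by exact_mod_cast this
    simpa [Submodule.coe_sum] using h2
  have := Fintype.linearIndependent_iff.1 G.cycleBasis.linearIndependent y hsum
  funext j
  simp [this j]

theorem isFullLattice_jacLattice (len : Lengths E) : IsFullLattice (G.jacLattice len) := by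
  have hcard : Fintype.card (Fin (Module.finrank ℤ G.H1)) = Module.finrank ℝ (G.Coh ℝ) := by
    rw [Module.finrank_eq_card_basis (G.cohBasis ℝ)]
  -- Trees are treated separately, since passing from cardinality to a basis requires a nonempty
  -- index set.
  rcases Nat.eq_zero_or_pos (Module.finrank ℤ G.H1) with h0 | h0
  · have hsub : Subsingleton (G.Coh ℝ) := by
      refine ⟨fun u w => (G.cohBasis ℝ).repr.injective (Finsupp.ext fun j => ?_)⟩
      exact absurd j.2 (by omega)
    refine ⟨_, G.cohBasis ℝ, fun u => ⟨fun _ j => absurd j.2 (by omega), fun _ => ?_⟩⟩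
    rw [Subsingleton.elim u 0]
    exact AddSubgroup.zero_mem _
  have : Nonempty (Fin (Module.finrank ℤ G.H1)) := ⟨⟨0, h0⟩⟩
  let B := basisOfLinearIndependentOfCardEqFinrank
    (G.linearIndependent_projInt_cycleBasis len) hcard
  have hB : ∀ j, B j = G.projInt (realLen len) (G.cycleBasis j : E → ℤ) := fun j => by
    simp [B]
  have hcomb : ∀ z : Fin (Module.finrank ℤ G.H1) → ℤ, ∑ j, (z j : ℝ) • B j =
      G.projInt (realLen len) ((∑ j, z j • G.cycleBasis j : G.H1) : E → ℤ) := by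
    intro z
    rw [Submodule.coe_sum, map_sum]
    refine Finset.sum_congr rfl fun j _ => ?_
    rw [hB, Int.cast_smul_eq_zsmul, Submodule.coe_smul, map_zsmul]
  refine ⟨_, B, fun u => ⟨?_, fun h => ?_⟩⟩
  · rintro ⟨h, hh, rfl⟩ j
    refine ⟨G.cycleBasis.repr ⟨h, hh⟩ j, ?_⟩
    have := hcomb (G.cycleBasis.repr ⟨h, hh⟩)
    rw [G.cycleBasis.sum_repr] at this
    rw [← this]
    exact congrFun (B.repr_sum_self fun j => (G.cycleBasis.repr ⟨h, hh⟩ j : ℝ)) j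
  · choose z hz using h
    refine ⟨_, (∑ j, z j • G.cycleBasis j : G.H1).2, ?_⟩
    rw [← hcomb, ← B.sum_repr u]
    exact Finset.sum_congr rfl fun j _ => by rw [hz]

end Lattices

section Ceresa

variable (len : Lengths E)

/-- The periods of segments form a calibration of the tropical Jacobian. -/
noncomputable def jacCalibration : Calibration G.integral (G.jacLattice len)
    (((Fin 3 → G.H1) → ℝ) ⧸ G.periodGroup (realLen len)) where
  val := G.segPeriod (realLen len)
  add_coeff _ _ a b := G.segPeriod_add _ _ _ a b
  translate n a b _ hl := G.segPeriod_translate _ n a b hl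
  triangle := by
    intro n hn a b c h
    obtain ⟨n, rfl⟩ := G.exists_cohCast_eq hn
    rw [(G.isAnisotropic_realLen len).segPeriod_triangle,
      wedge_eq_zero_of_not_linearIndependent h, QuotientAddGroup.mk_zero,
      add_zero]

/-- Write `n = k m` with `m` primitive: the lattice index is `k`, which matches additivity of the
value in the coefficient. For `n = 0`, the case of a bridge, both weight and value vanish. -/
theorem mem_graph_edge (n : G.Coh ℝ) (hn : n ∈ G.integral) (a : G.Coh ℝ) {t : ℝ} (ht : 0 ≤ t) :
    (((fun p => latticeIndex G.integral n *
      segWeight (G.jacLattice len) (segment ℝ a (a + t • n)) p :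
        G.Coh ℝ ⧸ G.jacLattice len → ℝ) : OneChain (G.jacLattice len)),
      G.segPeriod (realLen len) n a (a + t • n)) ∈ (G.jacCalibration len).graph := by
  by_cases h0 : n = 0
  · subst h0
    rw [latticeIndex_zero, segPeriod_zero]
    convert (G.jacCalibration len).graph.zero_mem using 1
    refine Prod.ext ?_ rfl
    change _ = ((0 : G.Coh ℝ ⧸ G.jacLattice len → ℝ) : OneChain (G.jacLattice len))
    refine congrArg (fun f : G.Coh ℝ ⧸ G.jacLattice len → ℝ => (f : OneChain (G.jacLattice len)))
      (funext fun p => ?_)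
    simp
  · obtain ⟨m, hm, k, hk, rfl⟩ := G.isFullLattice_integral.exists_primitive hn h0
    have hg := (G.jacCalibration len).mem_graph hm (a := a) (b := a + t • (k • m)) (t := t * k)
      (by positivity) (by rw [add_sub_cancel_left, mul_smul, Nat.cast_smul_eq_nsmul])
    rw [latticeIndex_nsmul hm k hk]
    convert (G.jacCalibration len).graph.smul_mem (k : ℤ) hg using 1
    refine Prod.ext ?_ ?_
    · rw [Prod.smul_fst, ← Filter.Germ.coe_smul]
      refine congrArg (fun f : G.Coh ℝ ⧸ G.jacLattice len → ℝ =>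
        (f : OneChain (G.jacLattice len))) (funext fun p => ?_)
      rw [Pi.smul_apply, zsmul_eq_mul]
      simp
    · rw [Prod.smul_snd, ← (G.jacCalibration len).val_zsmul hm.1, natCast_zsmul]
      rfl

theorem latticeIndex_neg {M : Type*} [AddCommGroup M] (N : AddSubgroup M) (n : M) :
    latticeIndex N (-n) = latticeIndex N n := by
  rw [latticeIndex, latticeIndex]
  congr 1
  ext k
  constructor
  · rintro ⟨m, hm, h⟩
    exact ⟨-m, N.neg_mem hm, by rw [smul_neg, h, neg_neg]⟩
  · rintro ⟨m, hm, h⟩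
    exact ⟨-m, N.neg_mem hm, by rw [smul_neg, h]⟩

variable (hG : G.Connected)

theorem edgeProj_eq_smul (e : E) :
    G.edgeProj (realLen len) e = realLen len e • G.cohCast ℝ (G.edgeCoord e) := rfl

/-- The reflected copy of an edge has coefficient `-n` and is subtracted, so the two signs cancel
and its value enters positively with coefficient `n`. -/
theorem tropCeresa_mem_graph (v : CurvePoint len) :
    (G.tropCeresa hG len v, ∑ e,
      (G.segPeriod (realLen len) (G.cohCast ℝ (G.edgeCoord e)) (G.ajStart hG len v e)
          (G.ajStart hG len v e + G.edgeProj (realLen len) e) +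
        G.segPeriod (realLen len) (G.cohCast ℝ (G.edgeCoord e)) (-G.ajStart hG len v e)
          (-(G.ajStart hG len v e + G.edgeProj (realLen len) e)))) ∈
      (G.jacCalibration len).graph := by
  have key : ∀ e, (((fun p => latticeIndex G.integral (G.cohCast ℝ (G.edgeCoord e)) *
        segWeight (G.jacLattice len) (segment ℝ (G.ajStart hG len v e)
          (G.ajStart hG len v e + G.edgeProj (realLen len) e)) p -
      latticeIndex G.integral (G.cohCast ℝ (G.edgeCoord e)) *
        segWeight (G.jacLattice len) (segment ℝ (G.ajStart hG len v e)
          (G.ajStart hG len v e + G.edgeProj (realLen len) e)) (-p) :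
        G.Coh ℝ ⧸ G.jacLattice len → ℝ) : OneChain (G.jacLattice len)),
      G.segPeriod (realLen len) (G.cohCast ℝ (G.edgeCoord e)) (G.ajStart hG len v e)
          (G.ajStart hG len v e + G.edgeProj (realLen len) e) +
        G.segPeriod (realLen len) (G.cohCast ℝ (G.edgeCoord e)) (-G.ajStart hG len v e)
          (-(G.ajStart hG len v e + G.edgeProj (realLen len) e))) ∈
      (G.jacCalibration len).graph := by
    intro e
    have hpos : 0 ≤ realLen len e := le_of_lt (len e).2
    have hn := G.cohCast_mem_integral (G.edgeCoord e)
    have h1 := G.mem_graph_edge len _ hn (G.ajStart hG len v e) hpos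
    have h2 := G.mem_graph_edge len _ (G.integral.neg_mem hn) (-G.ajStart hG len v e) hpos
    have h3 := (G.jacCalibration len).graph.sub_mem h1 h2
    convert h3 using 1
    refine Prod.ext ?_ ?_
    · rw [Prod.fst_sub, ← Filter.Germ.coe_sub]
      refine congrArg (fun f : G.Coh ℝ ⧸ G.jacLattice len → ℝ =>
        (f : OneChain (G.jacLattice len))) (funext fun p => ?_)
      rw [Pi.sub_apply, latticeIndex_neg, segWeight_neg, edgeProj_eq_smul, neg_add, smul_neg]
    · rw [Prod.snd_sub, segPeriod_neg, sub_neg_eq_add, smul_neg, ← neg_add, edgeProj_eq_smul]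
  have hsum := (G.jacCalibration len).graph.sum_mem fun e (_ : e ∈ Finset.univ) => key e
  convert hsum using 1
  refine Prod.ext ?_ ?_
  · rw [Prod.fst_sum, tropCeresa]
    refine Eq.trans ?_ (map_sum (Filter.Germ.coeAddHom Filter.cofinite) _ _)
    refine congrArg (fun f : G.Coh ℝ ⧸ G.jacLattice len → ℝ =>
        (f : OneChain (G.jacLattice len))) (funext fun p => ?_)
    rw [Finset.sum_apply, ajCycle, ajCycle, ← Finset.sum_sub_distrib]
  · rw [Prod.snd_sum]

/-- If the tropical Ceresa cycle is algebraically trivial for some basepoint, then the Ceresa form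
of any potential given by paths is a period. -/
theorem ceresaForm_mem_of_algTrivial {v : CurvePoint len}
    (h : AlgTrivial G.integral (G.jacLattice len) (G.tropCeresa hG len v)) (w₀ : V)
    (δ : V → E → ℤ) (hδ : ∀ w, G.bdry (δ w) = Finsupp.single w 1 - Finsupp.single w₀ 1) :
    G.ceresaForm (fun w => G.projInt (realLen len) (δ w)) ∈ G.periodGroup (realLen len) := by
  classical
  -- A basepoint inside an edge translates the whole potential by `t`, to which the Ceresa form is
  -- insensitive.
  let t : G.Coh ℝ := -G.proj (realLen len) fun f =>
    if f = v.edge then v.pos / realLen len v.edge else 0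
  let u : V → G.Coh ℝ := fun w => G.projInt (realLen len) (G.pathChain hG (G.tail v.edge) w)
  have hu : G.IsPotential (realLen len) u :=
    G.isPotential_of_bdry _ fun w => G.bdry_pathChain hG (G.tail v.edge) w
  have hstart : ∀ e, G.ajStart hG len v e = u (G.tail e) + t := by
    intro e
    rw [← sub_eq_add_neg]
    exact map_sub (G.proj (realLen len))
      (fun f => (G.pathChain hG (G.tail v.edge) (G.tail e) f : ℝ)) _
  have hut : G.IsPotential (realLen len) fun w => u w + t := by
    intro e
    have := hu e
    rwa [show u (G.tail e) + t + G.edgeProj (realLen len) e - (u (G.head e) + t) =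
      u (G.tail e) + G.edgeProj (realLen len) e - u (G.head e) by abel]
  have hmem := G.tropCeresa_mem_graph len hG v
  simp only [hstart] at hmem
  rw [(G.isAnisotropic_realLen len).sum_segPeriod G hut, ceresaForm_translate] at hmem
  have h0 := (G.jacCalibration len).mem_graph_of_algTrivial G.isFullLattice_integral
    (G.isFullLattice_jacLattice len) h
  have h1 := (G.jacCalibration len).graph.sub_mem hmem h0
  rw [Prod.mk_sub_mk, sub_self, sub_zero] at h1
  have h2 := (G.jacCalibration len).eq_zero_of_mem_graph (G.isFullLattice_jacLattice len) h1
  exact (G.isAnisotropic_realLen len).ceresaForm_mem_of_bdry G (G.bdry_pathChain hG _) hδ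
    ((QuotientAddGroup.eq_zero_iff _).1 h2)

end Ceresa

end MultiGraph

/-! ### The universal period in terms of the Ceresa form. -/

namespace MultiGraph

variable {V E : Type*} [Fintype E] (G : MultiGraph V E)

section Universal

/-- Evaluation at a cycle, as a linear form on `H¹(G, A)`. -/
noncomputable def evalCycle (A : Type*) [CommRing A] (γ : G.H1) : Module.Dual A (G.Coh A) where
  toFun u := u γ
  map_add' _ _ := rfl
  map_smul' _ _ := rfl

/-- The alternating form defined by an element of `⋀³ N_R`. -/
noncomputable def toForm : ⋀[EdgeRing E]^3 G.UCoh →ₗ[EdgeRing E] ((Fin 3 → G.H1) → EdgeRing E) :=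
  LinearMap.pi fun γ => exteriorPower.pairingDual (EdgeRing E) G.UCoh 3
    (exteriorPower.ιMulti (EdgeRing E) 3 fun i => G.evalCycle (EdgeRing E) (γ i))

theorem toForm_ιMulti (n u w : G.UCoh) :
    G.toForm (exteriorPower.ιMulti (EdgeRing E) 3 ![n, u, w]) = G.wedge n u w := by
  funext γ
  rw [toForm, LinearMap.pi_apply, exteriorPower.pairingDual_ιMulti_ιMulti, Matrix.det_fin_three]
  simp only [Matrix.of_apply, evalCycle, LinearMap.coe_mk, AddHom.coe_mk, Matrix.cons_val_zero,
    Matrix.cons_val_one, Matrix.cons_val, wedge]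
  ring

theorem isAnisotropic_univLength : G.IsAnisotropic (univLength : E → EdgeRing E) := by
  intro h hh
  have h0 := congrArg (MvPolynomial.eval fun _ => (1 : ℤ)) (LinearMap.congr_fun hh h)
  rw [projInt_apply, LinearMap.zero_apply, map_zero, map_sum] at h0
  simp only [univLength, map_mul, MvPolynomial.eval_X, map_intCast, one_mul, Int.cast_id] at h0
  refine Subtype.ext (funext fun e => ?_)
  exact mul_self_eq_zero.1 ((Finset.sum_eq_zero_iff_of_nonneg fun e _ => mul_self_nonneg _).1 h0 e
    (Finset.mem_univ e))

/-- Triples of basis cycles read off the coordinates in the induced basis of `⋀³ N_R`. -/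
theorem toForm_injective : Function.Injective G.toForm := by
  refine (injective_iff_map_eq_zero _).2 fun y hy => ?_
  refine ((G.cohBasis (EdgeRing E)).exteriorPower 3).ext_elem fun s => ?_
  rw [exteriorPower.basis_repr_apply, map_zero, Finsupp.coe_zero, Pi.zero_apply]
  exact congrFun hy fun i => G.cycleBasis (Set.powersetCard.ofFinEmbEquiv.symm s i)

/-- The parallelogram spanned by two lattice vectors closes up to a torus modulo `Λ`. Its
triangulation by `(0, a, a + b)` and `(0, b, a + b)` is a cycle, on which `Θ` equals `2 n ∧ a ∧ b`.
-/
theorem periodGroup_le_map_periods :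
    G.periodGroup univLength ≤ G.periods.map G.toForm.toAddMonoidHom := by
  rw [periodGroup, AddSubgroup.closure_le]
  rintro _ ⟨n, h, h', rfl⟩
  let a := G.projInt univLength h
  let b := G.projInt univLength h'
  have ha : a ∈ G.uLattice := ⟨h, h.2, rfl⟩
  have hb : b ∈ G.uLattice := ⟨h', h'.2, rfl⟩
  refine ⟨G.theta (Finsupp.single (LatticeChain.mk G.uLattice ![0, a, b + a]) n -
    Finsupp.single (LatticeChain.mk G.uLattice ![0, b, a + b]) n),
    ⟨_, ?_, rfl⟩, ?_⟩
  · change LatticeChain.boundary (G.Coh ℤ) G.uLattice 1 _ = 0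
    rw [map_sub, LatticeChain.boundary_single_one, LatticeChain.boundary_single_one]
    have h1 := LatticeChain.mk_translate G.uLattice 0 b ha
    have h2 := LatticeChain.mk_translate G.uLattice 0 a hb
    rw [zero_add] at h1 h2
    rw [h1, h2, add_comm a b]
    abel
  · change G.toForm _ = _
    rw [map_sub, map_sub, theta_single, theta_single, toForm_ιMulti, toForm_ιMulti]
    funext γ
    simp only [wedge, LinearMap.add_apply, LinearMap.sub_apply, LinearMap.zero_apply, Pi.sub_apply,
      Pi.smul_apply, two_smul, a, b]
    ring

/-- The segment periods, extended to all chains. -/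
noncomputable def chainPeriod :
    G.UChain 1 →+ ((Fin 3 → G.H1) → EdgeRing E) ⧸ G.periodGroup univLength :=
  Finsupp.liftAddHom fun σ : LatticeChain.Simplex G.uLattice 1 =>
    Quotient.liftOn' σ (fun u : Fin 2 → G.UCoh =>
      ({ toFun := fun n => G.segPeriod univLength (G.cohCast _ n) (u 0) (u 1)
         map_zero' := by rw [map_zero]; exact G.segPeriod_zero _ _ _
         map_add' := fun n n' => by rw [map_add]; exact G.segPeriod_add _ _ _ _ _ } :
        G.Coh ℤ →+ ((Fin 3 → G.H1) → EdgeRing E) ⧸ G.periodGroup univLength)) (by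
      intro u u' h
      obtain ⟨l, hΛ, hl⟩ := QuotientAddGroup.leftRel_apply.1 h
      have hj : ∀ j, u' j = u j + l := fun j => by
        have := congrFun hl j
        simp only [Pi.constAddMonoidHom_apply, Function.const_apply, Pi.add_apply,
          Pi.neg_apply] at this
        rw [this]; abel
      refine AddMonoidHom.ext fun n => ?_
      change G.segPeriod _ _ _ _ = G.segPeriod _ _ _ _
      rw [hj, hj, G.segPeriod_translate _ _ _ _ hΛ])

theorem chainPeriod_single (n : G.Coh ℤ) (a b : G.UCoh) :
    G.chainPeriod (Finsupp.single (LatticeChain.mk G.uLattice ![a, b]) n) =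
      G.segPeriod univLength (G.cohCast _ n) a b := by
  rw [chainPeriod, Finsupp.liftAddHom_apply_single]
  rfl

/-- On a generator this is the triangle identity for `segPeriod`. In particular `Θ` sends every
cycle into the period group, the inclusion opposite to `periodGroup_le_map_periods`. -/
theorem chainPeriod_boundary (S : G.UChain 2) :
    G.chainPeriod (G.uBoundary 1 S) = QuotientAddGroup.mk (G.toForm (G.theta S)) := by
  have : G.chainPeriod.comp (G.uBoundary 1) =
      (QuotientAddGroup.mk' (G.periodGroup univLength)).comp
        (G.toForm.toAddMonoidHom.comp G.theta) := by
    refine Finsupp.addHom_ext fun σ n => ?_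
    obtain ⟨u, rfl⟩ := QuotientAddGroup.mk_surjective σ
    have hu : u = ![u 0, u 1, u 2] := by
      ext j; fin_cases j <;> rfl
    rw [hu]
    change G.chainPeriod (LatticeChain.boundary (G.Coh ℤ) G.uLattice 1
      (Finsupp.single (LatticeChain.mk G.uLattice ![u 0, u 1, u 2]) n)) =
      QuotientAddGroup.mk (G.toForm (G.theta
        (Finsupp.single (LatticeChain.mk G.uLattice ![u 0, u 1, u 2]) n)))
    rw [LatticeChain.boundary_single_one, theta_single, toForm_ιMulti, map_add, map_sub,
      chainPeriod_single, chainPeriod_single, chainPeriod_single]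
    rw [← sub_eq_iff_eq_add'.2
      (G.isAnisotropic_univLength.segPeriod_triangle G n (u 0) (u 1) (u 2))]
    abel
  exact DFunLike.congr_fun this S

variable (hG : G.Connected) (v : V)

theorem chainPeriod_uCeresa :
    G.chainPeriod (G.uCeresa hG v) = QuotientAddGroup.mk
      (G.ceresaForm fun w => G.projInt univLength (G.pathChain hG v w)) := by
  rw [← G.isAnisotropic_univLength.sum_segPeriod G
    (G.isPotential_of_bdry univLength (G.bdry_pathChain hG v)),
    uCeresa, map_sum]
  refine Finset.sum_congr rfl fun e _ => ?_
  rw [map_sub, chainPeriod_single, chainPeriod_single, map_neg, segPeriod_neg, sub_neg_eq_add]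
  rfl

/-- For a filling, `Θ` is congruent modulo periods to the segment period of its boundary, which is
the Ceresa form; and the period group is exactly the image of `𝒫` under the injective map `toForm`.
-/
theorem ceresaPeriod_eq_zero_iff : G.ceresaPeriod hG v = 0 ↔
    (G.ceresaForm fun w => G.projInt univLength (G.pathChain hG v w)) ∈
      G.periodGroup univLength := by
  set S := (G.exists_uFilling hG v).choose with hS
  have hbd : G.uBoundary 1 S = G.uCeresa hG v := (G.exists_uFilling hG v).choose_spec
  have hform := G.chainPeriod_boundary S
  rw [hbd, chainPeriod_uCeresa] at hform
  rw [← QuotientAddGroup.eq_zero_iff, hform, QuotientAddGroup.eq_zero_iff, ceresaPeriod,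
    QuotientAddGroup.eq_zero_iff]
  constructor
  · rintro ⟨Z, hZ, hZS⟩
    have hZ' : G.uBoundary 1 Z = 0 := hZ
    have := G.chainPeriod_boundary Z
    rw [hZ', map_zero, hZS] at this
    exact (QuotientAddGroup.eq_zero_iff _).1 this.symm
  · intro h
    obtain ⟨p, hp, hpS⟩ := G.periodGroup_le_map_periods h
    rwa [← G.toForm_injective hpS]

end Universal

/-! ### Base change and very general edge lengths. -/

section Generic

variable {A B : Type*} [CommRing A] [CommRing B] (φ : A →+* B) (x : E → A)

theorem map_projInt (c : E → ℤ) (γ : G.H1) :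
    φ (G.projInt x c γ) = G.projInt (fun e => φ (x e)) c γ := by
  simp [projInt_apply]

theorem map_wedge (n : G.Coh ℤ) (c d : E → ℤ) (γ : Fin 3 → G.H1) :
    φ (G.wedge (G.cohCast A n) (G.projInt x c) (G.projInt x d) γ) =
      G.wedge (G.cohCast B n) (G.projInt (fun e => φ (x e)) c)
        (G.projInt (fun e => φ (x e)) d) γ := by
  simp [wedge, map_projInt, cohCast]

/-- Base change of alternating forms along a ring homomorphism. -/
def mapForm : ((Fin 3 → G.H1) → A) →+ ((Fin 3 → G.H1) → B) :=
  φ.toAddMonoidHom.compLeft _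

theorem mapForm_ceresaForm (δ : V → E → ℤ) :
    G.mapForm φ (G.ceresaForm fun w => G.projInt x (δ w)) =
      G.ceresaForm fun w => G.projInt (fun e => φ (x e)) (δ w) := by
  rw [ceresaForm, ceresaForm, map_zsmul, map_sum]
  congr 1
  refine Finset.sum_congr rfl fun e _ => ?_
  funext γ
  exact G.map_wedge φ x _ _ _ γ

theorem periodGroup_map_le :
    G.periodGroup (fun e => φ (x e)) ≤ (G.periodGroup x).map (G.mapForm φ) := by
  rw [periodGroup, AddSubgroup.closure_le]
  rintro _ ⟨n, h, h', rfl⟩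
  refine ⟨_, AddSubgroup.subset_closure ⟨n, h, h', rfl⟩, ?_⟩
  rw [map_zsmul]
  congr 1
  funext γ
  exact G.map_wedge φ x _ _ _ γ

/-- If no nonzero integral polynomial vanishes at the edge lengths, then algebraic triviality of the
tropical Ceresa cycle implies the vanishing of the Ceresa period. -/
theorem ceresaPeriod_eq_zero_of_algTrivial (hG : G.Connected) {len : Lengths E}
    (hlen : Function.Injective (MvPolynomial.aeval (realLen len) : EdgeRing E →ₐ[ℤ] ℝ))
    {p : CurvePoint len}
    (h : Trop.AlgTrivial G.integral (G.jacLattice len) (G.tropCeresa hG len p)) (v : V) :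
    G.ceresaPeriod hG v = 0 := by
  let φ : EdgeRing E →+* ℝ :=
    (MvPolynomial.aeval (realLen len) : EdgeRing E →ₐ[ℤ] ℝ).toRingHom
  have hφ : (fun e => φ (univLength e)) = realLen len := by
    funext e
    simp [φ, univLength]
  rw [ceresaPeriod_eq_zero_iff]
  have := G.ceresaForm_mem_of_algTrivial len hG h v _ (G.bdry_pathChain hG v)
  rw [← hφ, ← G.mapForm_ceresaForm φ] at this
  obtain ⟨y, hy, hyS⟩ := G.periodGroup_map_le φ _ this
  have hinj : Function.Injective (G.mapForm φ) := fun a b hab =>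
    funext fun γ => hlen (congrFun hab γ)
  rwa [← hinj hyS]

/-- There are countably many integral polynomials. Off their zero loci evaluation at the lengths is
injective on `EdgeRing E`. -/
theorem veryGeneral_ceresaNontrivial (hG : G.Connected) (v : V) (hα : G.ceresaPeriod hG v ≠ 0) :
    G.VeryGeneral (G.CeresaNontrivial hG) := by
  have hcount : Countable (EdgeRing E) :=
    (MvPolynomial.basisMonomials E ℤ).repr.injective.countable
  refine ⟨(fun f : EdgeRing E => G.toModuli '' {len | MvPolynomial.eval (realLen len)
      (MvPolynomial.map (Int.castRingHom ℝ) f) = 0}) '' {f | f ≠ 0},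
    (Set.to_countable _).image _, ?_, fun len hlen p h => hα ?_⟩
  · rintro _ ⟨f, hf, rfl⟩
    refine ⟨_, fun h0 => hf ?_, rfl⟩
    exact MvPolynomial.map_injective _ Int.cast_injective (h0.trans (map_zero _).symm)
  · refine G.ceresaPeriod_eq_zero_of_algTrivial hG ?_ h v
    refine (injective_iff_map_eq_zero _).2 fun f hf => ?_
    by_contra hne
    refine hlen ⟨_, ⟨f, hne, rfl⟩, len, ?_, rfl⟩
    rw [Set.mem_ofPred_eq, MvPolynomial.eval_map]
    exact hf

end Generic

end MultiGraph

/-! ### The tensor obstruction to vanishing of the period. -/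

namespace MultiGraph

section Tensor

variable {V E : Type*} [Fintype E] (G : MultiGraph V E)

/-- The entries of the bivector `c ∧ d`. -/
def chainWedge (c d : E → ℤ) (a b : E) : ℤ := c a * d b - c b * d a

/-- The cyclic sum of the products of the entries of `ξ(γ_i)` and `γ_j ∧ γ_k`. -/
noncomputable def cyclicSum (ξ : G.H1 → E → E → ℤ) (γ : Fin 3 → G.H1) (a b : E) : ℤ :=
  ξ (γ 0) a b * chainWedge (γ 1) (γ 2) a b + ξ (γ 1) a b * chainWedge (γ 2) (γ 0) a b +
    ξ (γ 2) a b * chainWedge (γ 0) (γ 1) a b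

/-- The entries of `-2 ∑ γ_e δ(e⁻) ∧ δ(e⁺)`. -/
noncomputable def ceresaTensor (δ : V → E → ℤ) (γ : G.H1) (a b : E) : ℤ :=
  -2 * ∑ e, (γ : E → ℤ) e * chainWedge (δ (G.tail e)) (δ (G.head e)) a b

/-- A family of bivectors of cycles. -/
def IsCycleTensor (ξ : G.H1 → E → E → ℤ) : Prop :=
  (∀ γ a b, ξ γ a b = -ξ γ b a) ∧ ∀ γ b, (fun a => ξ γ a b) ∈ G.H1

/-- The tensor of the Ceresa form is congruent to one with values in bivectors of cycles. -/
def CeresaSplits (δ : V → E → ℤ) : Prop :=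
  ∃ ξ, G.IsCycleTensor ξ ∧ ∀ γ a b, a ≠ b →
    G.cyclicSum (G.ceresaTensor δ) γ a b = G.cyclicSum ξ γ a b

open Classical in
/-- The specialization of the edge lengths to the indicator function of `{a, b}`. -/
noncomputable def pairHom (a b : E) : EdgeRing E →+* ℤ :=
  MvPolynomial.eval fun e => if e = a ∨ e = b then 1 else 0

/-- With only the lengths of `a` and `b` surviving, `π(c) ∧ π(d)` on two cycles is the determinant
of a product of 2 × 2 matrices, hence the product of the two minors at `(a, b)`. -/
theorem mapForm_pairHom_wedge {a b : E} (hab : a ≠ b) (n : G.Coh ℤ) (c d : E → ℤ)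
    (γ : Fin 3 → G.H1) :
    G.mapForm (pairHom a b) (G.wedge (G.cohCast _ n) (G.projInt univLength c)
      (G.projInt univLength d)) γ = G.cyclicSum (fun γ a b => n γ * chainWedge c d a b) γ a b := by
  classical
  have hp : ∀ (c : E → ℤ) (γ : G.H1), G.projInt (fun e => pairHom a b (univLength e)) c γ =
      c a * (γ : E → ℤ) a + c b * (γ : E → ℤ) b := by
    intro c γ
    have hx : ∀ e, pairHom a b (univLength e) = if e = a ∨ e = b then 1 else 0 := fun e => by
      simp [pairHom, univLength]
    rw [projInt_apply, ← Finset.sum_subset (Finset.subset_univ {a, b}), Finset.sum_pair hab]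
    · simp [hx]
    · intro e _ he
      rw [hx, if_neg (by simpa using he), zero_mul, zero_mul]
  refine (G.map_wedge (pairHom a b) univLength n c d γ).trans ?_
  simp only [wedge, hp, cyclicSum, chainWedge, cohCast, AddMonoidHom.coe_mk, ZeroHom.coe_mk,
    LinearMap.comp_apply, AddMonoidHom.coe_toIntLinearMap, Int.coe_castAddHom, Int.cast_id]
  ring

variable {G} in
theorem cyclicSum_add (ξ ξ' : G.H1 → E → E → ℤ) (γ : Fin 3 → G.H1) (a b : E) :
    G.cyclicSum (ξ + ξ') γ a b = G.cyclicSum ξ γ a b + G.cyclicSum ξ' γ a b := by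
  simp only [cyclicSum, Pi.add_apply]; ring

/-- A generator `2 n ∧ π(h) ∧ π(k)` gives the tensor `2 n ⊗ (h ∧ k)`. The factor two is not recorded
in `ξ`: the obstructions for `K₄` and `L₃` do not need it. -/
theorem exists_isCycleTensor {F : (Fin 3 → G.H1) → EdgeRing E}
    (hF : F ∈ G.periodGroup univLength) :
    ∃ ξ, G.IsCycleTensor ξ ∧ ∀ γ a b, a ≠ b →
      G.mapForm (pairHom a b) F γ = G.cyclicSum ξ γ a b := by
  induction hF using AddSubgroup.closure_induction with
  | mem F hF =>
    obtain ⟨n, h, h', rfl⟩ := hF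
    refine ⟨fun γ a b => 2 * (n γ * chainWedge h h' a b), ⟨fun γ a b => ?_, fun γ b => ?_⟩,
      fun γ a b hab => ?_⟩
    · simp only [chainWedge]; ring
    · convert ((2 * n γ * (h' : E → ℤ) b) • h - (2 * n γ * (h : E → ℤ) b) • h' : G.H1).2 using 1
      funext a
      simp only [chainWedge, Submodule.coe_sub, Submodule.coe_smul, Pi.sub_apply, Pi.smul_apply,
        smul_eq_mul]
      ring
    · rw [map_zsmul, Pi.smul_apply, G.mapForm_pairHom_wedge hab]
      simp only [cyclicSum, smul_eq_mul]
      ring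
  | zero =>
    exact ⟨0, ⟨fun _ _ _ => rfl, fun _ _ => G.H1.zero_mem⟩, fun γ a b _ => by
      simp [cyclicSum]⟩
  | add F F' _ _ ih ih' =>
    obtain ⟨ξ, h, hξ⟩ := ih
    obtain ⟨ξ', h', hξ'⟩ := ih'
    refine ⟨ξ + ξ', ⟨fun γ a b => ?_, fun γ b => G.H1.add_mem (h.2 γ b) (h'.2 γ b)⟩,
      fun γ a b hab => ?_⟩
    · simp only [Pi.add_apply]
      rw [h.1, h'.1, neg_add]
    · rw [map_add, Pi.add_apply, hξ γ a b hab, hξ' γ a b hab, cyclicSum_add]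
  | neg F _ ih =>
    obtain ⟨ξ, h, hξ⟩ := ih
    refine ⟨-ξ, ⟨fun γ a b => ?_, fun γ b => G.H1.neg_mem (h.2 γ b)⟩, fun γ a b hab => ?_⟩
    · simp only [Pi.neg_apply]
      rw [h.1]
    · rw [map_neg, Pi.neg_apply, hξ γ a b hab]
      simp only [cyclicSum, Pi.neg_apply]
      ring

theorem mapForm_pairHom_ceresaForm {a b : E} (hab : a ≠ b) (δ : V → E → ℤ) (γ : Fin 3 → G.H1) :
    G.mapForm (pairHom a b) (G.ceresaForm fun w => G.projInt univLength (δ w)) γ =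
      G.cyclicSum (G.ceresaTensor δ) γ a b := by
  rw [ceresaForm, map_zsmul, map_sum, Pi.smul_apply, Finset.sum_apply]
  simp only [G.mapForm_pairHom_wedge hab, cyclicSum, ceresaTensor, Finset.sum_add_distrib,
    smul_eq_mul, mul_add, mul_assoc, Finset.sum_mul]
  rfl

theorem ceresaSplits_of_ceresaPeriod_eq_zero {hG : G.Connected} {v : V}
    (h : G.ceresaPeriod hG v = 0) {δ : V → E → ℤ} {w₀ : V}
    (hδ : ∀ w, G.bdry (δ w) = Finsupp.single w 1 - Finsupp.single w₀ 1) : G.CeresaSplits δ := by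
  obtain ⟨ξ, hξ, h⟩ := G.exists_isCycleTensor (G.isAnisotropic_univLength.ceresaForm_mem_of_bdry G
    (G.bdry_pathChain hG v) hδ ((G.ceresaPeriod_eq_zero_iff hG v).1 h))
  exact ⟨ξ, hξ, fun γ a b hab => by rw [← h γ a b hab, G.mapForm_pairHom_ceresaForm hab]⟩

end Tensor

end MultiGraph

/-! ### Descent of the tensor condition to minors. -/

namespace MultiGraph

variable {V E : Type*} (G : MultiGraph V E)

section Chains

variable [Fintype E]

theorem sum_mul_head_sub_tail (c : E → ℤ) (g : V → ℤ) :
    ∑ e, c e * (g (G.head e) - g (G.tail e)) = Finsupp.linearCombination ℤ g (G.bdry c) := by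
  simp [bdry, Fintype.linearCombination_apply, mul_sub]

variable {G} in
theorem sum_cycle_mul {z : E → ℤ} (hz : z ∈ G.H1) (g : V → ℤ) :
    ∑ e, z e * (g (G.head e) - g (G.tail e)) = 0 := by
  rw [sum_mul_head_sub_tail, show G.bdry z = 0 from hz, map_zero]

variable {G} in
theorem mem_H1_of_sum_mul {z : E → ℤ}
    (h : ∀ g : V → ℤ, ∑ e, z e * (g (G.head e) - g (G.tail e)) = 0) : z ∈ G.H1 := by
  classical
  refine Finsupp.ext fun w => ?_
  have := h (Pi.single w 1)
  rw [sum_mul_head_sub_tail, Finsupp.linearCombination_apply] at this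
  simpa [Finsupp.sum, Pi.single_apply] using this

variable {G} in
theorem sum_path_mul {c : E → ℤ} {a b : V}
    (hc : G.bdry c = Finsupp.single b 1 - Finsupp.single a 1) (g : V → ℤ) :
    ∑ e, c e * (g (G.head e) - g (G.tail e)) = g b - g a := by
  rw [sum_mul_head_sub_tail, hc]
  simp

variable {G} in
/-- The cycle that consists of an edge and the paths to its ends. -/
theorem single_add_sub_mem [DecidableEq E] {δ : V → E → ℤ} {w₀ : V}
    (hδ : ∀ w, G.bdry (δ w) = Finsupp.single w 1 - Finsupp.single w₀ 1) (e : E) :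
    Pi.single e 1 + δ (G.tail e) - δ (G.head e) ∈ G.H1 := by
  change G.bdry _ = 0
  rw [map_sub, map_add, hδ, hδ]
  simp [bdry]

end Chains

section Contraction

variable {V' E' : Type*}

/-- Paths in `G` that are adapted to a presentation of `H` as a minor: `β` maps the vertices of
`G` to those of `H`, the edge `ψ f` corresponds to `f` with orientation `ε f`, and the paths `δ` of
`G` lie over the paths `δ'` of `H` and use no other edge between distinct fibres of `β`. -/
structure IsMinorModel (H : MultiGraph V' E') (β : V → V') (ψ : E' → E) (ε : E' → ℤ)
    (δ : V → E → ℤ) (δ' : V' → E' → ℤ) : Prop where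
  injective : Function.Injective ψ
  ends : ∀ f, (ε f = 1 ∧ β (G.tail (ψ f)) = H.tail f ∧ β (G.head (ψ f)) = H.head f) ∨
    (ε f = -1 ∧ β (G.tail (ψ f)) = H.head f ∧ β (G.head (ψ f)) = H.tail f)
  path_edge : ∀ w f, δ w (ψ f) = ε f * δ' (β w) f
  path_cross : ∀ w e, e ∉ Set.range ψ → β (G.tail e) ≠ β (G.head e) → δ w e = 0

namespace IsMinorModel

variable {G} {H : MultiGraph V' E'} {β : V → V'} {ψ : E' → E} {ε : E' → ℤ} {δ : V → E → ℤ}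
  {δ' : V' → E' → ℤ}

theorem sign_mul_self (h : G.IsMinorModel H β ψ ε δ δ')
    (f : E') : ε f * ε f = 1 := by
  rcases h.ends f with ⟨h, -⟩ | ⟨h, -⟩ <;> rw [h] <;> rfl

theorem sign_mul_sub (h : G.IsMinorModel H β ψ ε δ δ')
    (f : E') (g : V' → ℤ) :
    g (β (G.head (ψ f))) - g (β (G.tail (ψ f))) = ε f * (g (H.head f) - g (H.tail f)) := by
  rcases h.ends f with ⟨h, h1, h2⟩ | ⟨h, h1, h2⟩ <;> rw [h, h1, h2] <;> ring

variable [Fintype E]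

theorem ceresaTensor_cross (h : G.IsMinorModel H β ψ ε δ δ')
    (γ : G.H1) (a : E) {d : E} (hd : d ∉ Set.range ψ)
    (hd' : β (G.tail d) ≠ β (G.head d)) : G.ceresaTensor δ γ a d = 0 := by
  simp [ceresaTensor, chainWedge, h.path_cross _ _ hd hd']

variable [Fintype E']

theorem sum_eq (h : G.IsMinorModel H β ψ ε δ δ')
    [DecidablePred (· ∈ Set.range ψ)] (F : E → ℤ) :
    ∑ e, F e = ∑ f, F (ψ f) + ∑ e with e ∉ Set.range ψ, F e := by
  classical
  rw [← Finset.sum_filter_add_sum_filter_not Finset.univ (· ∈ Set.range ψ)]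
  congr 1
  rw [← Finset.sum_image fun a _ b _ hab => h.injective hab]
  congr 1
  ext e
  simp

theorem sum_cycle (h : G.IsMinorModel H β ψ ε δ δ')
    [DecidablePred (· ∈ Set.range ψ)] {z : E → ℤ} (hz : z ∈ G.H1) (g : V' → ℤ) :
    ∑ f, ε f * z (ψ f) * (g (H.head f) - g (H.tail f)) =
      -∑ e with e ∉ Set.range ψ, z e * (g (β (G.head e)) - g (β (G.tail e))) := by
  rw [eq_neg_iff_add_eq_zero, ← sum_cycle_mul hz fun w => g (β w), h.sum_eq]
  congr 1
  refine Finset.sum_congr rfl fun f _ => ?_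
  rw [h.sign_mul_sub]
  ring

open Classical in
/-- The lift of a cycle of the minor. -/
noncomputable def lift (_ : G.IsMinorModel H β ψ ε δ δ') {w₀ : V}
    (hδ : ∀ w, G.bdry (δ w) = Finsupp.single w 1 - Finsupp.single w₀ 1) (γ : H.H1) : G.H1 :=
  ∑ f, (ε f * (γ : E' → ℤ) f) • ⟨_, single_add_sub_mem hδ (ψ f)⟩

variable {w₀ : V}

theorem lift_apply (h : G.IsMinorModel H β ψ ε δ δ')
    (hδ : ∀ w, G.bdry (δ w) = Finsupp.single w 1 - Finsupp.single w₀ 1)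
    [DecidableEq E] (γ : H.H1) (e : E) : (h.lift hδ γ : E → ℤ) e =
    ∑ f, ε f * (γ : E' → ℤ) f *
      ((Pi.single (ψ f) 1 : E → ℤ) e + δ (G.tail (ψ f)) e - δ (G.head (ψ f)) e) := by
  simp only [lift, Submodule.coe_sum, Submodule.coe_smul, Finset.sum_apply, Pi.smul_apply,
    Pi.sub_apply, Pi.add_apply, smul_eq_mul]
  exact Finset.sum_congr rfl fun f _ => by congr

/-- On the edges of the minor the paths to the ends of `ψ f` depend only on the vertices of `H`, so
their contributions sum to zero over the cycle `γ`. -/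
theorem lift_edge (h : G.IsMinorModel H β ψ ε δ δ')
    (hδ : ∀ w, G.bdry (δ w) = Finsupp.single w 1 - Finsupp.single w₀ 1)
    (γ : H.H1) (a : E') :
    (h.lift hδ γ : E → ℤ) (ψ a) = ε a * (γ : E' → ℤ) a := by
  classical
  rw [h.lift_apply hδ]
  have hcyc := sum_cycle_mul γ.2 fun b => δ' b a
  have hterm : ∀ f, ε f * (γ : E' → ℤ) f * ((Pi.single (ψ f) 1 : E → ℤ) (ψ a) +
      δ (G.tail (ψ f)) (ψ a) - δ (G.head (ψ f)) (ψ a)) =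
      (if f = a then ε a * (γ : E' → ℤ) a else 0) -
        ε a * ((γ : E' → ℤ) f * (δ' (H.head f) a - δ' (H.tail f) a)) := by
    intro f
    have hs := h.sign_mul_sub f fun b => δ' b a
    have hsq := h.sign_mul_self f
    rw [h.path_edge, h.path_edge, Pi.single_apply]
    by_cases hf : f = a
    · subst hf
      rw [if_pos rfl, if_pos rfl]
      linear_combination (-(ε f * γ.1 f * ε f)) * hs -
        (γ.1 f * ε f * (δ' (H.head f) f - δ' (H.tail f) f)) * hsq
    · rw [if_neg fun e => hf (h.injective e.symm), if_neg hf]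
      linear_combination (-(ε f * γ.1 f * ε a)) * hs -
        (γ.1 f * ε a * (δ' (H.head f) a - δ' (H.tail f) a)) * hsq
  rw [Finset.sum_congr rfl fun f _ => hterm f, Finset.sum_sub_distrib, ← Finset.mul_sum, hcyc]
  simp

theorem lift_cross (h : G.IsMinorModel H β ψ ε δ δ')
    (hδ : ∀ w, G.bdry (δ w) = Finsupp.single w 1 - Finsupp.single w₀ 1)
    (γ : H.H1) {d : E} (hd : d ∉ Set.range ψ)
    (hd' : β (G.tail d) ≠ β (G.head d)) : (h.lift hδ γ : E → ℤ) d = 0 := by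
  classical
  rw [h.lift_apply hδ]
  refine Finset.sum_eq_zero fun f _ => ?_
  rw [h.path_cross _ _ hd hd', h.path_cross _ _ hd hd', Pi.single_apply,
    if_neg fun e => hd ⟨f, e.symm⟩]
  simp

/-- Edges inside a fibre of `β` contribute nothing, since the paths to their two ends agree on the
edges of the minor. Other edges outside the minor do not occur in the lift. -/
theorem ceresaTensor_edge (h : G.IsMinorModel H β ψ ε δ δ')
    (hδ : ∀ w, G.bdry (δ w) = Finsupp.single w 1 - Finsupp.single w₀ 1)
    (γ : H.H1) (a b : E') :
    G.ceresaTensor δ (h.lift hδ γ) (ψ a) (ψ b) = ε a * ε b * H.ceresaTensor δ' γ a b := by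
  classical
  have hz : ∑ e with e ∉ Set.range ψ, (h.lift hδ γ : E → ℤ) e *
      chainWedge (δ (G.tail e)) (δ (G.head e)) (ψ a) (ψ b) = 0 := by
    refine Finset.sum_eq_zero fun e he => ?_
    by_cases hd : β (G.tail e) = β (G.head e)
    · simp only [chainWedge, h.path_edge, hd]
      ring
    · rw [h.lift_cross hδ γ (Finset.mem_filter.1 he).2 hd, zero_mul]
  rw [ceresaTensor, ceresaTensor, h.sum_eq, hz, add_zero, mul_left_comm]
  congr 1
  rw [Finset.mul_sum]
  refine Finset.sum_congr rfl fun f _ => ?_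
  rw [h.lift_edge hδ]
  simp only [chainWedge, h.path_edge]
  rcases h.ends f with ⟨h0, h1, h2⟩ | ⟨h0, h1, h2⟩ <;> rw [h0, h1, h2] <;> ring

section Descent

variable {ξ : G.H1 → E → E → ℤ}

/-- Evaluate the identity on two lifts and the cycle through `d`. Only that cycle has a nonzero
entry at `d`, and the Ceresa tensor vanishes there. -/
theorem tensor_exchange (h : G.IsMinorModel H β ψ ε δ δ')
    (hδ : ∀ w, G.bdry (δ w) = Finsupp.single w 1 - Finsupp.single w₀ 1)
    (hξ : ∀ γ a b, a ≠ b →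
      G.cyclicSum (G.ceresaTensor δ) γ a b = G.cyclicSum ξ γ a b)
    {d : E} (hd : d ∉ Set.range ψ)
    (hd' : β (G.tail d) ≠ β (G.head d)) (γ γ' : H.H1) (a : E') :
    ξ (h.lift hδ γ) (ψ a) d * (ε a * (γ' : E' → ℤ) a) =
      ξ (h.lift hδ γ') (ψ a) d * (ε a * (γ : E' → ℤ) a) := by
  classical
  have := hξ ![h.lift hδ γ, h.lift hδ γ', ⟨_, single_add_sub_mem hδ d⟩] (ψ a) d
    fun e => hd ⟨a, e⟩
  simp only [cyclicSum, Matrix.cons_val_zero, Matrix.cons_val_one, Matrix.cons_val,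
    h.ceresaTensor_cross _ _ hd hd', chainWedge, h.lift_cross hδ _ hd hd', h.lift_edge hδ,
    Pi.sub_apply, Pi.add_apply, Pi.single_eq_same, h.path_cross _ _ hd hd'] at this
  linear_combination -this

/-- For `d ≠ d'`, evaluate at `(d, d')` on one lift and the cycles through `d` and `d'`. The minor
of the last two is one and everything else vanishes. -/
theorem tensor_cross_cross (h : G.IsMinorModel H β ψ ε δ δ')
    (hδ : ∀ w, G.bdry (δ w) = Finsupp.single w 1 - Finsupp.single w₀ 1)
    (hξ : ∀ γ a b, a ≠ b →
      G.cyclicSum (G.ceresaTensor δ) γ a b = G.cyclicSum ξ γ a b)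
    (hanti : ∀ γ a b, ξ γ a b = -ξ γ b a) {d d' : E}
    (hd : d ∉ Set.range ψ) (hdc : β (G.tail d) ≠ β (G.head d)) (hd' : d' ∉ Set.range ψ)
    (hdc' : β (G.tail d') ≠ β (G.head d')) (γ : H.H1) : ξ (h.lift hδ γ) d d' = 0 := by
  classical
  by_cases hdd : d = d'
  · subst hdd
    have := hanti (h.lift hδ γ) d d
    omega
  have := hξ ![h.lift hδ γ, ⟨_, single_add_sub_mem hδ d⟩, ⟨_, single_add_sub_mem hδ d'⟩] d d' hdd
  simp only [cyclicSum, Matrix.cons_val_zero, Matrix.cons_val_one, Matrix.cons_val,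
    h.ceresaTensor_cross _ _ hd' hdc', chainWedge, h.lift_cross hδ _ hd hdc,
    h.lift_cross hδ _ hd' hdc', Pi.sub_apply, Pi.add_apply, Pi.single_eq_same,
    h.path_cross _ _ hd hdc, h.path_cross _ _ hd' hdc', Pi.single_eq_of_ne hdd,
    Pi.single_eq_of_ne (Ne.symm hdd)] at this
  linear_combination -this

/-- Restricting `ξ` to the edges of the minor spoils the cycle condition, because boundary escapes
through the deleted edges `d` joining different fibres. The correction `K` replaces each such `d` by
the path `s d` in `H` between its ends. By `tensor_cross_cross` its factors `y γ d` are cycles, so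
`K` repairs exactly the missing boundary. By `tensor_exchange` the entries of `y γ d` are
proportional to those of `γ`, so the cyclic sum of `K` vanishes and the identity survives. -/
theorem ceresaSplits (h : G.IsMinorModel H β ψ ε δ δ')
    (hδ : ∀ w, G.bdry (δ w) = Finsupp.single w 1 - Finsupp.single w₀ 1)
    (hs : G.CeresaSplits δ) {b₀ : V'}
    (hδ' : ∀ b, H.bdry (δ' b) = Finsupp.single b 1 - Finsupp.single b₀ 1) :
    H.CeresaSplits δ' := by
  classical
  obtain ⟨ξ, ⟨hanti, hcol⟩, hξ⟩ := hs
  let s : E → E' → ℤ := fun d => δ' (β (G.tail d)) - δ' (β (G.head d))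
  let y : H.H1 → E → E' → ℤ := fun γ d a => ε a * ξ (h.lift hδ γ) (ψ a) d
  let K : H.H1 → E' → E' → ℤ := fun γ a b =>
    ∑ d with d ∉ Set.range ψ, chainWedge (y γ d) (s d) a b
  have hs0 : ∀ d, β (G.tail d) = β (G.head d) → s d = 0 := fun d hd => by
    simp only [s, hd, sub_self]
  have hsg : ∀ d (g : V' → ℤ), ∑ a, s d a * (g (H.head a) - g (H.tail a)) =
      g (β (G.tail d)) - g (β (G.head d)) := by
    intro d g
    simp only [s, Pi.sub_apply, sub_mul, Finset.sum_sub_distrib]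
    rw [sum_path_mul (hδ' _) g, sum_path_mul (hδ' _) g]
    ring
  have hyg : ∀ γ d, d ∉ Set.range ψ → ∀ (g : V' → ℤ) b,
      s d b * ∑ a, y γ d a * (g (H.head a) - g (H.tail a)) = 0 := by
    intro γ d hd g b
    by_cases hdc : β (G.tail d) = β (G.head d)
    · rw [hs0 d hdc]; simp
    · rw [h.sum_cycle (hcol (h.lift hδ γ) d) g, Finset.sum_eq_zero, neg_zero, mul_zero]
      intro d' hd'
      by_cases hdc' : β (G.tail d') = β (G.head d')
      · rw [hdc', sub_self, mul_zero]
      · rw [h.tensor_cross_cross hδ hξ hanti (Finset.mem_filter.1 hd').2 hdc' hd hdc, zero_mul]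
  refine ⟨fun γ a b => ε a * ε b * ξ (h.lift hδ γ) (ψ a) (ψ b) - K γ a b,
    ⟨fun γ a b => ?_, fun γ b => mem_H1_of_sum_mul fun g => ?_⟩, fun γ a b hab => ?_⟩
  · beta_reduce
    have : K γ a b = -K γ b a := by
      simp only [K, chainWedge, ← Finset.sum_neg_distrib]
      exact Finset.sum_congr rfl fun d _ => by ring
    rw [this, hanti]
    ring
  · have h1 : ∑ a, ε a * ε b * ξ (h.lift hδ γ) (ψ a) (ψ b) * (g (H.head a) - g (H.tail a)) =
        ∑ d with d ∉ Set.range ψ, y γ d b * (g (β (G.head d)) - g (β (G.tail d))) := by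
      have := h.sum_cycle (hcol (h.lift hδ γ) (ψ b)) g
      rw [← Finset.sum_neg_distrib] at this
      rw [← Finset.sum_congr rfl fun d _ => (by
        simp only [y]
        rw [hanti]
        ring : ε b * -(ξ (h.lift hδ γ) d (ψ b) * (g (β (G.head d)) - g (β (G.tail d)))) = _),
        ← Finset.mul_sum, ← this, Finset.mul_sum]
      exact Finset.sum_congr rfl fun a _ => by ring
    have h2 : ∑ a, K γ a b * (g (H.head a) - g (H.tail a)) =
        ∑ d with d ∉ Set.range ψ, y γ d b * (g (β (G.head d)) - g (β (G.tail d))) := by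
      simp only [K, Finset.sum_mul]
      rw [Finset.sum_comm]
      refine Finset.sum_congr rfl fun d hd => ?_
      have e1 := hyg γ d (Finset.mem_filter.1 hd).2 g b
      have e2 := hsg d g
      rw [Finset.mul_sum] at e1
      rw [← neg_sub, ← e2, mul_neg, Finset.mul_sum, ← zero_sub, ← e1, ← Finset.sum_sub_distrib]
      exact Finset.sum_congr rfl fun a _ => by simp only [chainWedge]; ring
    simp only [sub_mul, Finset.sum_sub_distrib]
    rw [h1, h2, sub_self]
  · have hK : H.cyclicSum K γ a b = 0 := by
      simp only [cyclicSum, K, Finset.sum_mul, ← Finset.sum_add_distrib]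
      refine Finset.sum_eq_zero fun d hd => ?_
      by_cases hdc : β (G.tail d) = β (G.head d)
      · simp [chainWedge, hs0 d hdc]
      · have hx := fun i j => h.tensor_exchange hδ hξ (Finset.mem_filter.1 hd).2 hdc (γ i) (γ j)
        simp only [chainWedge, y]
        linear_combination s d b * (γ 2 : E' → ℤ) b * hx 0 1 a +
          s d b * (γ 0 : E' → ℤ) b * hx 1 2 a + s d b * (γ 1 : E' → ℤ) b * hx 2 0 a +
          s d a * (γ 2 : E' → ℤ) a * hx 0 1 b +
          s d a * (γ 0 : E' → ℤ) a * hx 1 2 b + s d a * (γ 1 : E' → ℤ) a * hx 2 0 b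
    have hG := hξ (fun i => h.lift hδ (γ i)) (ψ a) (ψ b) fun e => hab (h.injective e)
    simp only [cyclicSum, chainWedge, h.lift_edge hδ, h.ceresaTensor_edge hδ] at hG hK ⊢
    rcases h.ends a with ⟨ha, -⟩ | ⟨ha, -⟩ <;> rcases h.ends b with ⟨hb, -⟩ | ⟨hb, -⟩ <;>
      simp only [ha, hb] at hG ⊢ <;> linear_combination hG + hK

end Descent

end IsMinorModel

end Contraction

end MultiGraph

/-! ### Construction of adapted paths for a minor. -/

namespace MultiGraph

section Fibration

variable {V E V' E' : Type*} [Fintype E] (G : MultiGraph V E)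

theorem bdry_single [DecidableEq E] (e : E) : G.bdry (Pi.single e 1) =
    Finsupp.single (G.head e) 1 - Finsupp.single (G.tail e) 1 := by
  simp [bdry]

variable {G} in
theorem exists_chain_of_adjVia {S : Set E} {a b : V} (h : G.AdjVia S a b) :
    ∃ c : E → ℤ, G.bdry c = Finsupp.single b 1 - Finsupp.single a 1 ∧ ∀ e, c e ≠ 0 → e ∈ S := by
  classical
  obtain ⟨e, he, ⟨rfl, rfl⟩ | ⟨rfl, rfl⟩⟩ := h
  · refine ⟨Pi.single e 1, G.bdry_single e, fun f hf => ?_⟩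
    by_cases h : f = e
    · rwa [h]
    · exact absurd (Pi.single_eq_of_ne h _) hf
  · refine ⟨-Pi.single e 1, by rw [map_neg, G.bdry_single, neg_sub], fun f hf => ?_⟩
    by_cases h : f = e
    · rwa [h]
    · exact absurd (by rw [Pi.neg_apply, Pi.single_eq_of_ne h, neg_zero]) hf

variable {G} in
theorem exists_chain_of_reflTransGen {S : Set E} {a b : V}
    (h : Relation.ReflTransGen (G.AdjVia S) a b) :
    ∃ c : E → ℤ, G.bdry c = Finsupp.single b 1 - Finsupp.single a 1 ∧ ∀ e, c e ≠ 0 → e ∈ S := by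
  induction h with
  | refl => exact ⟨0, by simp, fun e he => absurd rfl he⟩
  | tail _ h ih =>
    obtain ⟨c, hc, hcS⟩ := ih
    obtain ⟨d, hd, hdS⟩ := exists_chain_of_adjVia h
    refine ⟨c + d, by rw [map_add, hc, hd]; abel, fun e he => ?_⟩
    by_cases h0 : c e = 0
    · exact hdS e fun h1 => he (by rw [Pi.add_apply, h0, h1, add_zero])
    · exact hcS e h0

/-- The branch sets of a minor of a connected graph extend to a partition of the vertices into
connected sets. -/
theorem exists_fibration [Finite V] (hG : G.Connected) [Nonempty V'] {br : V' → Set V} {T : Set E}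
    (root : V' → V) (hroot : ∀ a, root a ∈ br a) (hdisj : ∀ a b, a ≠ b → Disjoint (br a) (br b))
    (hT : ∀ e ∈ T, (∃ a, G.tail e ∈ br a) ∧ ∃ a, G.head e ∈ br a)
    (hconn : ∀ a, ∀ x ∈ br a, ∀ y ∈ br a, Relation.ReflTransGen
      (G.AdjVia {e | e ∉ T ∧ G.tail e ∈ br a ∧ G.head e ∈ br a}) x y) :
    ∃ β : V → V', (∀ a, ∀ x ∈ br a, β x = a) ∧ ∀ w, ∃ c : E → ℤ,
      G.bdry c = Finsupp.single w 1 - Finsupp.single (root (β w)) 1 ∧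
        ∀ e, c e ≠ 0 → e ∉ T ∧ β (G.tail e) = β (G.head e) := by
  classical
  let Good : Set V → Prop := fun S => (∀ a, br a ⊆ S) ∧ ∃ β : V → V',
    (∀ a, ∀ x ∈ br a, β x = a) ∧ ∀ w ∈ S, ∃ c : E → ℤ,
      G.bdry c = Finsupp.single w 1 - Finsupp.single (root (β w)) 1 ∧
        ∀ e, c e ≠ 0 → e ∉ T ∧ G.tail e ∈ S ∧ G.head e ∈ S ∧ β (G.tail e) = β (G.head e)
  have hgood : Good (⋃ a, br a) := by
    refine ⟨fun a => Set.subset_iUnion br a, fun x => if h : ∃ a, x ∈ br a then h.choose else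
      Classical.arbitrary V', ?_⟩
    have hβ : ∀ a, ∀ x ∈ br a, (if h : ∃ a, x ∈ br a then h.choose else
        Classical.arbitrary V') = a := by
      intro a x hx
      have h : ∃ a, x ∈ br a := ⟨a, hx⟩
      rw [dif_pos h]
      by_contra hne
      exact Set.disjoint_left.1 (hdisj _ _ hne) h.choose_spec hx
    refine ⟨hβ, fun w hw => ?_⟩
    obtain ⟨a, ha⟩ := Set.mem_iUnion.1 hw
    obtain ⟨c, hc, hcS⟩ := exists_chain_of_reflTransGen (hconn a _ (hroot a) w ha)
    refine ⟨c, by beta_reduce; rw [hβ a w ha, hc], fun e he => ?_⟩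
    obtain ⟨h1, h2, h3⟩ := hcS e he
    exact ⟨h1, Set.mem_iUnion.2 ⟨a, h2⟩, Set.mem_iUnion.2 ⟨a, h3⟩,
      (hβ a _ h2).trans (hβ a _ h3).symm⟩
  -- Branch sets are enlarged greedily: a maximal good set that misses a vertex can absorb a
  -- neighbour of the set by connectedness.
  obtain ⟨S, -, hS⟩ := (Set.toFinite {S | Good S}).exists_le_maximal hgood
  obtain ⟨hbr, β, hβ, hpath⟩ := hS.prop
  by_cases huniv : ∀ w, w ∈ S
  · refine ⟨β, hβ, fun w => ?_⟩
    obtain ⟨c, hc, hcS⟩ := hpath w (huniv w)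
    exact ⟨c, hc, fun e he => ⟨(hcS e he).1, (hcS e he).2.2.2⟩⟩
  · exfalso
    push Not at huniv
    obtain ⟨w, hw⟩ := huniv
    have hstep : ∃ x ∈ S, ∃ y ∉ S, G.AdjVia Set.univ x y := by
      by_contra! hno
      have : ∀ y, Relation.ReflTransGen (G.AdjVia Set.univ) (root (Classical.arbitrary V')) y →
          y ∈ S := by
        intro y hy
        induction hy with
        | refl => exact hbr _ (hroot _)
        | tail _ h ih =>
          by_contra hy
          exact hno _ ih _ hy h
      exact hw (this w (hG.2 _ w))
    obtain ⟨x, hx, y, hy, hxy⟩ := hstep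
    have hne : ∀ z ∈ S, z ≠ y := fun z hz h => hy (h ▸ hz)
    let β' : V → V' := Function.update β y (β x)
    have hβ' : ∀ z ∈ S, β' z = β z := fun z hz => Function.update_of_ne (hne z hz) _ _
    have hβy : β' y = β x := Function.update_self _ _ _
    have hlift : ∀ c : E → ℤ, (∀ e, c e ≠ 0 → e ∉ T ∧ G.tail e ∈ S ∧ G.head e ∈ S ∧
        β (G.tail e) = β (G.head e)) → ∀ e, c e ≠ 0 → e ∉ T ∧ G.tail e ∈ insert y S ∧
          G.head e ∈ insert y S ∧ β' (G.tail e) = β' (G.head e) := by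
      intro c hc e he
      obtain ⟨h1, h2, h3, h4⟩ := hc e he
      exact ⟨h1, Set.mem_insert_of_mem _ h2, Set.mem_insert_of_mem _ h3, by
        rw [hβ' _ h2, hβ' _ h3, h4]⟩
    have hbig : Good (insert y S) := by
      refine ⟨fun a => (hbr a).trans (Set.subset_insert _ _), β', fun a z hz => ?_, fun z hz => ?_⟩
      · rw [hβ' z (hbr a hz), hβ a z hz]
      · rcases hz with rfl | hz
        · obtain ⟨c, hc, hcS⟩ := hpath x hx
          obtain ⟨e₀, -, he₀⟩ := hxy
          -- The chosen edges have both ends in branch sets, hence in `S`, whereas `e₀` leaves `S`.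
          have hT₀ : e₀ ∉ T := by
            intro h
            obtain ⟨⟨a, ha⟩, b, hb⟩ := hT e₀ h
            rcases he₀ with ⟨-, h2⟩ | ⟨h1, -⟩
            · exact hy (h2 ▸ hbr b hb)
            · exact hy (h1 ▸ hbr a ha)
          obtain ⟨d, hd, hdS⟩ := exists_chain_of_adjVia (G := G) (S := {e₀}) ⟨e₀, rfl, he₀⟩
          refine ⟨c + d, by rw [map_add, hc, hd, hβy]; abel, fun e he => ?_⟩
          by_cases h0 : c e = 0
          · have hee : e = e₀ := hdS e fun h1 => he (by rw [Pi.add_apply, h0, h1, add_zero])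
            subst hee
            have hxS := Set.mem_insert_of_mem z hx
            have hzS := Set.mem_insert z S
            rcases he₀ with ⟨h1, h2⟩ | ⟨h1, h2⟩ <;> rw [h1, h2] <;>
              simp only [hT₀, hxS, hzS, hβy, hβ' x hx, not_false_eq_true, and_self]
          · exact hlift c hcS e h0
        · obtain ⟨c, hc, hcS⟩ := hpath z hz
          exact ⟨c, by rw [hβ' z hz, hc], hlift c hcS⟩
    exact hy (hS.le_of_ge hbig (Set.subset_insert y S) (Set.mem_insert y S))

theorem IsMinor.exists_isMinorModel [Finite V] [Fintype E'] {G : MultiGraph V E}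
    {H : MultiGraph V' E'} (hG : G.Connected) (hm : H.IsMinor G) {δ' : V' → E' → ℤ} {b₀ : V'}
    (hδ' : ∀ b, H.bdry (δ' b) = Finsupp.single b 1 - Finsupp.single b₀ 1) :
    ∃ (β : V → V') (ψ : E' → E) (ε : E' → ℤ) (δ : V → E → ℤ) (w₀ : V),
      G.IsMinorModel H β ψ ε δ δ' ∧
        ∀ w, G.bdry (δ w) = Finsupp.single w 1 - Finsupp.single w₀ 1 := by
  classical
  obtain ⟨br, ψ, hne, hdisj, hψ, hends, hconn⟩ := hm
  have : Nonempty V' := ⟨b₀⟩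
  choose root hroot using hne
  obtain ⟨β, hβ, hpath⟩ := G.exists_fibration hG root hroot hdisj (T := Set.range ψ) (by
    rintro _ ⟨f, rfl⟩
    rcases hends f with ⟨h1, h2⟩ | ⟨h1, h2⟩ <;> exact ⟨⟨_, h1⟩, _, h2⟩) hconn
  choose p hp hpS using hpath
  have hsign : ∀ f, ∃ s : ℤ, (s = 1 ∧ β (G.tail (ψ f)) = H.tail f ∧ β (G.head (ψ f)) = H.head f) ∨
      (s = -1 ∧ β (G.tail (ψ f)) = H.head f ∧ β (G.head (ψ f)) = H.tail f) := by
    intro f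
    rcases hends f with ⟨h1, h2⟩ | ⟨h1, h2⟩
    · exact ⟨1, Or.inl ⟨rfl, hβ _ _ h1, hβ _ _ h2⟩⟩
    · exact ⟨-1, Or.inr ⟨rfl, hβ _ _ h1, hβ _ _ h2⟩⟩
  choose ε hε using hsign
  have hpψ : ∀ w f, p w (ψ f) = 0 := fun w f => by
    by_contra h
    exact (hpS w _ h).1 ⟨f, rfl⟩
  have hpc : ∀ w e, β (G.tail e) ≠ β (G.head e) → p w e = 0 := fun w e he => by
    by_contra h
    exact he (hpS w _ h).2
  -- The edge `ψ f` is prolonged inside the two fibres to join their roots, so that chains of `H`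
  -- lift with boundary supported on roots.
  let q : E' → E → ℤ := fun f => Pi.single (ψ f) 1 + p (G.tail (ψ f)) - p (G.head (ψ f))
  have hq : ∀ f, G.bdry (q f) =
      ε f • (Finsupp.single (root (H.head f)) 1 - Finsupp.single (root (H.tail f)) 1) := by
    intro f
    simp only [q]
    rw [map_sub, map_add, bdry_single, hp, hp]
    rcases hε f with ⟨h0, h1, h2⟩ | ⟨h0, h1, h2⟩ <;> rw [h0, h1, h2]
    · rw [one_smul]; abel
    · rw [neg_one_smul]; abel
  -- The path to `w` lifts the path of `H` to `β w` from root to root, and then runs inside the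
  -- fibre.
  refine ⟨β, ψ, ε, fun w => ∑ f, (δ' (β w) f * ε f) • q f + p w, root b₀,
    ⟨hψ, hε, fun w a => ?_, fun w e he hc => ?_⟩, fun w => ?_⟩
  · rw [Pi.add_apply, hpψ, add_zero, Finset.sum_apply, Finset.sum_eq_single a]
    · simp [q, hpψ, mul_comm]
    · intro f _ hf
      simp [q, hpψ, hψ.eq_iff, Ne.symm hf]
    · exact fun h => absurd (Finset.mem_univ a) h
  · rw [Pi.add_apply, hpc w e hc, add_zero, Finset.sum_apply]
    refine Finset.sum_eq_zero fun f _ => ?_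
    have hfe : e ≠ ψ f := fun h => he ⟨f, h.symm⟩
    simp [q, hpc _ e hc, Pi.single_eq_of_ne hfe]
  · rw [map_add, hp, map_sum]
    have hsum : ∑ f, G.bdry ((δ' (β w) f * ε f) • q f) =
        Finsupp.single (root (β w)) 1 - Finsupp.single (root b₀) 1 := by
      have := congrArg (Finsupp.mapDomain.addMonoidHom root) (hδ' (β w))
      rw [bdry, Fintype.linearCombination_apply, map_sum, map_sub] at this
      simp only [map_zsmul, map_sub, Finsupp.mapDomain.addMonoidHom_apply,
        Finsupp.mapDomain_single] at this
      rw [← this]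
      refine Finset.sum_congr rfl fun f _ => ?_
      have hs : ε f * ε f = 1 := by rcases hε f with ⟨h, -⟩ | ⟨h, -⟩ <;> rw [h] <;> rfl
      rw [map_zsmul, hq, smul_smul, mul_assoc, hs, mul_one]
    rw [hsum]
    abel

end Fibration

/-! ### The obstruction for `K₄` and `L₃`. -/

section Examples

/-- A star of paths in `K₄`. -/
def pathK4 : Fin 4 → Fin 6 → ℤ :=
  ![![0, 0, 0, 0, 0, 0], ![1, 0, 0, 0, 0, 0], ![0, 1, 0, 0, 0, 0], ![0, 0, 1, 0, 0, 0]]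

theorem bdry_pathK4 (b : Fin 4) :
    K4.bdry (pathK4 b) = Finsupp.single b 1 - Finsupp.single 0 1 := by
  fin_cases b <;> simp [bdry, Fintype.linearCombination_apply, Fin.sum_univ_six, pathK4, K4]

theorem mem_H1_K4 {z : Fin 6 → ℤ} (h1 : z 0 = z 3 + z 4) (h2 : z 1 = z 5 - z 3)
    (h3 : z 2 = -z 4 - z 5) : z ∈ K4.H1 := by
  refine mem_H1_of_sum_mul fun g => ?_
  simp only [Fin.sum_univ_six, K4, Matrix.cons_val]
  rw [h1, h2, h3]
  ring

theorem cycle_K4 {z : Fin 6 → ℤ} (hz : z ∈ K4.H1) :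
    z 0 = z 3 + z 4 ∧ z 1 = z 5 - z 3 ∧ z 2 = -z 4 - z 5 := by
  have h1 := sum_cycle_mul hz ![0, 1, 0, 0]
  have h2 := sum_cycle_mul hz ![0, 0, 1, 0]
  have h3 := sum_cycle_mul hz ![0, 0, 0, 1]
  simp [Fin.sum_univ_six, K4] at h1 h2 h3
  omega

theorem not_ceresaSplits_K4 : ¬ K4.CeresaSplits pathK4 := by
  rintro ⟨ξ, ⟨hanti, hcol⟩, hξ⟩
  obtain ⟨c, hc⟩ : ∃ c : K4.H1, (c : Fin 6 → ℤ) = ![1, -1, 0, 1, 0, 0] :=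
    ⟨⟨_, mem_H1_K4 (by decide) (by decide) (by decide)⟩, rfl⟩
  obtain ⟨d, hd⟩ : ∃ d : K4.H1, (d : Fin 6 → ℤ) = ![1, 0, -1, 0, 1, 0] :=
    ⟨⟨_, mem_H1_K4 (by decide) (by decide) (by decide)⟩, rfl⟩
  obtain ⟨e, he⟩ : ∃ e : K4.H1, (e : Fin 6 → ℤ) = ![0, 1, -1, 0, 0, 1] :=
    ⟨⟨_, mem_H1_K4 (by decide) (by decide) (by decide)⟩, rfl⟩
  have h := hξ ![c, d, e]
  -- A bivector of cycles is determined by its entries at pairs of edges outside a spanning tree,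
  -- here the star `{0, 1, 2}`.
  have hX : ∀ c, ξ c 2 4 = ξ c 4 5 ∧ ξ c 1 4 = -ξ c 4 5 - ξ c 3 4 ∧
      ξ c 0 1 = ξ c 3 5 + ξ c 4 5 + ξ c 3 4 ∧ ξ c 0 5 = ξ c 3 5 + ξ c 4 5 ∧
      ξ c 2 3 = ξ c 3 4 + ξ c 3 5 ∧ ξ c 1 3 = -ξ c 3 5 ∧ ξ c 0 3 = -ξ c 3 4 := by
    intro c
    have a := hanti c
    have r := fun b => cycle_K4 (hcol c b)
    have := r 1
    have := r 3
    have := r 4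
    have := r 5
    have := a 3 1
    have := a 4 1
    have := a 3 3
    have := a 4 4
    have := a 5 5
    have := a 4 3
    have := a 5 3
    have := a 5 4
    omega
  have h24 := h 2 4 (by decide)
  have h14 := h 1 4 (by decide)
  have h01 := h 0 1 (by decide)
  have h05 := h 0 5 (by decide)
  have h23 := h 2 3 (by decide)
  have h13 := h 1 3 (by decide)
  have h03 := h 0 3 (by decide)
  simp [cyclicSum, ceresaTensor, chainWedge, hc, hd, he, Fin.sum_univ_six, K4, pathK4]
    at h24 h14 h01 h05 h23 h13 h03
  have := hX c
  have := hX d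
  have := hX e
  -- With `T` the cyclic sum at a pair, `T01 - T05 - T23 - T14 + T24 + T13 + T03` vanishes
  -- identically for bivectors of cycles. For the Ceresa tensor all terms vanish except `T01 = -2`.
  omega

/-- A star of paths in `L₃`. -/
def pathL3 : Fin 3 → Fin 6 → ℤ :=
  ![![0, 0, 0, 0, 0, 0], ![1, 0, 0, 0, 0, 0], ![0, 0, 0, 0, -1, 0]]

theorem bdry_pathL3 (b : Fin 3) :
    L3.bdry (pathL3 b) = Finsupp.single b 1 - Finsupp.single 0 1 := by
  fin_cases b <;> simp [bdry, Fintype.linearCombination_apply, Fin.sum_univ_six, pathL3, L3]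

theorem mem_H1_L3 {z : Fin 6 → ℤ} (h1 : z 2 = z 0 + z 1 - z 3) (h2 : z 4 = z 0 + z 1 - z 5) :
    z ∈ L3.H1 := by
  refine mem_H1_of_sum_mul fun g => ?_
  simp only [Fin.sum_univ_six, L3, Matrix.cons_val]
  rw [h1, h2]
  ring

theorem cycle_L3 {z : Fin 6 → ℤ} (hz : z ∈ L3.H1) :
    z 2 = z 0 + z 1 - z 3 ∧ z 4 = z 0 + z 1 - z 5 := by
  have h1 := sum_cycle_mul hz ![0, 1, 0]
  have h2 := sum_cycle_mul hz ![0, 0, 1]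
  simp [Fin.sum_univ_six, L3] at h1 h2
  omega

theorem not_ceresaSplits_L3 : ¬ L3.CeresaSplits pathL3 := by
  rintro ⟨ξ, ⟨hanti, hcol⟩, hξ⟩
  obtain ⟨c, hc⟩ : ∃ c : L3.H1, (c : Fin 6 → ℤ) = ![-1, 1, 0, 0, 0, 0] :=
    ⟨⟨_, mem_H1_L3 (by decide) (by decide)⟩, rfl⟩
  obtain ⟨d, hd⟩ : ∃ d : L3.H1, (d : Fin 6 → ℤ) = ![1, 0, 1, 0, 1, 0] :=
    ⟨⟨_, mem_H1_L3 (by decide) (by decide)⟩, rfl⟩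
  obtain ⟨e, he⟩ : ∃ e : L3.H1, (e : Fin 6 → ℤ) = ![1, 0, 0, 1, 1, 0] :=
    ⟨⟨_, mem_H1_L3 (by decide) (by decide)⟩, rfl⟩
  obtain ⟨f, hf⟩ : ∃ f : L3.H1, (f : Fin 6 → ℤ) = ![0, 0, 0, 0, -1, 1] :=
    ⟨⟨_, mem_H1_L3 (by decide) (by decide)⟩, rfl⟩
  -- As for `K₄`, entries are expressed through those outside a spanning tree, now `{2, 4}`.
  have hX : ∀ c, ξ c 0 2 = ξ c 0 1 - ξ c 0 3 ∧ ξ c 1 2 = -ξ c 0 1 - ξ c 1 3 ∧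
      ξ c 0 4 = ξ c 0 1 - ξ c 0 5 ∧ ξ c 1 4 = -ξ c 0 1 - ξ c 1 5 ∧
      ξ c 3 4 = -ξ c 0 3 - ξ c 1 3 - ξ c 3 5 ∧
      ξ c 2 4 = -ξ c 0 5 - ξ c 1 5 + ξ c 0 3 + ξ c 1 3 + ξ c 3 5 ∧
      ξ c 2 5 = ξ c 0 5 + ξ c 1 5 - ξ c 3 5 := by
    intro c
    have a := hanti c
    have r := fun b => cycle_L3 (hcol c b)
    have := r 0
    have := r 1
    have := r 3
    have := r 4
    have := r 5
    have := a 0 0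
    have := a 1 1
    have := a 1 0
    have := a 2 0
    have := a 2 1
    have := a 4 0
    have := a 4 1
    have := a 4 3
    have := a 3 0
    have := a 3 1
    have := a 5 0
    have := a 5 1
    have := a 5 3
    omega
  have h := hξ ![d, e, f]
  have h35 := h 3 5 (by decide)
  have h34 := h 3 4 (by decide)
  have h24 := h 2 4 (by decide)
  have h25 := h 2 5 (by decide)
  simp [cyclicSum, ceresaTensor, chainWedge, hd, he, hf, Fin.sum_univ_six, L3, pathL3]
    at h35 h34 h24 h25
  have h := hξ ![c, d, f]
  have h05 := h 0 5 (by decide)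
  have h04 := h 0 4 (by decide)
  have h14 := h 1 4 (by decide)
  have h15 := h 1 5 (by decide)
  simp [cyclicSum, ceresaTensor, chainWedge, hc, hd, hf, Fin.sum_univ_six, L3, pathL3]
    at h05 h04 h14 h15
  have h := hξ ![c, d, e]
  have h02 := h 0 2 (by decide)
  have h03 := h 0 3 (by decide)
  have h13 := h 1 3 (by decide)
  have h12 := h 1 2 (by decide)
  simp [cyclicSum, ceresaTensor, chainWedge, hc, hd, he, Fin.sum_univ_six, L3, pathL3]
    at h02 h03 h13 h12
  have := hX c
  have := hX d
  have := hX e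
  have := hX f
  -- The unknowns cancel in a combination of the twelve equations. The only nonzero entry on the
  -- Ceresa side is `-2`, at `(0, 4)` for the triple `c, d, f`.
  omega

end Examples

/-- The Ceresa period of a connected graph with `K₄` or `L₃` as a minor does not vanish. -/
theorem ceresaPeriod_ne_zero_of_isMinor {V E : Type*} [Finite V] [Fintype E] {G : MultiGraph V E}
    (hG : G.Connected) (h : K4.IsMinor G ∨ L3.IsMinor G) (v : V) : G.ceresaPeriod hG v ≠ 0 := by
  intro h0
  rcases h with h | h
  · obtain ⟨β, ψ, ε, δ, w₀, hm, hδ⟩ := h.exists_isMinorModel hG bdry_pathK4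
    exact not_ceresaSplits_K4
      (hm.ceresaSplits hδ (G.ceresaSplits_of_ceresaPeriod_eq_zero h0 hδ) bdry_pathK4)
  · obtain ⟨β, ψ, ε, δ, w₀, hm, hδ⟩ := h.exists_isMinorModel hG bdry_pathL3
    exact not_ceresaSplits_L3
      (hm.ceresaSplits hδ (G.ceresaSplits_of_ceresaPeriod_eq_zero h0 hδ) bdry_pathL3)

end MultiGraph

theorem mainTheorem2 {V E : Type*} [Fintype V] [Fintype E] (G : MultiGraph V E)
    (hG : G.Connected) :
    (∀ v : V, G.ceresaPeriod hG v ≠ 0 → G.VeryGeneral (G.CeresaNontrivial hG)) ∧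
      (MultiGraph.K4.IsMinor G ∨ MultiGraph.L3.IsMinor G →
        (∀ v : V, G.ceresaPeriod hG v ≠ 0) ∧ G.VeryGeneral (G.CeresaNontrivial hG)) := by
  refine ⟨fun v hv => G.veryGeneral_ceresaNontrivial hG v hv, fun h => ?_⟩
  have hα : ∀ v : V, G.ceresaPeriod hG v ≠ 0 := MultiGraph.ceresaPeriod_ne_zero_of_isMinor hG h
  exact ⟨hα, G.veryGeneral_ceresaNontrivial hG hG.1.some (hα _)⟩
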